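/- Let $(K,v)$ be a valued field with value group $\Gamma=v(K^*)$, and let $\Gamma_{\mathbb Q}=\Gamma\otimes\mathbb Q$. All valuations below are valuations $\mu\colon K[x]\to\Gamma_{\mathbb Q}\cup\{\infty\}$ extending $v$. For such $\mu$ put $\mathcal P_\alpha=\{a\mid\mu(a)\ge\alpha\}$, $\mathcal P_\alpha^+=\{a\mid\mu(a)>\alpha\}$, let $\mathcal G_\mu=\bigoplus_\alpha\mathcal P_\alpha/\mathcal P_\alpha^+$ be the graded algebra, $\operatorname{in}_\mu a\in\mathcal G_\mu$ the initial term of $a$, $\Gamma_\mu$ the value group, $k_\mu$ the residue field (that of the valuation induced on $\operatorname{Frac}(K[x]/\mu^{-1}(\infty))$), and $\kappa(\mu)$ the relative algebraic closure in $k_\mu$ of the residue field of $v$. A key polynomial for $\mu$ is a monic $\phi\in K[x]$ such that $\operatorname{in}_\mu\phi$ is a prime element of $\mathcal G_\mu$ which does not divide $\operatorname{in}_\mu f$ for any nonzero $f$ with $\deg f<\deg\phi$; $\deg(\mu)$ is the least degree of a key polynomial for $\mu$. For $\phi$ monic of positive degree, let $g=\sum_{i\ge0}a_i\phi^i$, $\deg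 a_i<\deg\phi$, be the $\phi$-expansion of $g\in K[x]$. * If $\phi$ is a key polynomial for $\mu$ and $\gamma\in\Gamma_{\mathbb Q}$, $\gamma>\mu(\phi)$, then $[\mu;\phi,\gamma]$ denotes the augmented valuation $g\mapsto\min_i\{\mu(a_i)+i\gamma\}$. * $N_{\mu,\phi}(g)\subset\mathbb Q\times\Gamma_{\mathbb Q}$ is the lower convex hull of the points $(i,\mu(a_i))$ with $\mu(a_i)<\infty$. It is one-sided of slope $-\lambda$ if it is a segment of slope $-\lambda$ whose left endpoint has abscissa $0$ and whose right endpoint has positive abscissa. * Let $e_{\rm rel}(\mu)=(\Gamma_\mu:\Gamma_\mu^0)$, where $\Gamma^0_\mu$ is generated by the values $\mu(a)$ with $a\ne0$, $\deg a<\deg(\mu)$. Let $\phi$ be a key polynomial for $\mu$ of minimal degree, put $e=e_{\rm rel}(\mu)$, and let $u\in\mathcal G_\mu$ be a homogeneous unit of degree $e\,\mu(\phi)$. For $g\neq0$ put $S=\{i\mid\mu(a_i\phi^i)=\mu(g)\}$, $\ell_0=\min S$, $\ell=\max S$, $\ell-\ell_0=de$. The residual polynomial is $R_{\mu,\phi}(g)=R_{\mu,\phi,u}(g)=\sum_{j=0}^d\zeta_jy^j\in\kappa(\mu)[y]$,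 where $\zeta_j=(\operatorname{in}_\mu a_\ell)^{-1}u^{j-d}\operatorname{in}_\mu a_{\ell_0+je}$ if $\ell_0+je\in S$ and $\zeta_j=0$ otherwise; here the $\zeta_j\in\mathcal P_0/\mathcal P_0^+$ are viewed in $k_\mu$. * If $g$ is monic, $n\mid\deg g$ and $n\ne0$ in $K$, the approximate root $\sqrt[n]{g}$ is the monic polynomial $Q$ of degree $\deg(g)/n$ such that the coefficient of $Q^{n-1}$ in the $Q$-expansion of $g$ is zero. **Proposition.** Let $\mu$ be a valuation as above, $\varphi$ a key polynomial for $\mu$, and $g\in K[x]$ a monic polynomial with $\deg(\varphi)\mid\deg(g)$ and $\operatorname{char}(k_\mu)\nmid\deg(g)$. Let $\lambda\in\Gamma_{\mathbb Q}$, $\lambda>\mu(\varphi)$, and suppose that (i) $N_{\mu,\varphi}(g)$ is one-sided of slope $-\lambda$; (ii) for $\mu_\lambda=[\mu;\varphi,\lambda]$ (and any fixed choice of the unit $u$) we have $R_{\mu_\lambda,\varphi}(g)=\psi^n$, with $\psi\in\kappa(\mu_\lambda)[y]$ monic and irreducible. Then: (a) The approximate root $Q=\sqrt[n]{g}$ exists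 and is unique, it is a key polynomial for $\mu_\lambda$, and $R_{\mu_\lambda,\varphi}(Q)=\psi$. (b) If $N_{\mu_\lambda,Q}(g)$ is one-sided of slope $-\lambda_*$, then $\lambda_*>\mu_\lambda(Q)$; and if, moreover, for $\nu=[\mu_\lambda;Q,\lambda_*]$ (and any choice of the unit) we have $R_{\nu,Q}(g)=\psi_*^{n_*}$ with $\psi_*\in\kappa(\nu)[y]$ monic and irreducible, then $n_*<n$. In this case $e_{\rm rel}(\nu)\deg(\psi_*)>1$, and the approximate root $Q_*=\sqrt[n_*]{g}$ exists, is unique, and satisfies $\deg(Q_*)>\deg(Q)$. That is, when the irreducibility test passes from $(\mu,\varphi)$ to $(\mu_\lambda,Q)$ and then to $(\nu,Q_*)$, the second pass is not a refinement step (a step that leaves the degree of the key polynomial unchanged). -/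

import Mathlib

open Polynomial

namespace KeyPol

section Generic

variable {K : Type*} [Field K] {L : Type*} [AddCommGroup L] [LinearOrder L] [IsOrderedAddMonoid L]

/-- `adicCoeff φ g n` is the coefficient `aₙ` of the canonical `φ`-expansion
`g = ∑ aₙ φ ^ n`, `deg aₙ < deg φ`, for `φ` monic of positive degree, computed by successive
division (see `sum_adicCoeff` and `degree_adicCoeff_lt`). -/
noncomputable def adicCoeff (φ : K[X]) : K[X] → ℕ → K[X]
  | g, 0 => g %ₘ φ
  | g, n + 1 => adicCoeff φ (g /ₘ φ) n

/-! ### The graded algebra `⨁ P_α / P_α⁺`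

With `P_α = {a | μ a ≥ α}` and `P_α⁺ = {a | μ a > α}`, the direct sums `⨁ P_α` and `⨁ P_α⁺` are
realised inside the additive monoid algebra of `L` over `K[X]`; the graded algebra is the
quotient of the first one by the second one. -/

/-- The ring `⨁ P_α` of finite sums of elements `a ∈ P_α` placed in degree `α`. -/
noncomputable def reesRing (μ : AddValuation K[X] (WithTop L)) : Subring (AddMonoidAlgebra K[X] L) where
  carrier := {f | ∀ α : L, (α : WithTop L) ≤ μ (f.coeff α)}
  mul_mem' := by
    classical
    intro f g hf hg α
    rw [AddMonoidAlgebra.coeff_mul, Finsupp.sum]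
    refine μ.map_le_sum fun β _ => ?_
    rw [Finsupp.sum]
    refine μ.map_le_sum fun δ _ => ?_
    split_ifs with h
    · subst h
      rw [μ.map_mul, WithTop.coe_add]
      exact add_le_add (hf β) (hg δ)
    · simp
  one_mem' := by
    classical
    intro α
    rw [AddMonoidAlgebra.one_def, AddMonoidAlgebra.coeff_single, Finsupp.single_apply]
    split_ifs with h
    · subst h; simp
    · simp
  add_mem' := by
    intro f g hf hg α
    exact μ.map_le_add (hf α) (hg α)
  zero_mem' := by
    intro α
    simp
  neg_mem' := by
    intro f hf α
    rw [AddMonoidAlgebra.coeff_neg, Finsupp.neg_apply, μ.map_neg]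
    exact hf α

/-- The ideal `⨁ P_α⁺` of `⨁ P_α`. -/
def reesIdeal (μ : AddValuation K[X] (WithTop L)) : Ideal (reesRing μ) where
  carrier := {f | ∀ α : L, (α : WithTop L) < μ (f.1.coeff α)}
  add_mem' := by
    intro f g hf hg α
    exact μ.map_lt_add (hf α) (hg α)
  zero_mem' := by
    intro α
    simp
  smul_mem' := by
    classical
    intro f g hg α
    simp only [smul_eq_mul, Subring.coe_mul]
    rw [AddMonoidAlgebra.coeff_mul, Finsupp.sum]
    refine μ.map_lt_sum' (WithTop.coe_lt_top α) fun β _ => ?_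
    rw [Finsupp.sum]
    refine μ.map_lt_sum' (WithTop.coe_lt_top α) fun δ _ => ?_
    split_ifs with h
    · subst h
      rw [μ.map_mul, WithTop.coe_add]
      exact WithTop.add_lt_add_of_le_of_lt (WithTop.coe_ne_top) (f.2 β) (hg δ)
    · simp

/-- The graded algebra `⨁ P_α / P_α⁺` of `μ`. -/
abbrev AssocGraded (μ : AddValuation K[X] (WithTop L)) : Type _ := reesRing μ ⧸ reesIdeal μ

theorem single_mem_reesRing (μ : AddValuation K[X] (WithTop L)) {α : L} {a : K[X]}
    (h : (α : WithTop L) ≤ μ a) : AddMonoidAlgebra.single α a ∈ reesRing μ := by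
  classical
  intro β
  rw [AddMonoidAlgebra.coeff_single, Finsupp.single_apply]
  split_ifs with hβ
  · exact hβ ▸ h
  · simp

/-- The class of `a ∈ P_α` in `P_α / P_α⁺`, as an element of the graded algebra. -/
noncomputable def homog (μ : AddValuation K[X] (WithTop L)) (α : L) (a : K[X]) (h : (α : WithTop L) ≤ μ a) :
    AssocGraded μ :=
  Ideal.Quotient.mk (reesIdeal μ) ⟨AddMonoidAlgebra.single α a, single_mem_reesRing μ h⟩

theorem untopD_le {L : Type*} [AddCommGroup L] [LinearOrder L] (x : WithTop L) : ((x.untopD 0 : L) : WithTop L) ≤ x := by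
  cases x <;> simp

/-- The initial term of `a`: the class of `a` in degree `μ a`, and `0` if `μ a = ∞`
(see `initial_of_top`). -/
noncomputable def initial (μ : AddValuation K[X] (WithTop L)) (a : K[X]) : AssocGraded μ :=
  homog μ ((μ a).untopD 0) a (untopD_le _)

theorem homog_eq_zero (μ : AddValuation K[X] (WithTop L)) (α : L) (a : K[X])
    (h : (α : WithTop L) < μ a) : homog μ α a h.le = 0 := by
  classical
  refine Ideal.Quotient.eq_zero_iff_mem.2 fun β => ?_
  change _ < μ ((AddMonoidAlgebra.single α a).coeff β)
  rw [AddMonoidAlgebra.coeff_single, Finsupp.single_apply]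
  split_ifs with hβ
  · exact hβ ▸ h
  · simp

theorem homog_congr (μ : AddValuation K[X] (WithTop L)) {α β : L} {a b : K[X]} (hαβ : α = β)
    (hab : a = b) (h : (α : WithTop L) ≤ μ a) (h' : (β : WithTop L) ≤ μ b) :
    homog μ α a h = homog μ β b h' := by
  subst hαβ hab; rfl

theorem homog_add (μ : AddValuation K[X] (WithTop L)) {α : L} {a b : K[X]}
    (ha : (α : WithTop L) ≤ μ a) (hb : (α : WithTop L) ≤ μ b) :
    homog μ α (a + b) (μ.map_le_add ha hb) = homog μ α a ha + homog μ α b hb := by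
  unfold homog
  rw [← map_add]
  congr 1
  ext1
  change AddMonoidAlgebra.single α (a + b) = AddMonoidAlgebra.single α a + AddMonoidAlgebra.single α b
  rw [AddMonoidAlgebra.single_add]

theorem homog_mul (μ : AddValuation K[X] (WithTop L)) {α β : L} {a b : K[X]}
    (ha : (α : WithTop L) ≤ μ a) (hb : (β : WithTop L) ≤ μ b) :
    homog μ (α + β) (a * b) (by rw [μ.map_mul, WithTop.coe_add]; exact add_le_add ha hb) =
      homog μ α a ha * homog μ β b hb := by
  unfold homog
  rw [← map_mul]
  congr 1
  ext1
  change AddMonoidAlgebra.single (α + β) (a * b) =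
    AddMonoidAlgebra.single α a * AddMonoidAlgebra.single β b
  rw [AddMonoidAlgebra.single_mul_single]

theorem initial_of_top (μ : AddValuation K[X] (WithTop L)) {a : K[X]} (h : μ a = ⊤) :
    initial μ a = 0 :=
  homog_eq_zero μ _ a (by rw [h]; exact WithTop.coe_lt_top _)

theorem initial_eq_homog (μ : AddValuation K[X] (WithTop L)) {a : K[X]} {α : L} (h : μ a = α) :
    initial μ a = homog μ α a h.ge :=
  homog_congr μ (by simp [h]) rfl _ _

theorem initial_mul (μ : AddValuation K[X] (WithTop L)) (a b : K[X]) :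
    initial μ (a * b) = initial μ a * initial μ b := by
  by_cases ha : μ a = ⊤
  · rw [initial_of_top μ ha, zero_mul, initial_of_top μ (by rw [μ.map_mul, ha, top_add])]
  by_cases hb : μ b = ⊤
  · rw [initial_of_top μ hb, mul_zero, initial_of_top μ (by rw [μ.map_mul, hb, add_top])]
  obtain ⟨α, hα⟩ := WithTop.ne_top_iff_exists.1 ha
  obtain ⟨β, hβ⟩ := WithTop.ne_top_iff_exists.1 hb
  rw [initial_eq_homog μ hα.symm, initial_eq_homog μ hβ.symm, ← homog_mul,
    initial_eq_homog μ (α := α + β) (by rw [μ.map_mul, ← hα, ← hβ, WithTop.coe_add])]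

theorem initial_congr (μ : AddValuation K[X] (WithTop L)) {a b : K[X]} (h : μ a < μ (b - a)) :
    initial μ a = initial μ b := by
  obtain ⟨α, hα⟩ := WithTop.ne_top_iff_exists.1 (ne_top_of_lt h)
  have hb : μ b = α := by rw [μ.map_eq_of_lt_sub h, hα]
  rw [← hα] at h
  have e := homog_add μ (α := α) (a := a) (b := b - a) hα.le h.le
  rw [homog_eq_zero μ _ _ h, add_zero] at e
  rw [initial_eq_homog μ hα.symm, initial_eq_homog μ hb, ← e]
  exact homog_congr μ rfl (by ring) _ _

/-- (MacLane-Vaquié) key polynomials: monic, `μ`-minimal and `μ`-irreducible. -/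
structure IsKeyPolynomial (μ : AddValuation K[X] (WithTop L)) (φ : K[X]) : Prop where
  monic : φ.Monic
  minimal : ∀ f : K[X], f ≠ 0 → f.degree < φ.degree → ¬ initial μ φ ∣ initial μ f
  irreducible : Prime (initial μ φ)


theorem IsKeyPolynomial.natDegree_pos {μ : AddValuation K[X] (WithTop L)} {φ : K[X]}
    (h : IsKeyPolynomial μ φ) : 0 < φ.natDegree := by
  rcases Nat.eq_zero_or_pos φ.natDegree with h0 | h0
  · exfalso
    have h1 : φ = 1 := eq_one_of_monic_natDegree_zero h.monic h0
    subst h1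
    apply h.irreducible.not_isUnit
    have : initial μ 1 = 1 := by
      rw [initial_eq_homog μ (α := 0) (by simp)]
      rfl
    rw [this]
    exact isUnit_one
  · exact h0

theorem adicCoeff_zero_left (φ : K[X]) (n : ℕ) : adicCoeff φ 0 n = 0 := by
  induction n with
  | zero => simp [adicCoeff]
  | succ n ih => simp [adicCoeff, ih]

theorem adicCoeff_add {φ : K[X]} (hφ : φ.Monic) (f g : K[X]) (n : ℕ) :
    adicCoeff φ (f + g) n = adicCoeff φ f n + adicCoeff φ g n := by
  induction n generalizing f g with
  | zero => simp [adicCoeff, add_modByMonic]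
  | succ n ih =>
    simp only [adicCoeff]
    rw [show (f + g) /ₘ φ = f /ₘ φ + g /ₘ φ from ?_, ih]
    refine (div_modByMonic_unique _ (f %ₘ φ + g %ₘ φ) hφ ⟨?_, ?_⟩).1
    · conv_rhs => rw [← modByMonic_add_div f φ, ← modByMonic_add_div g φ]
      ring
    · exact (degree_add_le _ _).trans_lt
        (max_lt (degree_modByMonic_lt _ hφ) (degree_modByMonic_lt _ hφ))

theorem adicCoeff_sum {φ : K[X]} (hφ : φ.Monic) {ι : Type*} (s : Finset ι) (f : ι → K[X]) (n : ℕ) :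
    adicCoeff φ (∑ i ∈ s, f i) n = ∑ i ∈ s, adicCoeff φ (f i) n := by
  classical
  induction s using Finset.induction_on with
  | empty => simp [adicCoeff_zero_left]
  | insert a s ha ih => rw [Finset.sum_insert ha, Finset.sum_insert ha, adicCoeff_add hφ, ih]

theorem degree_adicCoeff_lt {φ : K[X]} (hφ : φ.Monic) (g : K[X]) (n : ℕ) :
    (adicCoeff φ g n).degree < φ.degree := by
  induction n generalizing g with
  | zero => exact degree_modByMonic_lt _ hφ
  | succ n ih => exact ih _

theorem adicCoeff_eq_zero {φ : K[X]} (hφ : φ.Monic) (h0 : 0 < φ.natDegree) (g : K[X]) (n : ℕ)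
    (hn : g.natDegree < n) : adicCoeff φ g n = 0 := by
  induction n generalizing g with
  | zero => omega
  | succ n ih =>
    rw [adicCoeff]
    by_cases hg : g.natDegree < φ.natDegree
    · have : g /ₘ φ = 0 := (divByMonic_eq_zero_iff hφ).2 (degree_lt_degree hg)
      rw [this, adicCoeff_zero_left]
    · refine ih _ ?_
      rw [natDegree_divByMonic _ hφ]
      omega

/-- The `φ`-expansion `g = ∑ cₙ φ ^ n`. -/
theorem sum_adicCoeff {φ : K[X]} (hφ : φ.Monic) (h0 : 0 < φ.natDegree) (g : K[X]) (N : ℕ)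
    (hN : g.natDegree < N) : ∑ n ∈ Finset.range N, adicCoeff φ g n * φ ^ n = g := by
  induction N generalizing g with
  | zero => omega
  | succ N ih =>
    rw [Finset.sum_range_succ']
    simp only [adicCoeff, pow_zero, mul_one]
    have key : ∑ n ∈ Finset.range N, adicCoeff φ (g /ₘ φ) n * φ ^ n = g /ₘ φ := by
      by_cases hg : g.natDegree < φ.natDegree
      · have : g /ₘ φ = 0 := (divByMonic_eq_zero_iff hφ).2 (degree_lt_degree hg)
        simp [this, adicCoeff_zero_left]
      · refine ih _ ?_
        rw [natDegree_divByMonic _ hφ]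
        omega
    simp only [pow_succ, ← mul_assoc]
    rw [← Finset.sum_mul, key, add_comm, mul_comm]
    exact modByMonic_add_div _ _

theorem adicCoeff_zero_of_lt {φ : K[X]} (hφ : φ.Monic) {a : K[X]} (ha : a.degree < φ.degree) :
    adicCoeff φ a 0 = a := (modByMonic_eq_self_iff hφ).2 ha

theorem adicCoeff_succ_of_lt {φ : K[X]} (hφ : φ.Monic) {a : K[X]} (ha : a.degree < φ.degree)
    (n : ℕ) : adicCoeff φ a (n + 1) = 0 := by
  rw [adicCoeff, (divByMonic_eq_zero_iff hφ).2 ha, adicCoeff_zero_left]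

theorem adicCoeff_mul_pow {φ : K[X]} (hφ : φ.Monic) (f : K[X]) (s k : ℕ) :
    adicCoeff φ (f * φ ^ s) k = if k < s then 0 else adicCoeff φ f (k - s) := by
  induction s generalizing k with
  | zero => simp
  | succ s ih =>
    have e : f * φ ^ (s + 1) = φ * (f * φ ^ s) := by ring
    obtain ⟨h1, h2⟩ := div_modByMonic_unique (f := f * φ ^ (s + 1)) (f * φ ^ s) 0 hφ
      ⟨by rw [e, zero_add], by rw [degree_zero]; exact bot_lt_iff_ne_bot.2 (degree_ne_bot.2 hφ.ne_zero)⟩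
    cases k with
    | zero => simp [adicCoeff, h2]
    | succ k =>
      rw [adicCoeff, h1, ih]
      simp

theorem valuation_mod {μ : AddValuation K[X] (WithTop L)} {φ : K[X]} (h : IsKeyPolynomial μ φ)
    {a b : K[X]} (ha : a.degree < φ.degree) (hb : b.degree < φ.degree) :
    μ ((a * b) %ₘ φ) = μ a + μ b := by
  by_cases ha0 : a = 0
  · simp [ha0]
  by_cases hb0 : b = 0
  · simp [hb0]
  have hdvd : ∀ x c : K[X], μ x < μ (φ * c - x) → initial μ φ ∣ initial μ x := by
    intro x c hx
    rw [initial_congr μ hx, initial_mul]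
    exact dvd_mul_right _ _
  have hd := modByMonic_add_div (a * b) φ
  set r := (a * b) %ₘ φ
  set c := (a * b) /ₘ φ
  rw [← μ.map_mul]
  rcases lt_trichotomy (μ r) (μ (a * b)) with hlt | heq | hgt
  · exfalso
    have hr0 : r ≠ 0 := by
      intro h0
      rw [h0, μ.map_zero] at hlt
      exact not_top_lt hlt
    refine h.minimal r hr0 (degree_modByMonic_lt _ h.monic) (hdvd r (-c) ?_)
    have : φ * -c - r = -(a * b) := by rw [← hd]; ring
    rw [this, μ.map_neg]
    exact hlt
  · exact heq
  · exfalso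
    have h1 : initial μ φ ∣ initial μ (a * b) := by
      refine hdvd (a * b) c ?_
      have : φ * c - a * b = -r := by rw [← hd]; ring
      rw [this, μ.map_neg]
      exact hgt
    rw [initial_mul] at h1
    rcases h.irreducible.dvd_or_dvd h1 with h2 | h2
    · exact h.minimal a ha0 ha h2
    · exact h.minimal b hb0 hb h2

theorem valuation_div {μ : AddValuation K[X] (WithTop L)} {φ : K[X]} (h : IsKeyPolynomial μ φ)
    {a b : K[X]} (ha : a.degree < φ.degree) (hb : b.degree < φ.degree) :
    μ a + μ b ≤ μ φ + μ ((a * b) /ₘ φ) := by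
  rw [← μ.map_mul φ]
  have hd := modByMonic_add_div (a * b) φ
  have : φ * ((a * b) /ₘ φ) = a * b - (a * b) %ₘ φ := by
    rw [eq_sub_iff_add_eq, add_comm]; exact hd
  rw [this]
  exact μ.map_le_sub (μ.map_mul a b).ge (valuation_mod h ha hb).ge

/-! ### Ordinary augmentations -/

/-- `g ↦ min {μ(aₙ) + n γ}`, where `g = ∑ aₙ φ ^ n` is the `φ`-expansion of `g`. -/
noncomputable def augmentFun (μ : AddValuation K[X] (WithTop L)) (φ : K[X]) (γ : L) (g : K[X]) :
    WithTop L :=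
  (Finset.range (g.natDegree + 1)).inf fun n => μ (adicCoeff φ g n) + ((n • γ : L) : WithTop L)

theorem le_augmentFun_iff {μ : AddValuation K[X] (WithTop L)} {φ : K[X]} (h : IsKeyPolynomial μ φ)
    (γ : L) (g : K[X]) (x : WithTop L) :
    x ≤ augmentFun μ φ γ g ↔ ∀ n, x ≤ μ (adicCoeff φ g n) + ((n • γ : L) : WithTop L) := by
  rw [augmentFun, Finset.le_inf_iff]
  refine ⟨fun H n => ?_, fun H n _ => H n⟩
  by_cases hn : n < g.natDegree + 1
  · exact H n (Finset.mem_range.2 hn)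
  · rw [adicCoeff_eq_zero h.monic h.natDegree_pos g n (by omega)]
    simp

theorem augmentFun_le {μ : AddValuation K[X] (WithTop L)} {φ : K[X]} (h : IsKeyPolynomial μ φ)
    (γ : L) (g : K[X]) (n : ℕ) :
    augmentFun μ φ γ g ≤ μ (adicCoeff φ g n) + ((n • γ : L) : WithTop L) :=
  (le_augmentFun_iff h γ g _).1 le_rfl n

theorem exists_min_augmentFun {μ : AddValuation K[X] (WithTop L)} {φ : K[X]}
    (h : IsKeyPolynomial μ φ) (γ : L) (g : K[X]) :
    ∃ n, augmentFun μ φ γ g = μ (adicCoeff φ g n) + ((n • γ : L) : WithTop L) ∧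
      ∀ m < n, augmentFun μ φ γ g < μ (adicCoeff φ g m) + ((m • γ : L) : WithTop L) := by
  classical
  have hex : ∃ n, augmentFun μ φ γ g = μ (adicCoeff φ g n) + ((n • γ : L) : WithTop L) := by
    obtain ⟨n, -, hn⟩ := Finset.exists_mem_eq_inf (Finset.range (g.natDegree + 1))
      ⟨0, by simp⟩ fun n => μ (adicCoeff φ g n) + ((n • γ : L) : WithTop L)
    exact ⟨n, hn⟩
  refine ⟨Nat.find hex, Nat.find_spec hex, fun m hm => ?_⟩
  exact lt_of_le_of_ne (augmentFun_le h γ g m) (Nat.find_min hex hm)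

theorem augmentFun_coeff_term {μ : AddValuation K[X] (WithTop L)} {φ : K[X]}
    (h : IsKeyPolynomial μ φ) (γ : L) (hγ : μ φ < γ) {a b : K[X]} (ha : a.degree < φ.degree)
    (hb : b.degree < φ.degree) (s k : ℕ) :
    (k = s → μ (adicCoeff φ (a * b * φ ^ s) k) + ((k • γ : L) : WithTop L) =
      μ a + μ b + ((s • γ : L) : WithTop L)) ∧
    (k ≠ s → ∀ V : WithTop L, V ≠ ⊤ → V ≤ μ a + μ b + ((s • γ : L) : WithTop L) →
      V < μ (adicCoeff φ (a * b * φ ^ s) k) + ((k • γ : L) : WithTop L)) := by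
  constructor
  · rintro rfl
    rw [adicCoeff_mul_pow h.monic, if_neg (lt_irrefl _), Nat.sub_self, adicCoeff,
      valuation_mod h ha hb]
  · intro hks V hV hle
    rw [adicCoeff_mul_pow h.monic]
    have top : V < μ 0 + ((k • γ : L) : WithTop L) := by
      rw [μ.map_zero, top_add]; exact lt_top_iff_ne_top.2 hV
    split_ifs with hlt
    · exact top
    · obtain ⟨j, rfl⟩ : ∃ j, k = s + (j + 1) := ⟨k - s - 1, by omega⟩
      rw [show s + (j + 1) - s = j + 1 by omega]
      have hc : ((a * b) /ₘ φ).degree < φ.degree := by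
        by_cases hc0 : (a * b) /ₘ φ = 0
        · rw [hc0, degree_zero]
          exact bot_lt_iff_ne_bot.2 (degree_ne_bot.2 h.monic.ne_zero)
        · have h0 := h.natDegree_pos
          refine degree_lt_degree ?_
          rw [natDegree_divByMonic _ h.monic]
          have h1 : (a * b).natDegree ≤ a.natDegree + b.natDegree := natDegree_mul_le
          have h2 : a.natDegree < φ.natDegree := by
            by_cases ha0 : a = 0
            · simpa [ha0] using h0
            · exact natDegree_lt_natDegree ha0 ha
          have h3 : b.natDegree < φ.natDegree := by
            by_cases hb0 : b = 0
            · simpa [hb0] using h0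
            · exact natDegree_lt_natDegree hb0 hb
          omega
      rw [adicCoeff]
      cases j with
      | succ j =>
        rw [adicCoeff_succ_of_lt h.monic hc]
        rw [μ.map_zero, top_add]; exact lt_top_iff_ne_top.2 hV
      | zero =>
        rw [adicCoeff_zero_of_lt h.monic hc]
        have hd := valuation_div h ha hb
        rcases eq_or_ne (μ ((a * b) /ₘ φ)) ⊤ with ht | ht
        · rw [ht, top_add]; exact lt_top_iff_ne_top.2 hV
        · have e : (((s + (0 + 1)) • γ : L) : WithTop L) = (γ : WithTop L) + ((s • γ : L) : WithTop L) := by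
            rw [← WithTop.coe_add, zero_add, succ_nsmul']
          rw [e, ← add_assoc, add_comm (μ ((a * b) /ₘ φ))]
          refine hle.trans_lt ?_
          refine WithTop.add_lt_add_right WithTop.coe_ne_top ?_
          exact hd.trans_lt (WithTop.add_lt_add_right ht hγ)

theorem augmentFun_add {μ : AddValuation K[X] (WithTop L)} {φ : K[X]} (h : IsKeyPolynomial μ φ)
    (γ : L) (f g : K[X]) :
    min (augmentFun μ φ γ f) (augmentFun μ φ γ g) ≤ augmentFun μ φ γ (f + g) := by
  rw [le_augmentFun_iff h]
  intro n
  rw [adicCoeff_add h.monic]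
  refine le_trans ?_ (add_le_add_left (μ.map_add _ _) _)
  rw [min_add]
  exact min_le_min (augmentFun_le h γ f n) (augmentFun_le h γ g n)

theorem valuation_sum_lt (μ : AddValuation K[X] (WithTop L)) {V : WithTop L} (hV : V ≠ ⊤) (c : L)
    {ι : Type*} (s : Finset ι) (f : ι → K[X]) (hf : ∀ i ∈ s, V < μ (f i) + (c : WithTop L)) :
    V < μ (∑ i ∈ s, f i) + (c : WithTop L) := by
  classical
  induction s using Finset.induction_on with
  | empty => simpa using lt_top_iff_ne_top.2 hV
  | insert a s ha ih =>
    rw [Finset.sum_insert ha]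
    refine lt_of_lt_of_le ?_ (add_le_add_left (μ.map_add _ _) _)
    rw [min_add]
    exact lt_min (hf a (Finset.mem_insert_self _ _))
      (ih fun i hi => hf i (Finset.mem_insert_of_mem hi))

theorem valuation_sum_le (μ : AddValuation K[X] (WithTop L)) {V : WithTop L} (c : L)
    {ι : Type*} (s : Finset ι) (f : ι → K[X]) (hf : ∀ i ∈ s, V ≤ μ (f i) + (c : WithTop L)) :
    V ≤ μ (∑ i ∈ s, f i) + (c : WithTop L) := by
  classical
  induction s using Finset.induction_on with
  | empty => simp
  | insert a s ha ih =>
    rw [Finset.sum_insert ha]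
    refine le_trans ?_ (add_le_add_left (μ.map_add _ _) _)
    rw [min_add]
    exact le_min (hf a (Finset.mem_insert_self _ _))
      (ih fun i hi => hf i (Finset.mem_insert_of_mem hi))

theorem augmentFun_mul {μ : AddValuation K[X] (WithTop L)} {φ : K[X]} (h : IsKeyPolynomial μ φ)
    (γ : L) (hγ : μ φ < γ) (f g : K[X]) :
    augmentFun μ φ γ (f * g) = augmentFun μ φ γ f + augmentFun μ φ γ g := by
  classical
  set F := augmentFun μ φ γ f with hF
  set G := augmentFun μ φ γ g with hG
  have hexp : ∀ k, adicCoeff φ (f * g) k =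
      ∑ p ∈ Finset.range (f.natDegree + 1) ×ˢ Finset.range (g.natDegree + 1),
        adicCoeff φ (adicCoeff φ f p.1 * adicCoeff φ g p.2 * φ ^ (p.1 + p.2)) k := by
    intro k
    rw [← adicCoeff_sum h.monic]
    congr 1
    conv_lhs => rw [← sum_adicCoeff h.monic h.natDegree_pos f _ (Nat.lt_succ_self _),
      ← sum_adicCoeff h.monic h.natDegree_pos g _ (Nat.lt_succ_self _)]
    rw [Finset.sum_mul_sum, Finset.sum_product]
    refine Finset.sum_congr rfl fun i _ => Finset.sum_congr rfl fun j _ => ?_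
    ring
  have hsum : ∀ i j : ℕ, μ (adicCoeff φ f i) + μ (adicCoeff φ g j) + (((i + j) • γ : L) : WithTop L) =
      (μ (adicCoeff φ f i) + ((i • γ : L) : WithTop L)) +
        (μ (adicCoeff φ g j) + ((j • γ : L) : WithTop L)) := by
    intro i j
    rw [add_nsmul, WithTop.coe_add]
    abel
  have hge : ∀ i j : ℕ, F + G ≤
      μ (adicCoeff φ f i) + μ (adicCoeff φ g j) + (((i + j) • γ : L) : WithTop L) := by
    intro i j
    rw [hsum]
    exact add_le_add (augmentFun_le h γ f i) (augmentFun_le h γ g j)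
  refine le_antisymm ?_ ?_
  · rcases eq_or_ne (F + G) ⊤ with htop | htop
    · rw [htop]; exact le_top
    · obtain ⟨hFt, hGt⟩ := WithTop.add_ne_top.1 htop
      obtain ⟨i, hi, hi'⟩ := exists_min_augmentFun h γ f
      obtain ⟨j, hj, hj'⟩ := exists_min_augmentFun h γ g
      rw [← hF] at hi hi'
      rw [← hG] at hj hj'
      refine (augmentFun_le h γ (f * g) (i + j)).trans_eq ?_
      have hmain : ∀ p : ℕ × ℕ, p ≠ (i, j) → F + G <
          μ (adicCoeff φ (adicCoeff φ f p.1 * adicCoeff φ g p.2 * φ ^ (p.1 + p.2)) (i + j)) +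
            (((i + j) • γ : L) : WithTop L) := by
        rintro ⟨p, q⟩ hp
        have ht := augmentFun_coeff_term h γ hγ (degree_adicCoeff_lt h.monic f p)
          (degree_adicCoeff_lt h.monic g q) (p + q) (i + j)
        by_cases hk : i + j = p + q
        · rw [ht.1 hk, hsum]
          rcases lt_or_ge p i with hpi | hpi
          · exact WithTop.add_lt_add_of_lt_of_le hGt (hi' p hpi) (augmentFun_le h γ g q)
          · have hqj : q < j := by
              by_contra hqj
              exact hp (Prod.ext (by simp; omega) (by simp; omega))
            exact WithTop.add_lt_add_of_le_of_lt hFt (augmentFun_le h γ f p) (hj' q hqj)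
        · exact ht.2 hk _ htop (hge p q)
      have hij := (augmentFun_coeff_term h γ hγ (degree_adicCoeff_lt h.monic f i)
          (degree_adicCoeff_lt h.monic g j) (i + j) (i + j)).1 rfl
      rw [hsum, ← hi, ← hj] at hij
      have hmem : (i, j) ∈
          Finset.range (f.natDegree + 1) ×ˢ Finset.range (g.natDegree + 1) := by
        rw [Finset.mem_product, Finset.mem_range, Finset.mem_range]
        constructor
        · by_contra hlt
          rw [adicCoeff_eq_zero h.monic h.natDegree_pos f i (by omega), μ.map_zero, top_add] at hi
          exact hFt hi
        · by_contra hlt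
          rw [adicCoeff_eq_zero h.monic h.natDegree_pos g j (by omega), μ.map_zero, top_add] at hj
          exact hGt hj
      rw [hexp, ← Finset.add_sum_erase _ _ hmem]
      rw [← hij]
      congr 1
      refine μ.map_add_eq_of_lt_left ?_
      have hrest := valuation_sum_lt μ (V := F + G) htop ((i + j) • γ)
        ((Finset.range (f.natDegree + 1) ×ˢ Finset.range (g.natDegree + 1)).erase (i, j))
        (fun p => adicCoeff φ (adicCoeff φ f p.1 * adicCoeff φ g p.2 * φ ^ (p.1 + p.2)) (i + j))
        (fun p hp => hmain p (Finset.ne_of_mem_erase hp))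
      rw [← hij] at hrest
      exact lt_of_add_lt_add_right hrest
  · rw [le_augmentFun_iff h]
    intro k
    rw [hexp]
    refine valuation_sum_le μ _ _ _ fun p _ => ?_
    have ht := augmentFun_coeff_term h γ hγ (degree_adicCoeff_lt h.monic f p.1)
      (degree_adicCoeff_lt h.monic g p.2) (p.1 + p.2) k
    refine (hge p.1 p.2).trans ?_
    by_cases hk : k = p.1 + p.2
    · exact (ht.1 hk).ge
    · by_contra hlt
      rw [not_le] at hlt
      exact lt_irrefl _ (ht.2 hk _ (ne_top_of_lt hlt) hlt.le)

theorem augmentFun_of_lt {μ : AddValuation K[X] (WithTop L)} {φ : K[X]} (h : IsKeyPolynomial μ φ)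
    (γ : L) {a : K[X]} (ha : a.degree < φ.degree) : augmentFun μ φ γ a = μ a := by
  refine le_antisymm ?_ ?_
  · refine (augmentFun_le h γ a 0).trans_eq ?_
    rw [adicCoeff_zero_of_lt h.monic ha]
    simp
  · rw [le_augmentFun_iff h]
    intro n
    cases n with
    | zero => rw [adicCoeff_zero_of_lt h.monic ha]; simp
    | succ n => rw [adicCoeff_succ_of_lt h.monic ha]; simp

/-- The ordinary augmentation `[μ; φ, γ]` of `μ` with respect to a key polynomial `φ` and
`γ > μ φ`; it acts as `∑ aₙ φ ^ n ↦ min {μ(aₙ) + n γ}` on `φ`-expansions. -/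
noncomputable def augment (μ : AddValuation K[X] (WithTop L)) (φ : K[X]) (h : IsKeyPolynomial μ φ)
    (γ : L) (hγ : μ φ < γ) : AddValuation K[X] (WithTop L) :=
  AddValuation.of (augmentFun μ φ γ)
    (by
      have h0 := h.natDegree_pos
      rw [augmentFun_of_lt h γ (a := 0), μ.map_zero]
      rw [degree_zero]
      exact bot_lt_iff_ne_bot.2 (degree_ne_bot.2 h.monic.ne_zero))
    (by
      have h0 := h.natDegree_pos
      rw [augmentFun_of_lt h γ (a := 1), μ.map_one]
      rw [degree_one]
      exact natDegree_pos_iff_degree_pos.1 h0)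
    (augmentFun_add h γ) (augmentFun_mul h γ hγ)


/-! ### Residue fields -/

/-- The valuation induced by `μ` on `K[X] / supp μ`. -/
noncomputable def quotValuation (μ : AddValuation K[X] (WithTop L)) :
    Valuation (K[X] ⧸ μ.supp) (Multiplicative (WithTop L)ᵒᵈ) :=
  AddValuation.toValuation (μ.onQuot le_rfl)

instance suppIsPrime (μ : AddValuation K[X] (WithTop L)) : μ.supp.IsPrime :=
  inferInstanceAs (Ideal.IsPrime (Valuation.supp (AddValuation.toValuation μ)))

theorem nonZeroDivisors_le (μ : AddValuation K[X] (WithTop L)) :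
    nonZeroDivisors (K[X] ⧸ μ.supp) ≤ (quotValuation μ).supp.primeCompl := by
  intro x hx hx'
  have h : (quotValuation μ).supp = 0 := AddValuation.supp_quot_supp μ
  rw [h] at hx'
  exact nonZeroDivisors.ne_zero hx hx'

/-- The valuation induced by `μ` on the field of fractions of `K[X] / supp μ`. -/
noncomputable def fracValuation (μ : AddValuation K[X] (WithTop L)) :
    Valuation (FractionRing (K[X] ⧸ μ.supp)) (Multiplicative (WithTop L)ᵒᵈ) :=
  (quotValuation μ).extendToLocalization (nonZeroDivisors_le μ) _

theorem fracValuation_algebraMap (μ : AddValuation K[X] (WithTop L)) (a : K[X]) :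
    fracValuation μ (algebraMap _ _ (Ideal.Quotient.mk μ.supp a)) =
      Multiplicative.ofAdd (OrderDual.toDual (μ a)) :=
  Valuation.extendToLocalization_apply_map_apply _ _ _ _

/-- The residue field of `μ`: the residue field of the valuation induced by `μ` on the field of
fractions of `K[X] / supp μ`. -/
abbrev ResidueFieldOf (μ : AddValuation K[X] (WithTop L)) : Type _ :=
  IsLocalRing.ResidueField (fracValuation μ).valuationSubring

/-- `P₀ = {a | μ a ≥ 0}`. -/
def gradeGEZero (μ : AddValuation K[X] (WithTop L)) : Subring K[X] where
  carrier := {a | 0 ≤ μ a}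
  mul_mem' := fun {a b} ha hb => by
    change 0 ≤ μ (a * b)
    rw [μ.map_mul]
    exact add_nonneg ha hb
  one_mem' := μ.map_one.ge
  add_mem' := fun ha hb => μ.map_le_add ha hb
  zero_mem' := by simp
  neg_mem' := fun {a} ha => by
    change 0 ≤ μ (-a)
    rw [μ.map_neg]
    exact ha

/-- `P₀⁺ = {a | μ a > 0}`. -/
def gradeGTZero (μ : AddValuation K[X] (WithTop L)) : Ideal (gradeGEZero μ) where
  carrier := {a | 0 < μ a}
  add_mem' := fun ha hb => μ.map_lt_add ha hb
  zero_mem' := by simp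
  smul_mem' := fun c a ha => by
    change 0 < μ (c.1 * a.1)
    rw [μ.map_mul]
    exact lt_of_lt_of_le ha (le_add_of_nonneg_left c.2)

/-- The ring `Δ = P₀ / P₀⁺`. -/
abbrev GradeZero (μ : AddValuation K[X] (WithTop L)) : Type _ := gradeGEZero μ ⧸ gradeGTZero μ

/-- `P₀ → ⨁ P_α / P_α⁺`, placing `a` in degree zero. -/
noncomputable def gradeGEZeroToGraded (μ : AddValuation K[X] (WithTop L)) :
    gradeGEZero μ →+* AssocGraded μ where
  toFun a := homog μ 0 a.1 a.2
  map_one' := rfl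
  map_zero' := homog_eq_zero μ 0 0 (by simp)
  map_add' a b := homog_add μ a.2 b.2
  map_mul' a b := by
    rw [← homog_mul μ a.2 b.2]
    exact homog_congr μ (add_zero 0).symm rfl _ _

/-- The canonical embedding of `Δ` into the graded algebra (as its degree zero part). -/
noncomputable def gradeZeroToGraded (μ : AddValuation K[X] (WithTop L)) :
    GradeZero μ →+* AssocGraded μ :=
  Ideal.Quotient.lift (gradeGTZero μ) (gradeGEZeroToGraded μ) fun a ha => homog_eq_zero μ 0 a.1 ha

/-- The residue map from `P₀` to the residue field of `μ`. -/
noncomputable def gradeGEZeroToResidue (μ : AddValuation K[X] (WithTop L)) :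
    gradeGEZero μ →+* ResidueFieldOf μ :=
  (IsLocalRing.residue (fracValuation μ).valuationSubring).comp
    ((((algebraMap (K[X] ⧸ μ.supp) (FractionRing (K[X] ⧸ μ.supp))).comp
      (Ideal.Quotient.mk μ.supp)).comp (gradeGEZero μ).subtype).codRestrict
        (fracValuation μ).valuationSubring fun a => by
          change fracValuation μ (algebraMap _ _ (Ideal.Quotient.mk μ.supp a.1)) ≤ 1
          rw [fracValuation_algebraMap]
          exact a.2)

theorem gradeGEZeroToResidue_eq_zero (μ : AddValuation K[X] (WithTop L)) (a : gradeGEZero μ)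
    (ha : 0 < μ a.1) : gradeGEZeroToResidue μ a = 0 := by
  refine (IsLocalRing.residue_eq_zero_iff _).2 ?_
  rw [Valuation.mem_maximalIdeal_iff]
  change fracValuation μ (algebraMap _ _ (Ideal.Quotient.mk μ.supp a.1)) < 1
  rw [fracValuation_algebraMap]
  exact ha

/-- The canonical embedding of `Δ` into the residue field of `μ`. -/
noncomputable def gradeZeroToResidue (μ : AddValuation K[X] (WithTop L)) :
    GradeZero μ →+* ResidueFieldOf μ :=
  Ideal.Quotient.lift (gradeGTZero μ) (gradeGEZeroToResidue μ) fun a ha =>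
    gradeGEZeroToResidue_eq_zero μ a ha

/-- The residue field `k` of the restriction of `μ` to `K`. -/
abbrev BaseResidueField (μ : AddValuation K[X] (WithTop L)) : Type _ :=
  IsLocalRing.ResidueField (AddValuation.toValuation (μ.comap C)).valuationSubring


/-- The residue map from the valuation ring of `K` to the residue field of `μ`. -/
noncomputable def baseToResidue (μ : AddValuation K[X] (WithTop L)) :
    (AddValuation.toValuation (μ.comap C)).valuationSubring →+* ResidueFieldOf μ :=
  (gradeGEZeroToResidue μ).comp
    ((C.comp (AddValuation.toValuation (μ.comap C)).valuationSubring.subtype).codRestrict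
      (gradeGEZero μ) fun a => a.2)

instance baseToResidue_isLocalHom (μ : AddValuation K[X] (WithTop L)) :
    IsLocalHom (baseToResidue μ) where
  map_nonunit a ha := by
    by_contra hn
    have h1 : a ∈ IsLocalRing.maximalIdeal (AddValuation.toValuation (μ.comap C)).valuationSubring :=
      (IsLocalRing.mem_maximalIdeal a).2 hn
    rw [Valuation.mem_maximalIdeal_iff] at h1
    have h2 : (0 : WithTop L) < μ (C (a : K)) := h1
    have h3 : baseToResidue μ a = 0 := gradeGEZeroToResidue_eq_zero μ _ h2
    rw [h3] at ha
    exact not_isUnit_zero ha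

noncomputable instance baseResidueAlgebra (μ : AddValuation K[X] (WithTop L)) :
    Algebra (BaseResidueField μ) (ResidueFieldOf μ) :=
  (IsLocalRing.ResidueField.lift (baseToResidue μ)).toAlgebra

/-- `κ(μ)`: the relative algebraic closure of `k` in the residue field of `μ`. -/
noncomputable abbrev kappa (μ : AddValuation K[X] (WithTop L)) :
    IntermediateField (BaseResidueField μ) (ResidueFieldOf μ) :=
  algebraicClosure (BaseResidueField μ) (ResidueFieldOf μ)

/-! ### Residual polynomials -/

/-- The degree of `μ`: the minimal degree of a key polynomial for `μ`. -/
noncomputable def degreeOf (μ : AddValuation K[X] (WithTop L)) : ℕ :=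
  sInf {d | ∃ φ : K[X], IsKeyPolynomial μ φ ∧ φ.natDegree = d}

/-- The value group: generated by all finite values of `μ`. -/
def valueGroup (μ : AddValuation K[X] (WithTop L)) : AddSubgroup L :=
  AddSubgroup.closure {γ | ∃ a : K[X], μ a = γ}

/-- The subgroup generated by the values of the nonzero polynomials of degree less than `deg μ`. -/
def valueGroupZero (μ : AddValuation K[X] (WithTop L)) : AddSubgroup L :=
  AddSubgroup.closure {γ | ∃ a : K[X], a ≠ 0 ∧ a.natDegree < degreeOf μ ∧ μ a = γ}

/-- The relative ramification index `e_rel(μ)`. -/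
noncomputable def relRamificationIndex (μ : AddValuation K[X] (WithTop L)) : ℕ :=
  (valueGroupZero μ).relIndex (valueGroup μ)

/-- `S = {n | μ(aₙ φ ^ n) = μ(g)}`, where `g = ∑ aₙ φ ^ n` is the `φ`-expansion of `g`. -/
def minimalIndices (μ : AddValuation K[X] (WithTop L)) (φ g : K[X]) : Set ℕ :=
  {n | μ (adicCoeff φ g n * φ ^ n) = μ g}

/-- The `j`-th residual coefficient of `g` with respect to `μ, φ, u`. With `l₀ = min S`,
`l = max S`, `l = l₀ + d e`, it is `in(a_l)⁻¹ u ^ (j - d) in(a_{l₀ + j e})` if `l₀ + j e ∈ S` (so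
that `j ≤ d`), and zero otherwise. -/
noncomputable def residualCoeff (μ : AddValuation K[X] (WithTop L)) (φ : K[X])
    (u : AssocGraded μ) (g : K[X]) (j : ℕ) : AssocGraded μ :=
  let e := relRamificationIndex μ
  let l₀ := sInf (minimalIndices μ φ g)
  let l := sSup (minimalIndices μ φ g)
  let d := (l - l₀) / e
  open Classical in
  if l₀ + j * e ∈ minimalIndices μ φ g then
    Ring.inverse (initial μ (adicCoeff φ g l)) * Ring.inverse u ^ (d - j) *
      initial μ (adicCoeff φ g (l₀ + j * e))
  else 0

/-- `u` is a homogeneous unit of the graded algebra, of grade `e_rel(μ) μ(φ)`. -/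
def IsNormalizingUnit (μ : AddValuation K[X] (WithTop L)) (φ : K[X]) (u : AssocGraded μ) : Prop :=
  IsUnit u ∧ ∃ b : K[X], μ b = relRamificationIndex μ • μ φ ∧ initial μ b = u

/-- `P` is the residual polynomial `R_{μ,φ,u}(g)`: its coefficients, which lie in `κ(μ)`, are the
residual coefficients of `g`, under the canonical embeddings of `Δ` into the graded algebra and
into the residue field of `μ`. -/
def IsResidualPolynomial (μ : AddValuation K[X] (WithTop L)) (φ : K[X]) (u : AssocGraded μ)
    (g : K[X]) (P : (kappa μ)[X]) : Prop :=
  ∀ j : ℕ, ∃ δ : GradeZero μ, gradeZeroToGraded μ δ = residualCoeff μ φ u g j ∧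
    gradeZeroToResidue μ δ = (P.coeff j : ResidueFieldOf μ)

/-- `Q` is the `n`-th approximate root of `g`, where `n` divides `deg g` and `n ≠ 0` in `K`. -/
structure IsApproximateRoot (g : K[X]) (n : ℕ) (Q : K[X]) : Prop where
  natCast_ne_zero : (n : K) ≠ 0
  monic : Q.Monic
  natDegree_mul : Q.natDegree * n = g.natDegree
  coeff_eq_zero : adicCoeff Q g (n - 1) = 0

/-- The residual polynomial is determined by `μ, φ, u, g`. -/
theorem IsResidualPolynomial.unique {μ : AddValuation K[X] (WithTop L)} {φ : K[X]}
    {u : AssocGraded μ} {g : K[X]} {P P' : (kappa μ)[X]} (h : IsResidualPolynomial μ φ u g P)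
    (h' : IsResidualPolynomial μ φ u g P') : P = P' := by
  classical
  have inj : Function.Injective (gradeZeroToGraded μ) := by
    refine (injective_iff_map_eq_zero _).2 fun a ha => ?_
    obtain ⟨a, rfl⟩ := Ideal.Quotient.mk_surjective a
    have h0 : homog μ 0 a.1 a.2 = 0 := ha
    have h1 : ((0 : L) : WithTop L) < μ ((AddMonoidAlgebra.single (0 : L) a.1).coeff 0) :=
      Ideal.Quotient.eq_zero_iff_mem.1 h0 0
    rw [AddMonoidAlgebra.coeff_single, Finsupp.single_eq_same] at h1
    exact Ideal.Quotient.eq_zero_iff_mem.2 h1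
  ext j
  obtain ⟨δ, h1, h2⟩ := h j
  obtain ⟨δ', h1', h2'⟩ := h' j
  rw [← h2, ← h2', inj (h1.trans h1'.symm)]

end Generic

/-! ### Newton polygons -/

section Newton
variable {K : Type*} [Field K] {L : Type*} [AddCommGroup L] [LinearOrder L] [IsOrderedAddMonoid L]
  [Module ℚ L]

/-- The points `(n, μ(aₙ))` with `aₙ` of finite value, where `g = ∑ aₙ φ ^ n`. -/
def newtonCloud (μ : AddValuation K[X] (WithTop L)) (φ g : K[X]) : Set (ℚ × L) :=
  {P | ∃ n : ℕ, P.1 = n ∧ μ (adicCoeff φ g n) = P.2}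

/-- The Newton polygon: the lower convex hull of the cloud of points `(n, μ(aₙ))`. -/
def newtonPolygon (μ : AddValuation K[X] (WithTop L)) (φ g : K[X]) : Set (ℚ × L) :=
  {P | P ∈ convexHull ℚ (newtonCloud μ φ g) ∧
    ∀ β : L, (P.1, β) ∈ convexHull ℚ (newtonCloud μ φ g) → P.2 ≤ β}

/-- The `lam`-component of `N`: the points `(n, α)` of `N` at which `α + n lam` is minimal. -/
def slopeComponent (N : Set (ℚ × L)) (lam : L) : Set (ℚ × L) :=
  {P | P ∈ N ∧ ∀ P' ∈ N, P.2 + P.1 • lam ≤ P'.2 + P'.1 • lam}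

/-- `N` is one-sided of slope `-lam`: it coincides with its `lam`-component, whose left endpoint has
abscissa zero and whose right endpoint has positive abscissa. -/
def IsOneSided (N : Set (ℚ × L)) (lam : L) : Prop :=
  N = slopeComponent N lam ∧ IsLeast (Prod.fst '' slopeComponent N lam) 0 ∧
    ∃ n' : ℚ, IsGreatest (Prod.fst '' slopeComponent N lam) n' ∧ 0 < n'

end Newton

end KeyPol

open KeyPol

/-!
Let `w` be the augmentation `[μ; φ, λ]` and `x = in(φ)`. The classes of the polynomials of degree less
than `deg φ` form a graded ring of constants in which every nonzero homogeneous element is invertible,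
and the graded algebra of `w` is the polynomial ring in `x` over it (`isMinimalKeyPolynomial_augment`,
`gradedConstants`). With `e` the relative ramification index, every homogeneous element is therefore
a constant times `x ^ s p(x ^ e / u)` for a unique polynomial `p` with `p(0) = 1` over the field `F`
of constants of degree `0` (`GradedConstants.IsHom.exists_eq`, `GradedConstants.normal_form_unique`).
The field `F` is algebraic over the residue field of `K`, hence lies in `κ(w)`
(`constToResidue_mem_kappa`). When the Newton polygon of `g` is one-sided of slope `-λ`, the
element `x` does not divide `in(g)`, and `in(g) = u ^ d p(x ^ e / u)`, where `p`, of degree `d`, is the residual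
polynomial of `g` (`exists_homogenize_eq`).

If the residual polynomial of `g` is `ψ ^ n`, it has coefficients in `F`, and so does `ψ`, which is its
approximate root of order `n` (`exists_map_eq_of_pow`). Hence `in(g) = in(Q₀) ^ n` for a monic lift
`Q₀` of `u ^ f ψ(x ^ e / u)`, `f = deg ψ`. Since `ψ` is prime and `ψ(0) ≠ 0`, unique normal forms show
that `in(Q₀)` behaves like a prime with respect to homogeneous elements, which suffices because the
grading group is ordered (`prime_initial_of_homogeneous`). So `Q₀` is a key polynomial
(`isKeyPolynomial_of_irreducible`). The approximate root `Q` of `g` arises from `Q₀` by substitutions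
`Q ↦ Q + a / n`, with `a` the coefficient of `Q ^ (n - 1)` in `g`. As `w(g - Q ^ n) > n w(Q)` and `n`
is a unit, `w(a / n) > w(Q)`, so each substitution leaves `in(Q)` unchanged
(`exists_isApproximateRoot_initial_eq`). This makes `Q` a key polynomial with residual polynomial `ψ`.

From `in(g) = in(Q) ^ n` it follows also that the Newton polygon of `g` with respect to `Q` has slope
less than `-w(Q)` (`lt_of_initial_eq_pow`). After the next augmentation, let the residual polynomial
of `g` be `ψ₁ ^ n₁`, so that `n = e₁ f₁ n₁` with `f₁ = deg ψ₁`. If `e₁ f₁` were `1`, it would be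
`(y + c) ^ n` with `c ≠ 0`, whose coefficient `n c` of degree `n - 1` does not vanish. But this
coefficient comes from the coefficient of `Q ^ (n - 1)` in `g`, which is zero
(`one_lt_of_isResidualPolynomial_pow`).
-/

namespace KeyPol

/-! ### Approximate roots -/

section Approx

variable {K : Type*} [Field K]

theorem adicCoeff_neg {φ : K[X]} (hφ : φ.Monic) (f : K[X]) (n : ℕ) :
    adicCoeff φ (-f) n = -adicCoeff φ f n := by
  rw [eq_neg_iff_add_eq_zero, ← adicCoeff_add hφ, neg_add_cancel, adicCoeff_zero_left]

theorem adicCoeff_sub {φ : K[X]} (hφ : φ.Monic) (f g : K[X]) (n : ℕ) :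
    adicCoeff φ (f - g) n = adicCoeff φ f n - adicCoeff φ g n := by
  rw [sub_eq_add_neg, adicCoeff_add hφ, adicCoeff_neg hφ, sub_eq_add_neg]

theorem adicCoeff_pow {φ : K[X]} (hφ : φ.Monic) (h0 : 0 < φ.natDegree) (s k : ℕ) :
    adicCoeff φ (φ ^ s) k = if k = s then 1 else 0 := by
  have h1 : (1 : K[X]).degree < φ.degree := by
    rw [degree_one]; exact natDegree_pos_iff_degree_pos.1 h0
  have := adicCoeff_mul_pow hφ 1 s k
  rw [one_mul] at this
  rw [this]
  rcases lt_trichotomy k s with h | h | h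
  · rw [if_pos h, if_neg h.ne]
  · subst h
    simp [adicCoeff_zero_of_lt hφ h1]
  · rw [if_neg (not_lt.2 h.le), if_neg h.ne']
    obtain ⟨j, hj⟩ : ∃ j, k - s = j + 1 := ⟨k - s - 1, by omega⟩
    rw [hj, adicCoeff_succ_of_lt hφ h1]

theorem adicCoeff_eq_zero_of_degree_lt {φ : K[X]} (hφ : φ.Monic)
    {n : ℕ} {f : K[X]} (hf : f.degree < ((n * φ.natDegree : ℕ) : WithBot ℕ)) {i : ℕ} (hi : n ≤ i) :
    adicCoeff φ f i = 0 := by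
  induction n generalizing f i with
  | zero =>
    have : f = 0 := by
      by_contra h
      exact absurd (zero_le_degree_iff.2 h) (not_le.2 (by simpa using hf))
    rw [this, adicCoeff_zero_left]
  | succ n ih =>
    obtain ⟨j, rfl⟩ : ∃ j, i = j + 1 := ⟨i - 1, by omega⟩
    rw [adicCoeff]
    by_cases hq : f /ₘ φ = 0
    · rw [hq, adicCoeff_zero_left]
    refine ih ?_ (by omega)
    have hle : φ.degree ≤ f.degree := by
      by_contra h
      exact hq ((divByMonic_eq_zero_iff hφ).2 (not_le.1 h))
    have hf0 : f ≠ 0 := fun h => hq (by rw [h, zero_divByMonic])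
    rw [degree_eq_natDegree hf0, Nat.cast_lt] at hf
    rw [degree_eq_natDegree hq, Nat.cast_lt, natDegree_divByMonic _ hφ]
    have := natDegree_le_natDegree hle
    rw [Nat.succ_mul] at hf
    omega

theorem degree_sum_mul_pow_lt {φ : K[X]} (hφ : φ.Monic) (c : ℕ → K[X])
    (hc : ∀ i, (c i).degree < φ.degree) (N : ℕ) :
    (∑ i ∈ Finset.range N, c i * φ ^ i).degree < ((N * φ.natDegree : ℕ) : WithBot ℕ) := by
  refine (degree_sum_le _ _).trans_lt ((Finset.sup_lt_iff (WithBot.bot_lt_coe _)).2 fun i hi => ?_)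
  rw [Finset.mem_range] at hi
  by_cases h0 : c i = 0
  · rw [h0, zero_mul, degree_zero]; exact WithBot.bot_lt_coe _
  have h1 := natDegree_lt_natDegree h0 (hc i)
  rw [degree_mul, degree_pow, degree_eq_natDegree h0, degree_eq_natDegree hφ.ne_zero,
    nsmul_eq_mul]
  norm_cast
  calc (c i).natDegree + i * φ.natDegree < φ.natDegree + i * φ.natDegree := by omega
    _ = (i + 1) * φ.natDegree := by ring
    _ ≤ N * φ.natDegree := Nat.mul_le_mul_right _ hi

theorem adicCoeff_sum_mul_pow {φ : K[X]} (hφ : φ.Monic) (c : ℕ → K[X])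
    (hc : ∀ i, (c i).degree < φ.degree) (N j : ℕ) :
    adicCoeff φ (∑ i ∈ Finset.range N, c i * φ ^ i) j = if j < N then c j else 0 := by
  have key : ∀ i, adicCoeff φ (c i * φ ^ i) j = if i = j then c j else 0 := by
    intro i
    rw [adicCoeff_mul_pow hφ]
    rcases lt_trichotomy j i with h | h | h
    · rw [if_pos h, if_neg h.ne']
    · subst h
      simp [adicCoeff_zero_of_lt hφ (hc _)]
    · rw [if_neg (not_lt.2 h.le), if_neg h.ne]
      obtain ⟨k, hk⟩ : ∃ k, j - i = k + 1 := ⟨j - i - 1, by omega⟩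
      rw [hk, adicCoeff_succ_of_lt hφ (hc i)]
  rw [adicCoeff_sum hφ, Finset.sum_congr rfl fun i _ => key i, Finset.sum_ite_eq']
  simp

/-- The `Q`-expansion of `g` starts with `Q ^ n`, so `g - Q ^ n` has smaller degree. -/
theorem degree_sub_pow_lt {g Q : K[X]} (hg : g.Monic) (hQ : Q.Monic) {n : ℕ}
    (hn : Q.natDegree * n = g.natDegree) :
    (g - Q ^ n).degree < ((n * Q.natDegree : ℕ) : WithBot ℕ) := by
  have h1 : g.degree = ((n * Q.natDegree : ℕ) : WithBot ℕ) := by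
    rw [degree_eq_natDegree hg.ne_zero, ← hn, mul_comm]
  have h2 : (Q ^ n).degree = ((n * Q.natDegree : ℕ) : WithBot ℕ) := by
    rw [degree_eq_natDegree (hQ.pow n).ne_zero, hQ.natDegree_pow]
  rw [← h1]
  exact degree_sub_lt_left (h1.trans h2.symm) hg.ne_zero (by rw [hg, hQ.pow n])

theorem adicCoeff_sub_pow {g Q : K[X]} (hQ : Q.Monic) (h0 : 0 < Q.natDegree) {n i : ℕ}
    (hi : i ≠ n) : adicCoeff Q (g - Q ^ n) i = adicCoeff Q g i := by
  rw [adicCoeff_sub hQ, adicCoeff_pow hQ h0, if_neg hi, sub_zero]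

theorem adicCoeff_eq_one {g Q : K[X]} (hg : g.Monic) (hQ : Q.Monic) (h0 : 0 < Q.natDegree) {n : ℕ}
    (hn : Q.natDegree * n = g.natDegree) : adicCoeff Q g n = 1 := by
  have h := adicCoeff_eq_zero_of_degree_lt hQ (degree_sub_pow_lt hg hQ hn) le_rfl
  rwa [adicCoeff_sub hQ, adicCoeff_pow hQ h0, if_pos rfl, sub_eq_zero] at h

theorem adicCoeff_eq_zero_of_lt {g Q : K[X]} (hg : g.Monic) (hQ : Q.Monic) (h0 : 0 < Q.natDegree)
    {n i : ℕ} (hn : Q.natDegree * n = g.natDegree) (hi : n < i) : adicCoeff Q g i = 0 := by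
  have h := adicCoeff_eq_zero_of_degree_lt hQ (degree_sub_pow_lt hg hQ hn) hi.le
  rwa [adicCoeff_sub_pow hQ h0 hi.ne'] at h

theorem degree_sub_pow_sub_lt {g Q : K[X]} (hg : g.Monic) (hQ : Q.Monic) (h0 : 0 < Q.natDegree)
    {n : ℕ} (hn : Q.natDegree * (n + 1) = g.natDegree) :
    (g - Q ^ (n + 1) - adicCoeff Q g n * Q ^ n).degree < ((n * Q.natDegree : ℕ) : WithBot ℕ) := by
  have hd := degree_sub_pow_lt hg hQ hn
  set h := g - Q ^ (n + 1) with hh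
  have hexp : h = ∑ i ∈ Finset.range (n + 1), adicCoeff Q h i * Q ^ i := by
    have h1 := sum_adicCoeff hQ h0 h (h.natDegree + 1 + (n + 1)) (by omega)
    conv_lhs => rw [← h1]
    symm
    refine Finset.sum_subset (Finset.range_mono (by omega)) fun i _ hi => ?_
    rw [Finset.mem_range, not_lt] at hi
    rw [adicCoeff_eq_zero_of_degree_lt hQ hd hi, zero_mul]
  rw [Finset.sum_range_succ] at hexp
  have hc : adicCoeff Q h n = adicCoeff Q g n := adicCoeff_sub_pow hQ h0 (by omega)
  rw [hc] at hexp
  have : h - adicCoeff Q g n * Q ^ n = ∑ i ∈ Finset.range n, adicCoeff Q h i * Q ^ i := by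
    rw [sub_eq_iff_eq_add]; exact hexp
  rw [this]
  exact degree_sum_mul_pow_lt hQ _ (fun i => degree_adicCoeff_lt hQ h i) n

/-- A coefficient `a` with `deg (a Q ^ n) < n deg Q + D` has degree less than `D`. -/
theorem degree_lt_of_degree_mul_pow_lt {a Q : K[X]} (hQ : Q.Monic) {n D : ℕ}
    (h : (a * Q ^ n).degree < ((n * Q.natDegree + D : ℕ) : WithBot ℕ)) :
    a.degree < (D : WithBot ℕ) := by
  by_cases ha : a = 0
  · rw [ha, degree_zero]; exact WithBot.bot_lt_coe _
  rw [degree_mul, degree_pow, degree_eq_natDegree ha, degree_eq_natDegree hQ.ne_zero,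
    nsmul_eq_mul] at h
  rw [degree_eq_natDegree ha]
  norm_cast at h ⊢
  omega

/-- Approximate roots are characterized by a degree condition. -/
theorem adicCoeff_eq_zero_iff_degree {g Q : K[X]} (hg : g.Monic) (hQ : Q.Monic)
    (h0 : 0 < Q.natDegree) {n : ℕ} (hn : Q.natDegree * (n + 1) = g.natDegree) :
    adicCoeff Q g n = 0 ↔ (g - Q ^ (n + 1)).degree < ((n * Q.natDegree : ℕ) : WithBot ℕ) := by
  have h := degree_sub_pow_sub_lt hg hQ h0 hn
  constructor
  · intro ha
    simpa [ha] using h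
  · intro hd
    have h1 : (adicCoeff Q g n * Q ^ n).degree < ((n * Q.natDegree + 0 : ℕ) : WithBot ℕ) := by
      have : adicCoeff Q g n * Q ^ n = (g - Q ^ (n + 1)) - (g - Q ^ (n + 1) - adicCoeff Q g n * Q ^ n) := by
        ring
      rw [this]
      exact (degree_sub_le _ _).trans_lt (max_lt hd h)
    have h2 := degree_lt_of_degree_mul_pow_lt hQ h1
    by_contra hne
    exact absurd (zero_le_degree_iff.2 hne) (not_le.2 (by simpa using h2))

theorem Monic.add_of_degree_lt {Q c : K[X]} (hQ : Q.Monic) (hc : c.degree < Q.degree) :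
    (Q + c).Monic ∧ (Q + c).natDegree = Q.natDegree :=
  ⟨hQ.add_of_left hc, natDegree_eq_of_degree_eq (degree_add_eq_left_of_degree_lt hc)⟩

/-- The Tschirnhaus substitution `Q ↦ Q + a / n`, where `a` is the coefficient of `Q ^ (n - 1)`,
lowers the degree of that coefficient. -/
theorem degree_adicCoeff_tschirnhaus {g Q : K[X]} (hg : g.Monic) (hQ : Q.Monic)
    (h0 : 0 < Q.natDegree) {n : ℕ} (hn : Q.natDegree * (n + 1) = g.natDegree)
    (hn0 : ((n + 1 : ℕ) : K) ≠ 0) {D : ℕ} (hD : (adicCoeff Q g n).degree < ((D + 1 : ℕ) : WithBot ℕ)) :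
    (adicCoeff (Q + C ((n + 1 : ℕ) : K)⁻¹ * adicCoeff Q g n) g n).degree < (D : WithBot ℕ) := by
  set a := adicCoeff Q g n with ha
  set c := C ((n + 1 : ℕ) : K)⁻¹ * a with hc
  have hca : ((n + 1 : ℕ) : K[X]) * c = a := by
    rw [hc, ← mul_assoc, ← C_eq_natCast, ← C_mul, mul_inv_cancel₀ hn0, C_1, one_mul]
  have hcdeg : c.degree ≤ a.degree := by
    rw [hc]
    refine (degree_mul_le _ _).trans ?_
    exact (add_le_add_left degree_C_le _).trans (by simp)
  have haQ : a.degree < Q.degree := degree_adicCoeff_lt hQ g n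
  obtain ⟨hQ', hd'⟩ := Monic.add_of_degree_lt hQ (hcdeg.trans_lt haQ)
  set Q' := Q + c with hQ'def
  have hcD : c.degree ≤ (D : WithBot ℕ) := by
    refine hcdeg.trans ?_
    by_cases ha0 : a = 0
    · rw [ha0, degree_zero]; exact bot_le
    rw [degree_eq_natDegree ha0] at hD ⊢
    norm_cast at hD ⊢
    omega
  -- With `Q' = Q + c` and `(n + 1) c = a`, the difference `Q' ^ (n + 1) - Q ^ (n + 1) - a Q ^ n`
  -- equals `c Y`, and `deg Y < n deg Q` because the leading terms of `Q' ^ i` and `Q ^ i` cancel.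
  set Y := ∑ i ∈ Finset.range (n + 1), (Q' ^ i - Q ^ i) * Q ^ (n - i) with hY
  have hYdeg : Y.degree < ((n * Q.natDegree : ℕ) : WithBot ℕ) ∨ Y = 0 := by
    by_cases hY0 : Y = 0
    · exact Or.inr hY0
    left
    refine (degree_sum_le _ _).trans_lt ((Finset.sup_lt_iff (WithBot.bot_lt_coe _)).2 fun i hi => ?_)
    rw [Finset.mem_range] at hi
    have h1 : (Q' ^ i - Q ^ i).degree < ((i * Q.natDegree : ℕ) : WithBot ℕ) := by
      rw [← hd']
      have h2 : (Q ^ i).degree = ((i * Q'.natDegree : ℕ) : WithBot ℕ) := by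
        rw [degree_eq_natDegree (hQ.pow i).ne_zero, hQ.natDegree_pow, hd']
      have h3 : (Q' ^ i).degree = ((i * Q'.natDegree : ℕ) : WithBot ℕ) := by
        rw [degree_eq_natDegree (hQ'.pow i).ne_zero, hQ'.natDegree_pow]
      rw [← h3]
      exact degree_sub_lt_left (h3.trans h2.symm) (hQ'.pow i).ne_zero (by rw [hQ'.pow i, hQ.pow i])
    by_cases hz : Q' ^ i - Q ^ i = 0
    · rw [hz, zero_mul, degree_zero]; exact WithBot.bot_lt_coe _
    rw [degree_mul, degree_pow, degree_eq_natDegree hQ.ne_zero, degree_eq_natDegree hz,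
      nsmul_eq_mul]
    rw [degree_eq_natDegree hz] at h1
    norm_cast at h1 ⊢
    calc _ < i * Q.natDegree + (n - i) * Q.natDegree := by omega
      _ = n * Q.natDegree := by rw [← add_mul]; congr 1; omega
  have hcY : (c * Y).degree < ((n * Q.natDegree + D : ℕ) : WithBot ℕ) := by
    rcases hYdeg with hYdeg | hY0
    · by_cases hc0 : c = 0
      · rw [hc0, zero_mul, degree_zero]; exact WithBot.bot_lt_coe _
      by_cases hY0 : Y = 0
      · rw [hY0, mul_zero, degree_zero]; exact WithBot.bot_lt_coe _
      rw [degree_mul, degree_eq_natDegree hc0, degree_eq_natDegree hY0]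
      rw [degree_eq_natDegree hc0] at hcD
      rw [degree_eq_natDegree hY0] at hYdeg
      norm_cast at hcD hYdeg ⊢
      omega
    · rw [hY0, mul_zero, degree_zero]; exact WithBot.bot_lt_coe _
  have hgeom : Q' ^ (n + 1) - Q ^ (n + 1) - a * Q ^ n = c * Y := by
    have h1 := (Commute.all Q' Q).mul_geom_sum₂ (n + 1)
    rw [← h1, show Q' - Q = c by rw [hQ'def]; ring, hY, ← hca]
    simp only [sub_mul, Finset.sum_sub_distrib, mul_sub, Nat.add_sub_cancel]
    congr 1
    have : ∀ i ∈ Finset.range (n + 1), Q ^ i * Q ^ (n - i) = Q ^ n := by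
      intro i hi
      rw [Finset.mem_range] at hi
      rw [← pow_add]; congr 1; omega
    rw [Finset.sum_congr rfl this, Finset.sum_const, Finset.card_range, nsmul_eq_mul]
    ring
  have h1 : (g - Q' ^ (n + 1)).degree < ((n * Q.natDegree + D : ℕ) : WithBot ℕ) := by
    have : g - Q' ^ (n + 1) = (g - Q ^ (n + 1) - a * Q ^ n) - c * Y := by rw [← hgeom]; ring
    rw [this]
    refine (degree_sub_le _ _).trans_lt (max_lt ?_ hcY)
    refine (degree_sub_pow_sub_lt hg hQ h0 hn).trans_le ?_
    norm_cast
    omega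
  have h2 := degree_sub_pow_sub_lt hg hQ' (by rw [hd']; exact h0) (n := n) (by rw [hd']; exact hn)
  refine degree_lt_of_degree_mul_pow_lt hQ' (n := n) ?_
  have : adicCoeff Q' g n * Q' ^ n =
      (g - Q' ^ (n + 1)) - (g - Q' ^ (n + 1) - adicCoeff Q' g n * Q' ^ n) := by ring
  rw [this, hd']
  rw [hd'] at h2
  refine (degree_sub_le _ _).trans_lt (max_lt h1 (h2.trans_le ?_))
  norm_cast
  omega

/-- Existence of approximate roots, by iterated Tschirnhaus substitutions from any monic
polynomial of the right degree; a property stable under the substitutions passes from the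
starting polynomial to the root. -/
theorem exists_isApproximateRoot_of_tschirnhaus {g : K[X]} (hg : g.Monic) {n k : ℕ} (hk : 0 < k)
    (hn : k * n = g.natDegree) (hn0 : (n : K) ≠ 0) (P : K[X] → Prop)
    (hP : ∀ Q : K[X], Q.Monic → Q.natDegree = k → P Q →
      P (Q + C (n : K)⁻¹ * adicCoeff Q g (n - 1)))
    {Q : K[X]} (hQ : Q.Monic) (hQk : Q.natDegree = k) (hPQ : P Q) :
    ∃ R : K[X], IsApproximateRoot g n R ∧ P R := by
  obtain ⟨m, rfl⟩ : ∃ m, n = m + 1 := ⟨n - 1, by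
    have : n ≠ 0 := by rintro rfl; simp at hn0
    omega⟩
  simp only [Nat.add_sub_cancel] at hP
  have key : ∀ D : ℕ, ∀ Q : K[X], Q.Monic → Q.natDegree = k → P Q →
      (adicCoeff Q g m).degree < (D : WithBot ℕ) → ∃ R, IsApproximateRoot g (m + 1) R ∧ P R := by
    intro D
    induction D with
    | zero =>
      intro Q hQ hQk hPQ hD
      refine ⟨Q, ⟨hn0, hQ, by rw [hQk, hn], ?_⟩, hPQ⟩
      by_contra hne
      exact absurd (zero_le_degree_iff.2 hne) (not_le.2 (by simpa using hD))
    | succ D ih =>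
      intro Q hQ hQk hPQ hD
      have hc : (C ((m + 1 : ℕ) : K)⁻¹ * adicCoeff Q g m).degree < Q.degree := by
        refine lt_of_le_of_lt ?_ (degree_adicCoeff_lt hQ g m)
        refine (degree_mul_le _ _).trans ?_
        exact (add_le_add_left degree_C_le _).trans (by simp)
      obtain ⟨h1, h2⟩ := Monic.add_of_degree_lt hQ hc
      exact ih _ h1 (h2.trans hQk) (hP Q hQ hQk hPQ)
        (degree_adicCoeff_tschirnhaus hg hQ (hQk ▸ hk) (by rw [hQk, hn]) hn0 hD)
  by_cases ha : adicCoeff Q g m = 0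
  · exact key 0 Q hQ hQk hPQ (by rw [ha, degree_zero]; exact WithBot.bot_lt_coe _)
  · refine key ((adicCoeff Q g m).natDegree + 1) Q hQ hQk hPQ ?_
    rw [degree_eq_natDegree ha]
    exact_mod_cast Nat.lt_succ_self _

theorem exists_isApproximateRoot {g : K[X]} (hg : g.Monic) {n k : ℕ} (hk : 0 < k)
    (hn : k * n = g.natDegree) (hn0 : (n : K) ≠ 0) : ∃ Q : K[X], IsApproximateRoot g n Q := by
  obtain ⟨R, hR, -⟩ := exists_isApproximateRoot_of_tschirnhaus hg hk hn hn0 (fun _ => True)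
    (fun _ _ _ _ => trivial) (monic_X_pow k) (natDegree_X_pow k) trivial
  exact ⟨R, hR⟩

/-- Two monic polynomials of the same degree whose `n`-th powers are close are equal. -/
theorem eq_of_degree_pow_sub_pow_lt {P Q : K[X]} (hP : P.Monic) (hQ : Q.Monic)
    (hd : P.natDegree = Q.natDegree) {n : ℕ} (hn0 : ((n + 1 : ℕ) : K) ≠ 0)
    (h : (P ^ (n + 1) - Q ^ (n + 1)).degree < ((n * Q.natDegree : ℕ) : WithBot ℕ)) : P = Q := by
  by_contra hne
  rw [← (Commute.all P Q).mul_geom_sum₂ (n + 1)] at h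
  set Y := ∑ i ∈ Finset.range (n + 1), P ^ i * Q ^ (n + 1 - 1 - i) with hY
  have hc : Y.coeff (n * Q.natDegree) = ((n + 1 : ℕ) : K) := by
    rw [hY, finsetSum_coeff]
    have : ∀ i ∈ Finset.range (n + 1),
        (P ^ i * Q ^ (n + 1 - 1 - i)).coeff (n * Q.natDegree) = 1 := by
      intro i hi
      rw [Finset.mem_range] at hi
      have hm := (hP.pow i).mul (hQ.pow (n + 1 - 1 - i))
      have h2 : (P ^ i * Q ^ (n + 1 - 1 - i)).natDegree = n * Q.natDegree := by
        rw [(hP.pow i).natDegree_mul (hQ.pow _), hP.natDegree_pow, hQ.natDegree_pow, hd, ← add_mul]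
        congr 1; omega
      rw [← h2]; exact hm
    rw [Finset.sum_congr rfl this]; simp
  have hle : ((n * Q.natDegree : ℕ) : WithBot ℕ) ≤ Y.degree :=
    le_degree_of_ne_zero (by rw [hc]; exact hn0)
  rw [degree_mul] at h
  have h3 : (0 : WithBot ℕ) ≤ (P - Q).degree := zero_le_degree_iff.2 (sub_ne_zero.2 hne)
  exact absurd h (not_lt.2 (hle.trans (le_add_of_nonneg_left h3)))

theorem IsApproximateRoot.eq {g : K[X]} (hg : g.Monic) (hg0 : 0 < g.natDegree) {n : ℕ} {Q Q' : K[X]}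
    (h : IsApproximateRoot g n Q) (h' : IsApproximateRoot g n Q') : Q' = Q := by
  have hn0 := h.natCast_ne_zero
  obtain ⟨m, rfl⟩ : ∃ m, n = m + 1 := ⟨n - 1, by
    have : n ≠ 0 := by rintro rfl; simp at hn0
    omega⟩
  have hd : Q'.natDegree = Q.natDegree :=
    Nat.eq_of_mul_eq_mul_right (Nat.succ_pos m) (h'.natDegree_mul.trans h.natDegree_mul.symm)
  have hpos : 0 < Q.natDegree := by
    rcases Nat.eq_zero_or_pos Q.natDegree with h0 | h0
    · have := h.natDegree_mul
      rw [h0, zero_mul] at this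
      omega
    · exact h0
  refine eq_of_degree_pow_sub_pow_lt h'.monic h.monic hd hn0 ?_
  have h1 := (adicCoeff_eq_zero_iff_degree hg h.monic hpos h.natDegree_mul).1 h.coeff_eq_zero
  have h2 := (adicCoeff_eq_zero_iff_degree hg h'.monic (hd ▸ hpos) h'.natDegree_mul).1
    h'.coeff_eq_zero
  rw [hd] at h2
  have : Q' ^ (m + 1) - Q ^ (m + 1) = (g - Q ^ (m + 1)) - (g - Q' ^ (m + 1)) := by ring
  rw [this]
  exact (degree_sub_le _ _).trans_lt (max_lt h1 h2)

/-- If a power `ψ ^ n` of a monic polynomial has coefficients in a subfield in which `n ≠ 0`, so has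
`ψ`: it is the approximate root of `ψ ^ n`, which can be computed over the subfield. -/
theorem exists_map_eq_of_pow {F k : Type*} [Field F] [Field k] (ι : F →+* k) {ψ : k[X]}
    (hψ : ψ.Monic) (hpos : 0 < ψ.natDegree) {n : ℕ} (hn0 : (n : F) ≠ 0) {P : F[X]}
    (hP : P.map ι = ψ ^ n) :
    ∃ ψ₀ : F[X], ψ₀.Monic ∧ ψ₀.map ι = ψ ∧ P = ψ₀ ^ n := by
  obtain ⟨m, rfl⟩ : ∃ m, n = m + 1 := ⟨n - 1, by
    have : n ≠ 0 := by rintro rfl; simp at hn0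
    omega⟩
  have hPm : P.Monic := by
    have h := hψ.pow (m + 1)
    rw [← hP] at h
    exact monic_of_injective ι.injective h
  have hPd : ψ.natDegree * (m + 1) = P.natDegree := by
    rw [← natDegree_map ι, hP, hψ.natDegree_pow, mul_comm]
  obtain ⟨Q, hQ⟩ := exists_isApproximateRoot hPm hpos hPd hn0
  have hd : Q.natDegree = ψ.natDegree :=
    Nat.eq_of_mul_eq_mul_right (Nat.succ_pos m) (hQ.natDegree_mul.trans hPd.symm)
  have h1 := (adicCoeff_eq_zero_iff_degree hPm hQ.monic (hd ▸ hpos) hQ.natDegree_mul).1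
    hQ.coeff_eq_zero
  have hmap : Q.map ι = ψ := by
    refine eq_of_degree_pow_sub_pow_lt (hQ.monic.map ι) hψ (by rw [natDegree_map, hd])
      (n := m) ?_ ?_
    · rw [← map_natCast ι]
      exact (map_ne_zero ι).2 hn0
    · have : Q.map ι ^ (m + 1) - ψ ^ (m + 1) = -(P - Q ^ (m + 1)).map ι := by
        rw [Polynomial.map_sub, hP, Polynomial.map_pow]; ring
      rw [this, degree_neg, degree_map, ← hd]
      exact h1
  refine ⟨Q, hQ.monic, hmap, map_injective ι ι.injective ?_⟩
  rw [hP, Polynomial.map_pow, hmap]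

end Approx

/-! ### Initial terms and homogeneous primes of the graded algebra -/

section Graded

variable {K : Type*} [Field K] {L : Type*} [AddCommGroup L] [LinearOrder L] [IsOrderedAddMonoid L]
variable (w : AddValuation K[X] (WithTop L))

/-- The ring structure of the quotient, recorded for `AssocGraded` itself: instance search then
returns one fixed term, against which rewriting lemmas unify. -/
noncomputable instance assocGradedCommRing : CommRing (AssocGraded w) :=
  Ideal.Quotient.commRing (reesIdeal w)

/-- The ring structure of the quotient, recorded for `GradeZero` itself. -/
noncomputable instance gradeZeroCommRing : CommRing (GradeZero w) :=
  Ideal.Quotient.commRing (gradeGTZero w)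

theorem homog_eq_zero_iff {α : L} {a : K[X]} (h : (α : WithTop L) ≤ w a) :
    homog w α a h = 0 ↔ (α : WithTop L) < w a := by
  classical
  refine ⟨fun h0 => ?_, fun h' => homog_eq_zero w α a h'⟩
  have h1 : (α : WithTop L) < w ((AddMonoidAlgebra.single α a).coeff α) :=
    Ideal.Quotient.eq_zero_iff_mem.1 h0 α
  rwa [AddMonoidAlgebra.coeff_single, Finsupp.single_eq_same] at h1

theorem homog_neg {α : L} {a : K[X]} (h : (α : WithTop L) ≤ w a) :
    homog w α (-a) (by rwa [w.map_neg]) = -homog w α a h := by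
  rw [eq_neg_iff_add_eq_zero, ← homog_add w (by rwa [w.map_neg]) h]
  exact homog_eq_zero w α _ (by simp)

theorem homog_eq_homog_iff {α : L} {a b : K[X]} (ha : (α : WithTop L) ≤ w a)
    (hb : (α : WithTop L) ≤ w b) : homog w α a ha = homog w α b hb ↔ (α : WithTop L) < w (a - b) := by
  rw [← sub_eq_zero, sub_eq_add_neg, ← homog_neg w hb, ← homog_add w ha (by rwa [w.map_neg]),
    homog_eq_zero_iff]
  simp only [sub_eq_add_neg]

theorem homog_zero (α : L) : homog w α 0 (by simp) = 0 := homog_eq_zero w α 0 (by simp)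

theorem homog_one : homog w 0 1 (by simp) = 1 := rfl

theorem initial_one : initial w 1 = 1 := by
  rw [initial_eq_homog w (α := 0) (by simp)]
  rfl

theorem initial_pow (a : K[X]) (n : ℕ) : initial w (a ^ n) = initial w a ^ n := by
  induction n with
  | zero => rw [pow_zero, pow_zero, initial_one]
  | succ n ih => rw [pow_succ, pow_succ, initial_mul, ih]

theorem initial_ne_zero {a : K[X]} (h : w a ≠ ⊤) : initial w a ≠ 0 := by
  obtain ⟨α, hα⟩ := WithTop.ne_top_iff_exists.1 h
  rw [initial_eq_homog w hα.symm, Ne, homog_eq_zero_iff, ← hα]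
  exact lt_irrefl _

theorem ne_top_of_initial_ne_zero {a : K[X]} (h : initial w a ≠ 0) : w a ≠ ⊤ :=
  fun h' => h (initial_of_top w h')

/-- Divisibility of initial terms is witnessed by a polynomial. -/
theorem initial_dvd_initial_iff {a b : K[X]} (hb : w b ≠ ⊤) :
    initial w a ∣ initial w b ↔ ∃ c : K[X], w b < w (a * c - b) := by
  classical
  constructor
  · rintro ⟨y, hy⟩
    by_cases ha : w a = ⊤
    · exact absurd hy (by rw [initial_of_top w ha, zero_mul]; exact initial_ne_zero w hb)
    obtain ⟨α, hα⟩ := WithTop.ne_top_iff_exists.1 ha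
    obtain ⟨β, hβ⟩ := WithTop.ne_top_iff_exists.1 hb
    rw [initial_eq_homog w hα.symm, initial_eq_homog w hβ.symm] at hy
    obtain ⟨f, rfl⟩ := Ideal.Quotient.mk_surjective y
    unfold homog at hy
    rw [← map_mul] at hy
    have h1 := Ideal.Quotient.eq.1 hy.symm β
    refine ⟨f.1.coeff (-α + β), ?_⟩
    rw [← hβ]
    have h2 : (((⟨AddMonoidAlgebra.single α a, single_mem_reesRing w hα.le⟩ : reesRing w) * f -
        ⟨AddMonoidAlgebra.single β b, single_mem_reesRing w hβ.le⟩ : reesRing w) :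
          AddMonoidAlgebra K[X] L).coeff β = a * f.1.coeff (-α + β) - b := by
      change (AddMonoidAlgebra.single α a * f.1 - AddMonoidAlgebra.single β b).coeff β = _
      rw [AddMonoidAlgebra.coeff_sub, Finsupp.sub_apply, AddMonoidAlgebra.coeff_single_mul_apply,
        AddMonoidAlgebra.coeff_single, Finsupp.single_eq_same]
    rw [h2] at h1
    exact h1
  · rintro ⟨c, hc⟩
    rw [initial_congr w hc, initial_mul]
    exact dvd_mul_right _ _

theorem initial_eq_initial_iff {a b : K[X]} (ha : w a ≠ ⊤) :
    initial w a = initial w b ↔ w a < w (b - a) := by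
  classical
  refine ⟨fun h => ?_, initial_congr w⟩
  have hb : w b ≠ ⊤ := ne_top_of_initial_ne_zero w (h ▸ initial_ne_zero w ha)
  obtain ⟨α, hα⟩ := WithTop.ne_top_iff_exists.1 ha
  obtain ⟨β, hβ⟩ := WithTop.ne_top_iff_exists.1 hb
  rw [initial_eq_homog w hα.symm, initial_eq_homog w hβ.symm] at h
  have h1 : α = β := by
    by_contra hne
    have h1 := Ideal.Quotient.eq.1 h α
    have h2 : ((⟨AddMonoidAlgebra.single α a, single_mem_reesRing w hα.le⟩ -
        ⟨AddMonoidAlgebra.single β b, single_mem_reesRing w hβ.le⟩ : reesRing w) :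
          AddMonoidAlgebra K[X] L).coeff α = a := by
      change (AddMonoidAlgebra.single α a - AddMonoidAlgebra.single β b).coeff α = _
      rw [AddMonoidAlgebra.coeff_sub, Finsupp.sub_apply, AddMonoidAlgebra.coeff_single,
        AddMonoidAlgebra.coeff_single, Finsupp.single_eq_same,
        Finsupp.single_eq_of_ne hne, sub_zero]
    rw [h2, ← hα] at h1
    exact lt_irrefl _ h1
  subst h1
  have := (homog_eq_homog_iff w _ _).1 h.symm
  rwa [hα] at this

/-- The homogeneous component of degree `α` of an element of `⨁ P_α`, as an element of the graded
algebra. -/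
noncomputable def component (f : reesRing w) (α : L) : AssocGraded w :=
  homog w α (f.1.coeff α) (f.2 α)

/-- A homogeneous element which divides an element divides its components. -/
theorem homog_dvd_component {δ : L} {a : K[X]} (ha : (δ : WithTop L) ≤ w a) {f : reesRing w}
    (h : homog w δ a ha ∣ Ideal.Quotient.mk (reesIdeal w) f) (α : L) :
    homog w δ a ha ∣ component w f α := by
  classical
  obtain ⟨y, hy⟩ := h
  obtain ⟨g, rfl⟩ := Ideal.Quotient.mk_surjective y
  refine ⟨component w g (-δ + α), ?_⟩
  unfold component
  rw [← homog_mul]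
  unfold homog at hy
  rw [← map_mul] at hy
  have h1 : ((α : L) : WithTop L) < w (f.1.coeff α -
      ((AddMonoidAlgebra.single δ a * g.1 : AddMonoidAlgebra K[X] L)).coeff α) :=
    Ideal.Quotient.eq.1 hy α
  rw [AddMonoidAlgebra.coeff_single_mul_apply] at h1
  have h2 : (α : WithTop L) ≤ w (a * g.1.coeff (-δ + α)) := by
    rw [w.map_mul]
    refine (le_of_eq ?_).trans (add_le_add ha (g.2 (-δ + α)))
    rw [← WithTop.coe_add]; congr 1; abel
  rw [(homog_eq_homog_iff w (f.2 α) h2).2 h1]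
  exact homog_congr w (by abel) rfl _ _

/-- A homogeneous element of the graded algebra is prime as soon as it behaves like a prime with
respect to homogeneous elements, because the grading group is ordered. -/
theorem prime_initial_of_homogeneous {a : K[X]} (ha : w a ≠ ⊤) (hunit : ¬ IsUnit (initial w a))
    (H : ∀ b c : K[X], w b ≠ ⊤ → w c ≠ ⊤ → initial w a ∣ initial w b * initial w c →
      initial w a ∣ initial w b ∨ initial w a ∣ initial w c) : Prime (initial w a) := by
  classical
  refine ⟨initial_ne_zero w ha, hunit, ?_⟩
  obtain ⟨δ, hδ⟩ := WithTop.ne_top_iff_exists.1 ha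
  have hH : ∀ (α β : L) (b c : K[X]) (hb : (α : WithTop L) ≤ w b) (hc : (β : WithTop L) ≤ w c),
      initial w a ∣ homog w α b hb * homog w β c hc →
        initial w a ∣ homog w α b hb ∨ initial w a ∣ homog w β c hc := by
    intro α β b c hb hc hd
    rcases hb.lt_or_eq with hb' | hb'
    · left; rw [homog_eq_zero w α b hb']; exact dvd_zero _
    rcases hc.lt_or_eq with hc' | hc'
    · right; rw [homog_eq_zero w β c hc']; exact dvd_zero _
    rw [← initial_eq_homog w hb'.symm, ← initial_eq_homog w hc'.symm] at hd ⊢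
    exact H b c (by rw [← hb']; exact WithTop.coe_ne_top) (by rw [← hc']; exact WithTop.coe_ne_top) hd
  rw [initial_eq_homog w hδ.symm] at hH ⊢
  set p := homog w δ a hδ.le with hp
  -- A degree that is a sum of a degree of `f` and a degree of `g` in only one way gives homogeneous
  -- components whose product is divisible by `p`; remove the one that `p` divides and induct on the
  -- number of terms.
  have key : ∀ N : ℕ, ∀ f g : reesRing w, f.1.coeff.support.card + g.1.coeff.support.card ≤ N →
      p ∣ Ideal.Quotient.mk (reesIdeal w) f * Ideal.Quotient.mk (reesIdeal w) g →
      p ∣ Ideal.Quotient.mk (reesIdeal w) f ∨ p ∣ Ideal.Quotient.mk (reesIdeal w) g := by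
    intro N
    induction N with
    | zero =>
      intro f g hN _
      left
      have : f.1.coeff.support.card = 0 := by omega
      have hf : f = 0 := by
        apply Subtype.ext
        rw [Finset.card_eq_zero, Finsupp.support_eq_empty] at this
        exact AddMonoidAlgebra.coeff_eq_zero.1 this
      rw [hf, map_zero]; exact dvd_zero _
    | succ N ih =>
      intro f g hN hd
      by_cases hf : f.1.coeff.support.Nonempty
      swap
      · left
        have hf : f = 0 := by
          apply Subtype.ext
          rw [Finset.not_nonempty_iff_eq_empty, Finsupp.support_eq_empty] at hf
          exact AddMonoidAlgebra.coeff_eq_zero.1 hf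
        rw [hf, map_zero]; exact dvd_zero _
      by_cases hg : g.1.coeff.support.Nonempty
      swap
      · right
        have hg : g = 0 := by
          apply Subtype.ext
          rw [Finset.not_nonempty_iff_eq_empty, Finsupp.support_eq_empty] at hg
          exact AddMonoidAlgebra.coeff_eq_zero.1 hg
        rw [hg, map_zero]; exact dvd_zero _
      obtain ⟨α, hα, β, hβ, hu⟩ := UniqueSums.uniqueAdd_of_nonempty hf hg
      have hcoef : (f.1 * g.1).coeff (α + β) = f.1.coeff α * g.1.coeff β :=
        AddMonoidAlgebra.coeff_mul_add_of_uniqueAdd hu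
      have hprod : p ∣ component w f α * component w g β := by
        rw [← map_mul] at hd
        have := homog_dvd_component w hδ.le hd (α + β)
        have e : component w (f * g) (α + β) = component w f α * component w g β := by
          unfold component
          rw [← homog_mul]
          exact homog_congr w rfl hcoef _ _
        rwa [e] at this
      have hsub : ∀ (f : reesRing w) (α : L), α ∈ f.1.coeff.support → p ∣ component w f α →
          ∃ f' : reesRing w, f'.1.coeff.support.card < f.1.coeff.support.card ∧
            p ∣ Ideal.Quotient.mk (reesIdeal w) f - Ideal.Quotient.mk (reesIdeal w) f' := by
        intro f α hα hdiv
        refine ⟨f - ⟨AddMonoidAlgebra.single α (f.1.coeff α), single_mem_reesRing w (f.2 α)⟩, ?_, ?_⟩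
        · refine Finset.card_lt_card ?_
          refine (Finset.ssubset_iff_of_subset ?_).2 ⟨α, hα, ?_⟩
          · intro β hβ
            rw [Finsupp.mem_support_iff] at hβ ⊢
            intro h0
            apply hβ
            change (f.1 - AddMonoidAlgebra.single α (f.1.coeff α)).coeff β = 0
            rw [AddMonoidAlgebra.coeff_sub, Finsupp.sub_apply, AddMonoidAlgebra.coeff_single,
              Finsupp.single_apply, h0]
            split_ifs with h
            · rw [h, h0, sub_zero]
            · rw [sub_zero]
          · rw [Finsupp.mem_support_iff, not_not]
            change (f.1 - AddMonoidAlgebra.single α (f.1.coeff α)).coeff α = 0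
            rw [AddMonoidAlgebra.coeff_sub, Finsupp.sub_apply, AddMonoidAlgebra.coeff_single,
              Finsupp.single_eq_same, sub_self]
        · rw [map_sub, sub_sub_cancel]
          exact hdiv
      rcases hH _ _ _ _ _ _ hprod with h | h
      · obtain ⟨f', hc, hdf⟩ := hsub f α hα h
        have h1 : p ∣ Ideal.Quotient.mk (reesIdeal w) f' * Ideal.Quotient.mk (reesIdeal w) g := by
          have := dvd_sub hd (hdf.mul_right (Ideal.Quotient.mk (reesIdeal w) g))
          rwa [← sub_mul, sub_sub_cancel] at this
        rcases ih f' g (by omega) h1 with h2 | h2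
        · left
          have := dvd_add hdf h2
          rwa [sub_add_cancel] at this
        · exact Or.inr h2
      · obtain ⟨g', hc, hdg⟩ := hsub g β hβ h
        have h1 : p ∣ Ideal.Quotient.mk (reesIdeal w) f * Ideal.Quotient.mk (reesIdeal w) g' := by
          have := dvd_sub hd (hdg.mul_left (Ideal.Quotient.mk (reesIdeal w) f))
          rwa [← mul_sub, sub_sub_cancel] at this
        rcases ih f g' (by omega) h1 with h2 | h2
        · exact Or.inl h2
        · right
          have := dvd_add hdg h2
          rwa [sub_add_cancel] at this
  intro y z hyz
  obtain ⟨f, rfl⟩ := Ideal.Quotient.mk_surjective y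
  obtain ⟨g, rfl⟩ := Ideal.Quotient.mk_surjective z
  exact key _ f g le_rfl hyz

end Graded

section Key

variable {K : Type*} [Field K] {L : Type*} [AddCommGroup L] [LinearOrder L] [IsOrderedAddMonoid L]
variable {w : AddValuation K[X] (WithTop L)} {φ : K[X]}

theorem IsKeyPolynomial.ne_top (h : IsKeyPolynomial w φ) : w φ ≠ ⊤ :=
  ne_top_of_initial_ne_zero w h.irreducible.ne_zero

/-- Nonzero polynomials of degree less than a key polynomial have finite value. -/
theorem IsKeyPolynomial.ne_top_of_degree_lt (h : IsKeyPolynomial w φ) {a : K[X]} (ha : a ≠ 0)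
    (hd : a.degree < φ.degree) : w a ≠ ⊤ := fun ht =>
  h.minimal a ha hd (by rw [initial_of_top w ht]; exact dvd_zero _)

theorem IsKeyPolynomial.le_modByMonic (h : IsKeyPolynomial w φ) (f : K[X]) : w f ≤ w (f %ₘ φ) := by
  by_contra hlt
  rw [not_le] at hlt
  have hd := modByMonic_add_div f φ
  have h0 : f %ₘ φ ≠ 0 := by
    intro h0; rw [h0, w.map_zero] at hlt; exact not_top_lt hlt
  refine h.minimal _ h0 (degree_modByMonic_lt _ h.monic)
    ((initial_dvd_initial_iff w (ne_top_of_lt hlt)).2 ⟨-(f /ₘ φ), ?_⟩)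
  have : φ * -(f /ₘ φ) - f %ₘ φ = -f := by
    conv_rhs => rw [← hd]
    ring
  rwa [this, w.map_neg]

theorem IsKeyPolynomial.le_divByMonic (h : IsKeyPolynomial w φ) (f : K[X]) :
    w f ≤ w (f /ₘ φ) + w φ := by
  have hd := modByMonic_add_div f φ
  rw [← w.map_mul]
  have : f /ₘ φ * φ = f - f %ₘ φ := by
    rw [eq_sub_iff_add_eq, add_comm, mul_comm]
    exact hd
  rw [this]
  exact w.map_le_sub le_rfl (h.le_modByMonic f)

/-- The value of a polynomial is at most the values of the terms of its expansion with respect to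
a key polynomial. -/
theorem IsKeyPolynomial.le_adicCoeff (h : IsKeyPolynomial w φ) (f : K[X]) (i : ℕ) :
    w f ≤ w (adicCoeff φ f i * φ ^ i) := by
  induction i generalizing f with
  | zero => simpa [adicCoeff] using h.le_modByMonic f
  | succ i ih =>
    rw [adicCoeff, pow_succ, ← mul_assoc, w.map_mul]
    exact (h.le_divByMonic f).trans (add_le_add_left (ih (f /ₘ φ)) _)

/-- The value of a polynomial is attained by some term of its expansion. -/
theorem IsKeyPolynomial.exists_adicCoeff_eq (h : IsKeyPolynomial w φ) {f : K[X]} (hf : w f ≠ ⊤) :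
    ∃ i, w (adicCoeff φ f i * φ ^ i) = w f := by
  by_contra! hne
  have : w f < w f := by
    conv_rhs => rw [← sum_adicCoeff h.monic h.natDegree_pos f _ (Nat.lt_succ_self _)]
    exact w.map_lt_sum hf fun i _ => lt_of_le_of_ne (h.le_adicCoeff f i) (hne i).symm
  exact lt_irrefl _ this

/-- Only the degree and the initial term matter for being a key polynomial. -/
theorem IsKeyPolynomial.of_initial_eq (h : IsKeyPolynomial w φ) {Q : K[X]} (hQ : Q.Monic)
    (hd : Q.degree = φ.degree) (hi : initial w Q = initial w φ) : IsKeyPolynomial w Q :=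
  ⟨hQ, fun f hf hlt => by rw [hi]; exact h.minimal f hf (hd ▸ hlt), hi ▸ h.irreducible⟩

end Key

/-! ### Key polynomials of minimal degree and ordinary augmentations -/

section Minimal

variable {K : Type*} [Field K] {L : Type*} [AddCommGroup L] [LinearOrder L] [IsOrderedAddMonoid L]

/-- A key polynomial `φ` such that `in(a) in(b) = in((a b) mod φ)` for all nonzero `a`, `b` of degree
less than `deg φ`. Then `in(a)` is a unit for these `a`, so `φ` has the least degree among the
key polynomials; ordinary augmentations provide such key polynomials. -/
structure IsMinimalKeyPolynomial (w : AddValuation K[X] (WithTop L)) (φ : K[X]) : Prop extends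
    IsKeyPolynomial w φ where
  lt_mul_sub_modByMonic : ∀ a b : K[X], a ≠ 0 → b ≠ 0 → a.degree < φ.degree → b.degree < φ.degree →
    w (a * b) < w (a * b - (a * b) %ₘ φ)

theorem degree_mul_divByMonic_lt {φ : K[X]} (hφ : φ.Monic) {a b : K[X]} (ha : a.degree < φ.degree)
    (hb : b.degree < φ.degree) : ((a * b) /ₘ φ).degree < φ.degree := by
  by_cases hc0 : (a * b) /ₘ φ = 0
  · rw [hc0, degree_zero]
    exact bot_lt_iff_ne_bot.2 (degree_ne_bot.2 hφ.ne_zero)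
  have ha0 : a ≠ 0 := by rintro rfl; simp at hc0
  have hb0 : b ≠ 0 := by rintro rfl; simp at hc0
  refine degree_lt_degree ?_
  rw [natDegree_divByMonic _ hφ, natDegree_mul ha0 hb0]
  have h2 := natDegree_lt_natDegree ha0 ha
  have h3 := natDegree_lt_natDegree hb0 hb
  omega

section Augment

variable {μ : AddValuation K[X] (WithTop L)} {φ : K[X]} (h : IsKeyPolynomial μ φ) {γ : L}
  (hγ : μ φ < γ)

theorem augment_apply (f : K[X]) : augment μ φ h γ hγ f = augmentFun μ φ γ f := rfl

theorem augment_of_degree_lt {a : K[X]} (ha : a.degree < φ.degree) :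
    augment μ φ h γ hγ a = μ a := augmentFun_of_lt h γ ha

theorem augment_self : augment μ φ h γ hγ φ = γ := by
  rw [augment_apply]
  have hc := fun n => adicCoeff_pow h.monic h.natDegree_pos 1 n
  simp only [pow_one] at hc
  refine le_antisymm ?_ ?_
  · refine (augmentFun_le h γ φ 1).trans_eq ?_
    rw [hc]; simp
  · rw [le_augmentFun_iff h]
    intro n
    rw [hc]
    split_ifs with hn
    · subst hn; simp
    · simp

theorem augment_le_modByMonic (f : K[X]) :
    augment μ φ h γ hγ f ≤ augment μ φ h γ hγ (f %ₘ φ) := by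
  rw [augment_of_degree_lt h hγ (degree_modByMonic_lt f h.monic)]
  have := augmentFun_le h γ f 0
  rw [augment_apply]
  simpa [adicCoeff] using this

theorem initial_dvd_augment_iff {f : K[X]} (hf : augment μ φ h γ hγ f ≠ ⊤) :
    initial (augment μ φ h γ hγ) φ ∣ initial (augment μ φ h γ hγ) f ↔
      augment μ φ h γ hγ f < augment μ φ h γ hγ (f %ₘ φ) := by
  rw [initial_dvd_initial_iff _ hf]
  constructor
  · rintro ⟨c, hc⟩
    have e : f %ₘ φ = -((φ * c - f) %ₘ φ) := by
      rw [sub_modByMonic, (modByMonic_eq_zero_iff_dvd h.monic).2 (dvd_mul_right φ c), zero_sub,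
        neg_neg]
    rw [e, AddValuation.map_neg]
    exact hc.trans_le (augment_le_modByMonic h hγ _)
  · intro hlt
    refine ⟨f /ₘ φ, ?_⟩
    have : φ * (f /ₘ φ) - f = -(f %ₘ φ) := by
      have := modByMonic_add_div f φ
      linear_combination this
    rwa [this, AddValuation.map_neg]

/-- In the augmentation `[μ; φ, γ]`, the polynomial `φ` is a key polynomial of minimal degree. -/
theorem isMinimalKeyPolynomial_augment : IsMinimalKeyPolynomial (augment μ φ h γ hγ) φ := by
  have hd1 : (1 : K[X]).degree < φ.degree := by
    rw [degree_one]; exact natDegree_pos_iff_degree_pos.1 h.natDegree_pos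
  refine { monic := h.monic, minimal := ?_, irreducible := ?_, lt_mul_sub_modByMonic := ?_ }
  · intro f hf hd
    have hft : augment μ φ h γ hγ f ≠ ⊤ := by
      rw [augment_of_degree_lt h hγ hd]; exact h.ne_top_of_degree_lt hf hd
    rw [initial_dvd_augment_iff h hγ hft, (modByMonic_eq_self_iff h.monic).2 hd]
    exact lt_irrefl _
  · refine prime_initial_of_homogeneous _ (by rw [augment_self]; exact WithTop.coe_ne_top) ?_ ?_
    · intro hu
      have h1 : initial (augment μ φ h γ hγ) φ ∣ initial (augment μ φ h γ hγ) 1 := by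
        rw [initial_one]; exact hu.dvd
      rw [initial_dvd_augment_iff h hγ (by simp), (modByMonic_eq_self_iff h.monic).2 hd1] at h1
      exact lt_irrefl _ h1
    · intro b c hb hc hdvd
      have hbc : augment μ φ h γ hγ (b * c) ≠ ⊤ := by
        rw [AddValuation.map_mul]; exact WithTop.add_ne_top.2 ⟨hb, hc⟩
      rw [← initial_mul, initial_dvd_augment_iff h hγ hbc] at hdvd
      rw [initial_dvd_augment_iff h hγ hb, initial_dvd_augment_iff h hγ hc]
      by_contra! hcon
      have hb' := le_antisymm hcon.1 (augment_le_modByMonic h hγ b)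
      have hc' := le_antisymm hcon.2 (augment_le_modByMonic h hγ c)
      have hdb := degree_modByMonic_lt b h.monic
      have hdc := degree_modByMonic_lt c h.monic
      rw [augment_of_degree_lt h hγ (degree_modByMonic_lt _ h.monic),
        mul_modByMonic, valuation_mod h hdb hdc, AddValuation.map_mul, ← hb', ← hc',
        augment_of_degree_lt h hγ hdb, augment_of_degree_lt h hγ hdc] at hdvd
      exact lt_irrefl _ hdvd
  · intro a b ha hb hda hdb
    have e : a * b - (a * b) %ₘ φ = φ * ((a * b) /ₘ φ) := by
      rw [sub_eq_iff_eq_add, add_comm]; exact (modByMonic_add_div _ _).symm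
    rw [e, AddValuation.map_mul, AddValuation.map_mul, augment_of_degree_lt h hγ hda,
      augment_of_degree_lt h hγ hdb, augment_self,
      augment_of_degree_lt h hγ (degree_mul_divByMonic_lt h.monic hda hdb)]
    have hle := valuation_div h hda hdb
    rcases eq_or_ne (μ ((a * b) /ₘ φ)) ⊤ with ht | ht
    · rw [ht, add_top]
      exact lt_top_iff_ne_top.2 (WithTop.add_ne_top.2
        ⟨h.ne_top_of_degree_lt ha hda, h.ne_top_of_degree_lt hb hdb⟩)
    · exact hle.trans_lt (WithTop.add_lt_add_right ht hγ)

end Augment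

namespace IsMinimalKeyPolynomial

variable {w : AddValuation K[X] (WithTop L)} {φ : K[X]} (h : IsMinimalKeyPolynomial w φ)
include h

theorem degree_one_lt : (1 : K[X]).degree < φ.degree := by
  rw [degree_one]; exact natDegree_pos_iff_degree_pos.1 h.natDegree_pos

theorem degree_zero_lt : (0 : K[X]).degree < φ.degree := by
  rw [degree_zero]; exact bot_lt_iff_ne_bot.2 (degree_ne_bot.2 h.monic.ne_zero)

theorem map_mul_modByMonic {a b : K[X]} (hda : a.degree < φ.degree) (hdb : b.degree < φ.degree) :
    w ((a * b) %ₘ φ) = w a + w b := valuation_mod h.toIsKeyPolynomial hda hdb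

theorem initial_mul_modByMonic {a b : K[X]} (hda : a.degree < φ.degree) (hdb : b.degree < φ.degree) :
    initial w ((a * b) %ₘ φ) = initial w a * initial w b := by
  rw [← initial_mul]
  by_cases ha : a = 0
  · simp [ha]
  by_cases hb : b = 0
  · simp [hb]
  refine (initial_congr w ?_).symm
  rw [w.map_sub_swap]
  exact h.lt_mul_sub_modByMonic a b ha hb hda hdb

theorem modByMonic_mul_ne_zero {a b : K[X]} (ha : a ≠ 0) (hb : b ≠ 0) (hda : a.degree < φ.degree)
    (hdb : b.degree < φ.degree) : (a * b) %ₘ φ ≠ 0 := by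
  intro h0
  have := h.map_mul_modByMonic hda hdb
  rw [h0, w.map_zero] at this
  exact WithTop.add_ne_top.2 ⟨h.ne_top_of_degree_lt ha hda, h.ne_top_of_degree_lt hb hdb⟩ this.symm

theorem irreducible_polynomial : Irreducible φ := by
  refine h.monic.irreducible_iff_natDegree'.2 ⟨?_, ?_⟩
  · rintro rfl; have := h.natDegree_pos; simp at this
  · intro f g hf hg hfg hmem
    rw [Finset.mem_Ioc] at hmem
    have hfd := hf.natDegree_mul hg
    rw [hfg] at hfd
    have h1 : f.degree < φ.degree := degree_lt_degree (by omega)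
    have h2 : g.degree < φ.degree := degree_lt_degree (by omega)
    apply h.modByMonic_mul_ne_zero hf.ne_zero hg.ne_zero h1 h2
    rw [hfg]
    exact (modByMonic_eq_zero_iff_dvd h.monic).2 dvd_rfl

/-- Nonzero polynomials of small degree have invertible initial terms. -/
theorem exists_initial_mul_eq_one {a : K[X]} (ha : a ≠ 0) (hda : a.degree < φ.degree) :
    ∃ b : K[X], b ≠ 0 ∧ b.degree < φ.degree ∧ initial w a * initial w b = 1 := by
  have hcop : IsCoprime a φ := by
    refine (EuclideanDomain.isCoprime_of_dvd (fun h0 => ha h0.1) ?_)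
    intro z hz hz0 hza hzφ
    rcases h.irreducible_polynomial.dvd_iff.1 hzφ with hu | hass
    · exact hz hu
    · exact absurd (degree_le_of_dvd (hass.dvd.trans hza) ha) (not_le.2 hda)
  obtain ⟨s, t, hst⟩ := hcop
  have h1 : (a * (s %ₘ φ)) %ₘ φ = 1 := by
    have e : a * s = 1 + φ * (-t) := by linear_combination hst
    have : (a * (s %ₘ φ)) %ₘ φ = (a * s) %ₘ φ := by
      rw [mul_modByMonic a (s %ₘ φ), mul_modByMonic a s,
        (modByMonic_eq_self_iff h.monic).2 (degree_modByMonic_lt s h.monic)]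
    rw [this, e, add_modByMonic, (modByMonic_eq_zero_iff_dvd h.monic).2 (dvd_mul_right _ _),
      add_zero, (modByMonic_eq_self_iff h.monic).2 h.degree_one_lt]
  refine ⟨s %ₘ φ, ?_, degree_modByMonic_lt _ h.monic, ?_⟩
  · intro h0
    rw [h0, mul_zero, zero_modByMonic] at h1
    exact zero_ne_one h1
  · rw [← h.initial_mul_modByMonic hda (degree_modByMonic_lt _ h.monic), h1, initial_one]

theorem isUnit_initial {a : K[X]} (ha : a ≠ 0) (hda : a.degree < φ.degree) :
    IsUnit (initial w a) := by
  obtain ⟨b, -, -, hb⟩ := h.exists_initial_mul_eq_one ha hda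
  exact IsUnit.of_mul_eq_one _ hb

theorem degreeOf_eq : degreeOf w = φ.natDegree := by
  refine IsLeast.csInf_eq ⟨⟨φ, h.toIsKeyPolynomial, rfl⟩, ?_⟩
  rintro d ⟨ρ, hρ, rfl⟩
  by_contra hlt
  exact hρ.irreducible.not_isUnit
    (h.isUnit_initial hρ.monic.ne_zero (degree_lt_degree (not_le.1 hlt)))

theorem mem_valueGroupZero_iff {α : L} :
    α ∈ valueGroupZero w ↔ ∃ a : K[X], a ≠ 0 ∧ a.degree < φ.degree ∧ w a = α := by
  constructor
  · intro hα
    induction hα using AddSubgroup.closure_induction with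
    | mem x hx =>
      obtain ⟨a, ha, hd, hx⟩ := hx
      rw [h.degreeOf_eq] at hd
      exact ⟨a, ha, degree_lt_degree hd, hx⟩
    | zero => exact ⟨1, one_ne_zero, h.degree_one_lt, by simp⟩
    | add x y _ _ hx hy =>
      obtain ⟨a, ha, hda, hx⟩ := hx
      obtain ⟨b, hb, hdb, hy⟩ := hy
      exact ⟨(a * b) %ₘ φ, h.modByMonic_mul_ne_zero ha hb hda hdb, degree_modByMonic_lt _ h.monic,
        by rw [h.map_mul_modByMonic hda hdb, hx, hy, WithTop.coe_add]⟩
    | neg x _ hx =>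
      obtain ⟨a, ha, hda, hx⟩ := hx
      obtain ⟨b, hb, hdb, hab⟩ := h.exists_initial_mul_eq_one ha hda
      refine ⟨b, hb, hdb, ?_⟩
      have h1 : w a + w b = 0 := by
        rw [← h.map_mul_modByMonic hda hdb]
        rw [← h.initial_mul_modByMonic hda hdb, ← initial_one w, eq_comm,
          initial_eq_initial_iff w (by simp)] at hab
        rw [w.map_eq_of_lt_sub hab, w.map_one]
      obtain ⟨β, hβ⟩ := WithTop.ne_top_iff_exists.1 (h.ne_top_of_degree_lt hb hdb)
      rw [hx, ← hβ, ← WithTop.coe_add, WithTop.coe_eq_zero] at h1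
      rw [← hβ, neg_eq_of_add_eq_zero_right h1]
  · rintro ⟨a, ha, hda, hx⟩
    refine AddSubgroup.subset_closure ⟨a, ha, ?_, hx⟩
    rw [h.degreeOf_eq]
    exact natDegree_lt_natDegree ha hda

/-- The relative ramification index is the order of the value of a minimal key polynomial modulo
the values of the polynomials of smaller degree. -/
theorem relRamificationIndex_dvd_iff {γ : L} (hγ : w φ = γ) (k : ℕ) :
    relRamificationIndex w ∣ k ↔ k • γ ∈ valueGroupZero w := by
  have hmem : γ ∈ valueGroup w := AddSubgroup.subset_closure ⟨φ, hγ⟩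
  have hle : valueGroupZero w ≤ valueGroup w :=
    AddSubgroup.closure_mono fun x ⟨a, _, _, hx⟩ => ⟨a, hx⟩
  have hall : ∀ x ∈ valueGroup w, ∃ (m : ℤ) (y : L), y ∈ valueGroupZero w ∧ x = m • γ + y := by
    intro x hx
    induction hx using AddSubgroup.closure_induction with
    | mem x hx =>
      obtain ⟨f, hf⟩ := hx
      obtain ⟨i, hi⟩ := h.exists_adicCoeff_eq (f := f) (by rw [hf]; exact WithTop.coe_ne_top)
      have hd := degree_adicCoeff_lt h.monic f i
      by_cases h0 : adicCoeff φ f i = 0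
      · rw [h0, zero_mul, w.map_zero, hf] at hi
        exact absurd hi.symm WithTop.coe_ne_top
      obtain ⟨β, hβ⟩ := WithTop.ne_top_iff_exists.1 (h.ne_top_of_degree_lt h0 hd)
      refine ⟨i, β, h.mem_valueGroupZero_iff.2 ⟨_, h0, hd, hβ.symm⟩, ?_⟩
      rw [w.map_mul, w.map_pow, ← hβ, hγ, hf] at hi
      rw [natCast_zsmul, add_comm]
      exact_mod_cast hi.symm
    | zero => exact ⟨0, 0, zero_mem _, by simp⟩
    | add x y _ _ hx hy =>
      obtain ⟨m, y, hy', rfl⟩ := hx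
      obtain ⟨m', z, hz', rfl⟩ := hy
      exact ⟨m + m', y + z, add_mem hy' hz', by rw [add_zsmul]; abel⟩
    | neg x _ hx =>
      obtain ⟨m, y, hy', rfl⟩ := hx
      exact ⟨-m, -y, neg_mem hy', by rw [neg_zsmul]; abel⟩
  set q : valueGroup w ⧸ (valueGroupZero w).addSubgroupOf (valueGroup w) :=
    QuotientAddGroup.mk ⟨γ, hmem⟩ with hq
  have htop : AddSubgroup.zmultiples q = ⊤ := by
    rw [eq_top_iff]
    intro z _
    obtain ⟨⟨x, hx⟩, rfl⟩ := QuotientAddGroup.mk_surjective z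
    obtain ⟨m, y, hy, hxe⟩ := hall x hx
    rw [AddSubgroup.mem_zmultiples_iff]
    refine ⟨m, ?_⟩
    rw [hq, ← QuotientAddGroup.mk_zsmul, QuotientAddGroup.eq, AddSubgroup.mem_addSubgroupOf]
    change -(m • γ) + x ∈ _
    rw [hxe, neg_add_cancel_left]
    exact hy
  have hord : relRamificationIndex w = addOrderOf q := by
    rw [relRamificationIndex, AddSubgroup.relIndex, AddSubgroup.index, ← Nat.card_zmultiples, htop,
      Nat.card_congr AddSubgroup.topEquiv.toEquiv]
  rw [hord, addOrderOf_dvd_iff_nsmul_eq_zero, hq, ← QuotientAddGroup.mk_nsmul,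
    QuotientAddGroup.eq_zero_iff, AddSubgroup.mem_addSubgroupOf]
  rfl

/-- Indices of terms of equal value differ by multiples of the relative ramification index. -/
theorem relRamificationIndex_dvd_sub {a b : K[X]} (ha : a ≠ 0) (hb : b ≠ 0)
    (hda : a.degree < φ.degree) (hdb : b.degree < φ.degree) {i k : ℕ}
    (he : w (a * φ ^ i) = w (b * φ ^ (i + k))) : relRamificationIndex w ∣ k := by
  obtain ⟨γ, hγ⟩ := WithTop.ne_top_iff_exists.1 h.ne_top
  obtain ⟨α, hα⟩ := WithTop.ne_top_iff_exists.1 (h.ne_top_of_degree_lt ha hda)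
  obtain ⟨β, hβ⟩ := WithTop.ne_top_iff_exists.1 (h.ne_top_of_degree_lt hb hdb)
  rw [h.relRamificationIndex_dvd_iff hγ.symm]
  rw [w.map_mul, w.map_mul, w.map_pow, w.map_pow, ← hα, ← hβ, ← hγ] at he
  have he' : α + i • γ = β + (i + k) • γ := by exact_mod_cast he
  have : k • γ = α - β := by
    rw [add_nsmul] at he'
    rw [eq_sub_iff_add_eq]
    have h2 : (k • γ + β) + i • γ = α + i • γ := by rw [he']; abel
    exact add_right_cancel h2
  rw [this]
  exact sub_mem (h.mem_valueGroupZero_iff.2 ⟨a, ha, hda, hα.symm⟩)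
    (h.mem_valueGroupZero_iff.2 ⟨b, hb, hdb, hβ.symm⟩)

end IsMinimalKeyPolynomial

end Minimal

/-! ### Polynomial rings over graded fields -/

section Abstract

/-- The structure of the graded algebra of a valuation with a minimal key polynomial `φ`: it is a
polynomial ring in `x = in(φ)`, of degree `γ`, over a graded ring of constants in which every nonzero
homogeneous element is invertible. Here `const α` are the constants of degree `α`, the field `F` is
identified with `const 0` by `ι`, the positive integer `e` is the order of `γ` modulo the degrees of
the nonzero constants, and `u`, of degree `e γ`, is a constant with inverse `v`. -/
structure GradedConstants (F G L : Type*) [Field F] [CommRing G] [AddCommGroup L] where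
  const : L → AddSubgroup G
  ι : F →+* G
  x : G
  γ : L
  e : ℕ
  u : G
  v : G
  mem_const_zero : ∀ y, y ∈ const 0 ↔ ∃ c, ι c = y
  mul_mem : ∀ {α β y z}, y ∈ const α → z ∈ const β → y * z ∈ const (α + β)
  exists_inv : ∀ {α y}, y ∈ const α → y ≠ 0 → ∃ z ∈ const (-α), y * z = 1
  eq_zero_of_eval : ∀ (α : L) (T : G[X]), (∀ i, T.coeff i ∈ const (α - i • γ)) → T.eval x = 0 → T = 0
  e_pos : 0 < e
  u_mem : u ∈ const (e • γ)
  v_mem : v ∈ const (-(e • γ))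
  u_mul_v : u * v = 1
  dvd : ∀ {α i k y z}, y ∈ const (α - i • γ) → z ∈ const (α - (i + k) • γ) → y ≠ 0 → z ≠ 0 → e ∣ k

namespace GradedConstants

variable {F G L : Type*} [Field F] [CommRing G] [AddCommGroup L] (D : GradedConstants F G L)

/-- `T(x)` is homogeneous of degree `α`. -/
def IsHom (α : L) (T : G[X]) : Prop := ∀ i, T.coeff i ∈ D.const (α - i • D.γ)

variable {D} in
theorem IsHom.sub {α : L} {T T' : G[X]} (h : D.IsHom α T) (h' : D.IsHom α T') :
    D.IsHom α (T - T') := fun i => by rw [coeff_sub]; exact sub_mem (h i) (h' i)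

variable {D} in
theorem IsHom.mul {α β : L} {T T' : G[X]} (h : D.IsHom α T) (h' : D.IsHom β T') :
    D.IsHom (α + β) (T * T') := by
  intro i
  rw [coeff_mul]
  refine sum_mem fun p hp => ?_
  replace hp : p.1 + p.2 = i := Finset.HasAntidiagonal.mem_antidiagonal.1 hp
  have e : α + β - i • D.γ = (α - p.1 • D.γ) + (β - p.2 • D.γ) := by
    rw [← hp, add_nsmul]; abel
  rw [e]
  exact D.mul_mem (h _) (h' _)

/-- A homogeneous element has only one expansion. -/
theorem eq_of_eval_eq {α : L} {T T' : G[X]} (h : D.IsHom α T) (h' : D.IsHom α T')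
    (he : T.eval D.x = T'.eval D.x) : T = T' :=
  sub_eq_zero.1 (D.eq_zero_of_eval α _ (h.sub h') (by rw [eval_sub, he, sub_self]))

theorem isHom_C {α : L} {y : G} (hy : y ∈ D.const α) : D.IsHom α (C y) := by
  intro i
  rw [coeff_C]
  split_ifs with h
  · subst h; simpa using hy
  · exact zero_mem _

theorem one_mem : (1 : G) ∈ D.const 0 := (D.mem_const_zero _).2 ⟨1, map_one _⟩

theorem pow_mem {α : L} {y : G} (hy : y ∈ D.const α) (n : ℕ) : y ^ n ∈ D.const (n • α) := by
  induction n with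
  | zero => rw [pow_zero, zero_nsmul]; exact D.one_mem
  | succ n ih => rw [pow_succ, succ_nsmul]; exact D.mul_mem ih hy

/-- The substitution `p(y) ↦ p(x ^ e u⁻¹)`, with values in the polynomials in `x`. -/
noncomputable def lift : F[X] →+* G[X] :=
  (expand G D.e).toRingHom.comp ((compRingHom (C D.v * X)).comp (mapRingHom D.ι))

theorem lift_coeff (p : F[X]) (i : ℕ) :
    (D.lift p).coeff i = if D.e ∣ i then D.ι (p.coeff (i / D.e)) * D.v ^ (i / D.e) else 0 := by
  change (expand G D.e ((p.map D.ι).comp (C D.v * X))).coeff i = _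
  rw [coeff_expand D.e_pos, comp_C_mul_X_coeff, coeff_map]

theorem lift_coeff_mul (p : F[X]) (j : ℕ) :
    (D.lift p).coeff (D.e * j) = D.ι (p.coeff j) * D.v ^ j := by
  rw [lift_coeff, if_pos (dvd_mul_right _ _), Nat.mul_div_cancel_left _ D.e_pos]

theorem isHom_lift (p : F[X]) : D.IsHom 0 (D.lift p) := by
  intro i
  rw [lift_coeff]
  split_ifs with h
  · obtain ⟨j, rfl⟩ := h
    rw [Nat.mul_div_cancel_left _ D.e_pos]
    have h1 := D.mul_mem ((D.mem_const_zero _).2 ⟨p.coeff j, rfl⟩) (D.pow_mem D.v_mem j)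
    have e : (0 : L) - (D.e * j) • D.γ = 0 + j • -(D.e • D.γ) := by
      rw [mul_comm, mul_nsmul, zero_sub, zero_add, smul_neg, ← mul_nsmul, ← mul_nsmul, mul_comm]
    rw [e]
    exact h1
  · exact zero_mem _

theorem u_pow_mul_v_pow (n : ℕ) : D.u ^ n * D.v ^ n = 1 := by
  rw [← mul_pow, D.u_mul_v, one_pow]

variable {D} in
theorem isUnit_of_mem {α : L} {y : G} (hy : y ∈ D.const α) (h0 : y ≠ 0) : IsUnit y := by
  obtain ⟨z, -, hz⟩ := D.exists_inv hy h0
  exact IsUnit.of_mul_eq_one _ hz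

theorem coeff_normal_form (y : G) (s : ℕ) (p : F[X]) (j : ℕ) :
    (C y * X ^ s * D.lift p).coeff (s + D.e * j) = y * (D.ι (p.coeff j) * D.v ^ j) := by
  rw [mul_assoc, coeff_C_mul, coeff_X_pow_mul', if_pos (Nat.le_add_right _ _),
    Nat.add_sub_cancel_left, lift_coeff_mul]

theorem lift_eq_C_mul {ψ : F[X]} (hψ0 : ψ.coeff 0 ≠ 0) :
    D.lift ψ = C (D.ι (ψ.coeff 0)) * D.lift (C (ψ.coeff 0)⁻¹ * ψ) := by
  have h1 : D.lift (C (ψ.coeff 0)) = C (D.ι (ψ.coeff 0)) := by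
    ext i
    rw [lift_coeff, coeff_C, coeff_C]
    rcases Nat.eq_zero_or_pos i with rfl | hi
    · simp
    · rw [if_neg hi.ne']
      split_ifs with h2 h3
      · obtain ⟨j, rfl⟩ := h2
        rw [Nat.mul_div_cancel_left _ D.e_pos] at h3
        subst h3
        omega
      · simp
      · rfl
  rw [← h1, ← map_mul, ← mul_assoc, ← C_mul, mul_inv_cancel₀ hψ0, C_1, one_mul]

variable [Nontrivial G]

theorem ι_injective : Function.Injective D.ι := D.ι.injective

/-- Every nonzero homogeneous element is `y x ^ s p(x ^ e u⁻¹)` with a constant `y` and a polynomial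
`p` with constant coefficient `1`. -/
theorem IsHom.exists_eq {α : L} {T : G[X]} (h : D.IsHom α T) (hT : T ≠ 0) :
    ∃ (s : ℕ) (y : G) (p : F[X]), y ∈ D.const (α - s • D.γ) ∧ y ≠ 0 ∧ p.coeff 0 = 1 ∧
      T = C y * X ^ s * D.lift p ∧ s + D.e * p.natDegree ≤ T.natDegree := by
  classical
  set s := T.natTrailingDegree with hs
  have hy0 : T.coeff s ≠ 0 := trailingCoeff_nonzero_iff_nonzero.2 hT
  obtain ⟨z, hz, hyz⟩ := D.exists_inv (h s) hy0
  -- After division by the lowest coefficient, the coefficients of index `s + e j` become elements of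
  -- degree zero when multiplied by `u ^ j`; those of other indices vanish by the definition of `e`.
  have hex : ∀ j, ∃ c : F, D.ι c = z * T.coeff (s + D.e * j) * D.u ^ j := by
    intro j
    rw [← D.mem_const_zero]
    have h1 := D.mul_mem (D.mul_mem hz (h (s + D.e * j))) (D.pow_mem D.u_mem j)
    have e : -(α - s • D.γ) + (α - (s + D.e * j) • D.γ) + j • D.e • D.γ = 0 := by
      rw [add_nsmul, mul_nsmul]; abel
    rwa [e] at h1
  choose c hc using hex
  have hc0 : c 0 = 1 := by
    apply D.ι_injective
    rw [hc, map_one, mul_zero, add_zero, pow_zero, mul_one, mul_comm, hyz]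
  set M := (T.natDegree - s) / D.e with hM
  have hsT : s ≤ T.natDegree := natTrailingDegree_le_natDegree T
  have hcM : ∀ j, M < j → c j = 0 := by
    intro j hj
    apply D.ι_injective
    rw [hc, map_zero, coeff_eq_zero_of_natDegree_lt, mul_zero, zero_mul]
    rw [hM, Nat.div_lt_iff_lt_mul D.e_pos] at hj
    rw [mul_comm] at hj
    omega
  set p : F[X] := ∑ j ∈ Finset.range (M + 1), monomial j (c j) with hp
  have hpc : ∀ j, p.coeff j = c j := by
    intro j
    rw [hp, finsetSum_coeff]
    simp only [coeff_monomial]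
    rw [Finset.sum_ite_eq']
    split_ifs with hj
    · rfl
    · rw [Finset.mem_range, not_lt] at hj
      exact (hcM j (by omega)).symm
  refine ⟨s, T.coeff s, p, h s, hy0, by rw [hpc, hc0], ?_, ?_⟩
  · ext i
    rw [mul_assoc, coeff_C_mul, coeff_X_pow_mul']
    split_ifs with hi
    · obtain ⟨k, rfl⟩ := Nat.exists_eq_add_of_le hi
      rw [Nat.add_sub_cancel_left, lift_coeff]
      split_ifs with hk
      · obtain ⟨j, rfl⟩ := hk
        rw [Nat.mul_div_cancel_left _ D.e_pos, hpc, hc]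
        calc T.coeff (s + D.e * j) = (T.coeff s * z) * T.coeff (s + D.e * j) * (D.u ^ j * D.v ^ j) := by
              rw [hyz, D.u_pow_mul_v_pow]; ring
          _ = _ := by ring
      · rw [mul_zero]
        by_contra hne
        exact hk (D.dvd (h s) (h (s + k)) hy0 hne)
    · rw [mul_zero]
      exact coeff_eq_zero_of_lt_natTrailingDegree (not_le.1 hi)
  · have h1 : p.natDegree ≤ M := by
      refine natDegree_le_iff_coeff_eq_zero.2 fun j hj => ?_
      rw [hpc, hcM j hj]
    have h2 : D.e * M ≤ T.natDegree - s := Nat.mul_div_le _ _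
    have h3 := Nat.mul_le_mul_left D.e h1
    omega

theorem normal_form_unique {y y' : G} (hy : IsUnit y) (hy' : IsUnit y') {s s' : ℕ} {p p' : F[X]}
    (hp : p.coeff 0 = 1) (hp' : p'.coeff 0 = 1)
    (h : C y * X ^ s * D.lift p = C y' * X ^ s' * D.lift p') : s = s' ∧ p = p' := by
  have key : ∀ {y y' : G} (_ : IsUnit y) {s s' : ℕ} {p p' : F[X]} (_ : p.coeff 0 = 1)
      (_ : C y * X ^ s * D.lift p = C y' * X ^ s' * D.lift p'), s' ≤ s := by
    intro y y' hy s s' p p' hp h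
    by_contra! hlt
    have h1 := D.coeff_normal_form y s p 0
    rw [h, mul_assoc, coeff_C_mul, coeff_X_pow_mul', if_neg (by omega), mul_zero, hp, map_one,
      pow_zero, mul_one, mul_one] at h1
    exact hy.ne_zero h1.symm
  have hs : s = s' := le_antisymm (key hy' hp' h.symm) (key hy hp h)
  subst hs
  have hyy : y = y' := by
    have h1 := D.coeff_normal_form y s p 0
    rw [h, D.coeff_normal_form, hp, hp', map_one, pow_zero, mul_one, mul_one, mul_one] at h1
    exact h1.symm
  subst hyy
  refine ⟨rfl, ?_⟩
  ext j
  apply D.ι_injective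
  have h1 := D.coeff_normal_form y s p j
  rw [h, D.coeff_normal_form] at h1
  have h2 := hy.mul_left_cancel h1
  have hv : IsUnit (D.v ^ j) := (IsUnit.of_mul_eq_one D.u (by rw [mul_comm, D.u_mul_v])).pow j
  exact (hv.mul_right_cancel h2).symm

/-- Homogeneous units are constants. -/
theorem eq_C_of_mul_eq_one {α β : L} {T T' : G[X]} (hT : D.IsHom α T) (hT' : D.IsHom β T')
    (h : T * T' = 1) : ∃ y ∈ D.const α, T = C y := by
  have hT0 : T ≠ 0 := by rintro rfl; rw [zero_mul] at h; exact zero_ne_one h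
  have hT0' : T' ≠ 0 := by rintro rfl; rw [mul_zero] at h; exact zero_ne_one h
  obtain ⟨s, y, p, hy, hy0, hp, hTe, -⟩ := IsHom.exists_eq D hT hT0
  obtain ⟨s', y', p', hy', hy0', hp', hTe', -⟩ := IsHom.exists_eq D hT' hT0'
  have hprod : C (y * y') * X ^ (s + s') * D.lift (p * p') = C 1 * X ^ 0 * D.lift 1 := by
    rw [map_one D.lift, pow_zero, C_1, mul_one, mul_one, ← h, hTe, hTe', map_mul D.lift p p', C_mul,
      pow_add]
    ring
  obtain ⟨hs, hpp⟩ := D.normal_form_unique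
    ((isUnit_of_mem hy hy0).mul (isUnit_of_mem hy' hy0')) isUnit_one
    (by rw [mul_coeff_zero, hp, hp', one_mul]) (by simp) hprod
  have hs0 : s = 0 := by omega
  subst hs0
  obtain ⟨c, -, rfl⟩ := Polynomial.isUnit_iff.1 (IsUnit.of_mul_eq_one _ hpp)
  rw [coeff_C_zero] at hp
  refine ⟨y, by simpa using hy, ?_⟩
  rw [hTe, hp, C_1, map_one D.lift, pow_zero, mul_one, mul_one]

variable {ψ : F[X]} (hψ0 : ψ.coeff 0 ≠ 0)
include hψ0

/-- The normal form of a multiple of `ψ(x ^ e u⁻¹)`. -/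
theorem exists_normal_form_lift_mul {α : L} {S : G[X]} (hS : D.IsHom α S) (hS0 : S ≠ 0) :
    ∃ (s : ℕ) (y : G) (q : F[X]), IsUnit y ∧ q.coeff 0 = 1 ∧
      D.lift ψ * S = C y * X ^ s * D.lift (C (ψ.coeff 0)⁻¹ * ψ * q) := by
  obtain ⟨s, y, q, hy, hy0, hq, rfl, -⟩ := IsHom.exists_eq D hS hS0
  refine ⟨s, D.ι (ψ.coeff 0) * y, q, ?_, hq, ?_⟩
  · exact ((isUnit_iff_ne_zero.2 hψ0).map D.ι).mul (isUnit_of_mem hy hy0)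
  · rw [D.lift_eq_C_mul hψ0, map_mul D.lift (_ * ψ) q, C_mul]
    ring

theorem coeff_zero_normalized {q : F[X]} (hq : q.coeff 0 = 1) :
    (C (ψ.coeff 0)⁻¹ * ψ * q).coeff 0 = 1 := by
  rw [mul_coeff_zero, coeff_C_mul, inv_mul_cancel₀ hψ0, hq, one_mul]

theorem natDegree_le_of_lift_mul_eq {α β : L} {T S : G[X]} (hT : D.IsHom α T) (hT0 : T ≠ 0)
    (hS : D.IsHom β S) (h : T = D.lift ψ * S) : D.e * ψ.natDegree ≤ T.natDegree := by
  have hS0 : S ≠ 0 := by rintro rfl; rw [mul_zero] at h; exact hT0 h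
  obtain ⟨s, y, p, hy, hy0, hp, hTe, hdeg⟩ := IsHom.exists_eq D hT hT0
  obtain ⟨s', y', q, hy', hq, hSe⟩ := D.exists_normal_form_lift_mul hψ0 hS hS0
  rw [← h, hTe] at hSe
  have hpq := (D.normal_form_unique (isUnit_of_mem hy hy0) hy' hp
    (coeff_zero_normalized hψ0 hq) hSe).2
  have hp0 : p ≠ 0 := by rintro rfl; simp at hp
  have hdvd : ψ ∣ p := by rw [hpq]; exact ⟨C (ψ.coeff 0)⁻¹ * q, by ring⟩
  have h1 := natDegree_le_of_dvd hdvd hp0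
  have h2 := Nat.mul_le_mul_left D.e h1
  omega

/-- If `ψ` is prime and `ψ(0) ≠ 0`, then `ψ(x ^ e u⁻¹)` behaves like a prime with respect to homogeneous
elements. -/
theorem lift_dvd_or_dvd (hψ : Prime ψ) {α β δ : L} {T T' S : G[X]} (hT : D.IsHom α T)
    (hT' : D.IsHom β T') (hT0 : T ≠ 0) (hT0' : T' ≠ 0)
    (hS : D.IsHom δ S) (h : T * T' = D.lift ψ * S) :
    D.lift ψ ∣ T ∨ D.lift ψ ∣ T' := by
  obtain ⟨s, y, p, hy, hy0, hp, hTe, -⟩ := IsHom.exists_eq D hT hT0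
  obtain ⟨s', y', p', hy', hy0', hp', hTe', -⟩ := IsHom.exists_eq D hT' hT0'
  have hyu := isUnit_of_mem hy hy0
  have hyu' := isUnit_of_mem hy' hy0'
  have hprod : T * T' = C (y * y') * X ^ (s + s') * D.lift (p * p') := by
    rw [hTe, hTe', map_mul D.lift p p', C_mul, pow_add]; ring
  have hpp : (p * p').coeff 0 = 1 := by rw [mul_coeff_zero, hp, hp', one_mul]
  have hS0 : S ≠ 0 := by
    rintro rfl
    rw [mul_zero, hprod] at h
    have h1 := D.coeff_normal_form (y * y') (s + s') (p * p') 0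
    rw [h, coeff_zero, hpp, map_one, pow_zero, mul_one, mul_one] at h1
    exact (hyu.mul hyu').ne_zero h1.symm
  obtain ⟨t, z, q, hz, hq, hSe⟩ := D.exists_normal_form_lift_mul hψ0 hS hS0
  rw [← h, hprod] at hSe
  have hpq := (D.normal_form_unique (hyu.mul hyu') hz hpp (coeff_zero_normalized hψ0 hq) hSe).2
  have hdvd : ψ ∣ p * p' := by rw [hpq]; exact ⟨C (ψ.coeff 0)⁻¹ * q, by ring⟩
  rcases hψ.dvd_or_dvd hdvd with h1 | h1
  · left; rw [hTe]; exact (map_dvd D.lift h1).mul_left _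
  · right; rw [hTe']; exact (map_dvd D.lift h1).mul_left _

end GradedConstants

end Abstract

/-! ### The field of constants and its image in the residue field -/

section Residue

variable {K : Type*} [Field K] {L : Type*} [AddCommGroup L] [LinearOrder L] [IsOrderedAddMonoid L]

theorem gradeGEZeroToResidue_eq_zero_iff (w : AddValuation K[X] (WithTop L)) (a : gradeGEZero w) :
    gradeGEZeroToResidue w a = 0 ↔ 0 < w a.1 := by
  refine ⟨fun h => ?_, gradeGEZeroToResidue_eq_zero w a⟩
  have h1 := (IsLocalRing.residue_eq_zero_iff _).1 h
  rw [Valuation.mem_maximalIdeal_iff] at h1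
  change fracValuation w (algebraMap _ _ (Ideal.Quotient.mk w.supp a.1)) < 1 at h1
  rw [fracValuation_algebraMap] at h1
  exact h1

theorem gradeZeroToResidue_mk (w : AddValuation K[X] (WithTop L)) (a : gradeGEZero w) :
    gradeZeroToResidue w (Ideal.Quotient.mk _ a) = gradeGEZeroToResidue w a := rfl

theorem gradeZeroToGraded_injective (w : AddValuation K[X] (WithTop L)) :
    Function.Injective (gradeZeroToGraded w) := by
  refine (injective_iff_map_eq_zero _).2 fun a ha => ?_
  obtain ⟨a, rfl⟩ := Ideal.Quotient.mk_surjective a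
  have h1 : ((0 : L) : WithTop L) < w a.1 := (homog_eq_zero_iff w a.2).1 ha
  exact Ideal.Quotient.eq_zero_iff_mem.2 h1

theorem gradeZeroToResidue_injective (w : AddValuation K[X] (WithTop L)) :
    Function.Injective (gradeZeroToResidue w) := by
  refine (injective_iff_map_eq_zero _).2 fun a ha => ?_
  obtain ⟨a, rfl⟩ := Ideal.Quotient.mk_surjective a
  rw [gradeZeroToResidue_mk, gradeGEZeroToResidue_eq_zero_iff] at ha
  exact Ideal.Quotient.eq_zero_iff_mem.2 ha

theorem natCast_nonneg (w : AddValuation K[X] (WithTop L)) (n : ℕ) : 0 ≤ w (n : K[X]) :=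
  (natCast_mem (gradeGEZero w) n : (n : K[X]) ∈ gradeGEZero w)

theorem natCast_residue_eq_zero_iff (w : AddValuation K[X] (WithTop L)) (n : ℕ) :
    (n : ResidueFieldOf w) = 0 ↔ w (n : K[X]) ≠ 0 := by
  rw [← map_natCast (gradeGEZeroToResidue w), gradeGEZeroToResidue_eq_zero_iff]
  change 0 < w (n : K[X]) ↔ _
  rw [(natCast_nonneg w n).lt_iff_ne, ne_comm]

namespace IsMinimalKeyPolynomial

variable {w : AddValuation K[X] (WithTop L)} {φ : K[X]} (h : IsMinimalKeyPolynomial w φ)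

include h in
theorem sub_modByMonic_mul_pos {f g : K[X]} (hf : 0 ≤ w f) (hg : 0 ≤ w g)
    (hf' : 0 < w (f - f %ₘ φ)) (hg' : 0 < w (g - g %ₘ φ)) :
    0 < w (f * g - (f * g) %ₘ φ) := by
  have hdf := degree_modByMonic_lt f h.monic
  have hdg := degree_modByMonic_lt g h.monic
  have h1 : 0 < w ((f %ₘ φ) * (g %ₘ φ) - ((f %ₘ φ) * (g %ₘ φ)) %ₘ φ) := by
    by_cases hf0 : f %ₘ φ = 0
    · simp [hf0]
    by_cases hg0 : g %ₘ φ = 0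
    · simp [hg0]
    refine lt_of_le_of_lt ?_ (h.lt_mul_sub_modByMonic _ _ hf0 hg0 hdf hdg)
    rw [w.map_mul]
    exact add_nonneg (hf.trans (h.le_modByMonic f)) (hg.trans (h.le_modByMonic g))
  rw [← mul_modByMonic] at h1
  have h2 : 0 < w ((f - f %ₘ φ) * g) := by
    rw [w.map_mul]; exact lt_of_lt_of_le hf' (le_add_of_nonneg_right hg)
  have h3 : 0 < w (f %ₘ φ * (g - g %ₘ φ)) := by
    rw [w.map_mul]
    exact lt_of_lt_of_le hg' (le_add_of_nonneg_left (hf.trans (h.le_modByMonic f)))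
  have e : f * g - (f * g) %ₘ φ = ((f %ₘ φ) * (g %ₘ φ) - (f * g) %ₘ φ) +
      ((f - f %ₘ φ) * g + f %ₘ φ * (g - g %ₘ φ)) := by ring
  rw [e]
  exact w.map_lt_add h1 (w.map_lt_add h2 h3)

/-- The polynomials of nonnegative value which have the same class in `P₀ / P₀⁺` as their remainder
modulo `φ`. -/
def constLift : Subring (gradeGEZero w) where
  carrier := {f | 0 < w (f.1 - f.1 %ₘ φ)}
  mul_mem' := fun {f g} hf hg => h.sub_modByMonic_mul_pos f.2 g.2 hf hg
  one_mem' := by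
    change 0 < w ((1 : K[X]) - 1 %ₘ φ)
    rw [(modByMonic_eq_self_iff h.monic).2 h.degree_one_lt]
    simp
  add_mem' := fun {f g} hf hg => by
    change 0 < w (f.1 + g.1 - (f.1 + g.1) %ₘ φ)
    rw [add_modByMonic, add_sub_add_comm]
    exact w.map_lt_add hf hg
  zero_mem' := by
    change 0 < w ((0 : K[X]) - 0 %ₘ φ)
    simp
  neg_mem' := fun {f} hf => by
    change 0 < w (-f.1 - (-f.1) %ₘ φ)
    rw [neg_modByMonic, neg_sub_neg, w.map_sub_swap]
    exact hf

/-- The classes in `P₀ / P₀⁺` of the polynomials of degree less than `deg φ`. -/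
noncomputable def constSubring : Subring (GradeZero w) := h.constLift.map (Ideal.Quotient.mk (gradeGTZero w))

theorem mem_constSubring_iff {δ : GradeZero w} :
    δ ∈ h.constSubring ↔ ∃ (a : K[X]) (ha : 0 ≤ w a), a.degree < φ.degree ∧
      Ideal.Quotient.mk (gradeGTZero w) ⟨a, ha⟩ = δ := by
  constructor
  · rintro ⟨f, hf, rfl⟩
    refine ⟨f.1 %ₘ φ, f.2.trans (h.le_modByMonic f.1), degree_modByMonic_lt _ h.monic, ?_⟩
    refine Ideal.Quotient.eq.2 ?_
    change 0 < w (f.1 %ₘ φ - f.1)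
    rw [w.map_sub_swap]
    exact hf
  · rintro ⟨a, ha, hd, rfl⟩
    refine ⟨⟨a, ha⟩, ?_, rfl⟩
    change 0 < w (a - a %ₘ φ)
    rw [(modByMonic_eq_self_iff h.monic).2 hd]
    simp

theorem isField_constSubring : IsField h.constSubring where
  exists_pair_ne := by
    refine ⟨0, 1, fun h01 => ?_⟩
    have h1 : (0 : GradeZero w) = 1 := congrArg Subtype.val h01
    have h2 : (1 : gradeGEZero w) ∈ gradeGTZero w :=
      Ideal.Quotient.eq_zero_iff_mem.1 h1.symm
    have h3 : 0 < w (1 : K[X]) := h2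
    rw [w.map_one] at h3
    exact lt_irrefl _ h3
  mul_comm := mul_comm
  mul_inv_cancel := by
    rintro ⟨δ, hδ⟩ hne
    obtain ⟨a, ha, hd, rfl⟩ := h.mem_constSubring_iff.1 hδ
    have hwa : w a = 0 := by
      by_contra hwa
      exact hne (Subtype.ext (Ideal.Quotient.eq_zero_iff_mem.2 (lt_of_le_of_ne ha (Ne.symm hwa))))
    have ha0 : a ≠ 0 := by rintro rfl; rw [w.map_zero] at hwa; exact WithTop.top_ne_zero hwa
    obtain ⟨b, -, hdb, hab⟩ := h.exists_initial_mul_eq_one ha0 hd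
    rw [← initial_mul, ← initial_one w, eq_comm, initial_eq_initial_iff w (by simp), w.map_one] at hab
    have hwb : w b = 0 := by
      have h1 : w (a * b) = w 1 := w.map_eq_of_lt_sub (by rwa [w.map_one])
      rwa [w.map_mul, hwa, zero_add, w.map_one] at h1
    refine ⟨⟨_, h.mem_constSubring_iff.2 ⟨b, hwb.ge, hdb, rfl⟩⟩, Subtype.ext ?_⟩
    exact Ideal.Quotient.eq.2 hab

/-- The residue field of the polynomials of degree less than `deg φ`: the classes in `P₀ / P₀⁺` of
these polynomials form a field. -/
noncomputable def ConstField : Type _ := h.constSubring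

noncomputable instance : Field h.ConstField := h.isField_constSubring.toField

/-- The embedding of the field of constants in the graded algebra. -/
noncomputable def constToGraded : h.ConstField →+* AssocGraded w :=
  (gradeZeroToGraded w).comp h.constSubring.subtype

/-- The embedding of the field of constants in the residue field of `w`. -/
noncomputable def constToResidue : h.ConstField →+* ResidueFieldOf w :=
  (gradeZeroToResidue w).comp h.constSubring.subtype

theorem exists_constToGraded_eq {a : K[X]} (ha : 0 ≤ w a) (hd : a.degree < φ.degree) :
    ∃ c : h.ConstField, h.constToGraded c = homog w 0 a ha :=
  ⟨⟨_, h.mem_constSubring_iff.2 ⟨a, ha, hd, rfl⟩⟩, rfl⟩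

theorem exists_eq_homog (c : h.ConstField) : ∃ (a : K[X]) (ha : 0 ≤ w a), a.degree < φ.degree ∧
    h.constToGraded c = homog w 0 a ha ∧
      h.constToResidue c = gradeGEZeroToResidue w ⟨a, ha⟩ := by
  obtain ⟨δ, hδ⟩ := c
  obtain ⟨a, ha, hd, rfl⟩ := h.mem_constSubring_iff.1 hδ
  exact ⟨a, ha, hd, rfl, rfl⟩

theorem constToResidue_eq {δ : GradeZero w} {c : h.ConstField}
    (hc : gradeZeroToGraded w δ = h.constToGraded c) :
    gradeZeroToResidue w δ = h.constToResidue c :=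
  congrArg (gradeZeroToResidue w) (gradeZeroToGraded_injective w hc)

theorem exists_gradeZero (c : h.ConstField) : ∃ δ : GradeZero w,
    gradeZeroToGraded w δ = h.constToGraded c ∧ gradeZeroToResidue w δ = h.constToResidue c :=
  ⟨Subtype.val (p := fun x => x ∈ h.constSubring) c, rfl, rfl⟩

/-- The field of constants is algebraic over the residue field of `K`: the polynomials of degree less
than `deg φ` represent elements of the finite extension `K[X] / (φ)` of `K`, and an algebraic relation
over `K` can be scaled so that its reduction is not trivial. -/
theorem constToResidue_mem_kappa (c : h.ConstField) : h.constToResidue c ∈ kappa w := by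
  classical
  obtain ⟨a, ha, hd, -, hc⟩ := h.exists_eq_homog c
  rw [hc, mem_algebraicClosure_iff]
  have := h.monic.finite_adjoinRoot
  obtain ⟨q, hq, hq0⟩ := IsIntegral.of_finite K (AdjoinRoot.mk φ a)
  have hφq : φ ∣ q.eval₂ C a := by
    rw [← AdjoinRoot.mk_eq_zero, hom_eval₂]
    exact hq0
  obtain ⟨i₀, hi₀, hmin⟩ := Finset.exists_min_image q.support (fun i => w (C (q.coeff i)))
    (support_nonempty.2 hq.ne_zero)
  have hq₀ : q.coeff i₀ ≠ 0 := mem_support_iff.1 hi₀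
  -- The relation `q` is divided by a coefficient of least value, so that it reduces to a nonzero one.
  set b : ℕ → K := fun i => (q.coeff i₀)⁻¹ * q.coeff i with hb
  have hbw : ∀ i, 0 ≤ w (C (b i)) := by
    intro i
    by_cases hi : q.coeff i = 0
    · simp [hb, hi]
    have h1 := hmin i (mem_support_iff.2 hi)
    have h2 : (0 : WithTop L) = w (C (q.coeff i₀)⁻¹) + w (C (q.coeff i₀)) := by
      rw [← w.map_mul, ← C_mul, inv_mul_cancel₀ hq₀, C_1, w.map_one]
    change 0 ≤ w (C ((q.coeff i₀)⁻¹ * q.coeff i))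
    rw [C_mul, w.map_mul, h2]
    exact add_le_add_right h1 _
  have hCmem : ∀ i, (⟨C (b i), hbw i⟩ : gradeGEZero w) ∈ h.constLift := by
    intro i
    change 0 < w (C (b i) - C (b i) %ₘ φ)
    rw [(modByMonic_eq_self_iff h.monic).2
      (degree_C_le.trans_lt (natDegree_pos_iff_degree_pos.1 h.natDegree_pos))]
    simp
  have hamem : (⟨a, ha⟩ : gradeGEZero w) ∈ h.constLift := by
    change 0 < w (a - a %ₘ φ)
    rw [(modByMonic_eq_self_iff h.monic).2 hd]
    simp
  set N := q.natDegree + 1 with hN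
  set f : gradeGEZero w := ∑ i ∈ Finset.range N, ⟨C (b i), hbw i⟩ * (⟨a, ha⟩ : gradeGEZero w) ^ i
    with hf
  have hfmem : f ∈ h.constLift :=
    sum_mem fun i _ => mul_mem (hCmem i) (pow_mem hamem i)
  have hfval : f.1 = C (q.coeff i₀)⁻¹ * q.eval₂ C a := by
    rw [hf, eval₂_eq_sum_range, Finset.mul_sum]
    change (gradeGEZero w).subtype _ = _
    rw [map_sum]
    refine Finset.sum_congr rfl fun i _ => ?_
    rw [map_mul, map_pow]
    change C (b i) * a ^ i = _
    rw [← mul_assoc, ← C_mul]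
  have hfpos : 0 < w f.1 := by
    have h1 : 0 < w (f.1 - f.1 %ₘ φ) := hfmem
    rwa [(modByMonic_eq_zero_iff_dvd h.monic).2 (hfval ▸ hφq.mul_left _), sub_zero] at h1
  have hres : gradeGEZeroToResidue w f = 0 := (gradeGEZeroToResidue_eq_zero_iff w f).2 hfpos
  let β : ℕ → (AddValuation.toValuation (w.comap C)).valuationSubring := fun i => ⟨b i, hbw i⟩
  refine ⟨∑ i ∈ Finset.range N, C (IsLocalRing.residue _ (β i)) * X ^ i, ?_, ?_⟩
  · intro h0
    have h1 := congrArg (fun p => p.coeff i₀) h0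
    simp only [finsetSum_coeff, coeff_C_mul, coeff_X_pow, coeff_zero, mul_ite, mul_one, mul_zero]
      at h1
    rw [Finset.sum_ite_eq, if_pos (Finset.mem_range.2
      (Nat.lt_succ_of_le (le_natDegree_of_mem_supp _ hi₀)))] at h1
    have hβ : β i₀ = 1 := Subtype.ext (inv_mul_cancel₀ hq₀)
    rw [hβ, map_one] at h1
    exact one_ne_zero h1
  · rw [map_sum, ← hres, hf, map_sum]
    refine Finset.sum_congr rfl fun i _ => ?_
    rw [map_mul, map_pow, aeval_X, aeval_C, map_mul, map_pow]
    rfl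

/-- The embedding of the field of constants in `κ(w)`. -/
noncomputable def constToKappa : h.ConstField →+* kappa w :=
  h.constToResidue.codRestrict (kappa w) h.constToResidue_mem_kappa

theorem coe_constToKappa (c : h.ConstField) :
    ((h.constToKappa c : kappa w) : ResidueFieldOf w) = h.constToResidue c := rfl

end IsMinimalKeyPolynomial

end Residue

/-! ### Expansions in the initial term of a key polynomial -/

section Expansion

variable {K : Type*} [Field K] {L : Type*} [AddCommGroup L] [LinearOrder L] [IsOrderedAddMonoid L]

theorem homog_ne_zero_iff (w : AddValuation K[X] (WithTop L)) {α : L} {a : K[X]}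
    (h : (α : WithTop L) ≤ w a) : homog w α a h ≠ 0 ↔ w a = α := by
  rw [Ne, homog_eq_zero_iff, not_lt]
  exact ⟨fun h' => le_antisymm h' h, fun h' => h'.le⟩

theorem homog_sum (w : AddValuation K[X] (WithTop L)) {α : L} (s : Finset ℕ) (b : ℕ → K[X])
    (hb : ∀ i, (α : WithTop L) ≤ w (b i)) :
    ∑ i ∈ s, homog w α (b i) (hb i) =
      homog w α (∑ i ∈ s, b i) (w.map_le_sum fun i _ => hb i) := by
  classical
  induction s using Finset.induction_on with
  | empty => exact (homog_zero w α).symm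
  | insert i s hi ih =>
    rw [Finset.sum_insert hi, ih, ← homog_add]
    exact homog_congr w rfl (Finset.sum_insert hi).symm _ _

theorem homog_pow (w : AddValuation K[X] (WithTop L)) {φ : K[X]} {γ : L} (hγ : w φ = γ) (i : ℕ) :
    initial w φ ^ i = homog w (i • γ) (φ ^ i) (by
      rw [w.map_pow, hγ]; exact (WithTop.coe_nsmul _ _).le) := by
  rw [← initial_pow]
  exact initial_eq_homog w (by rw [w.map_pow, hγ]; exact (WithTop.coe_nsmul _ _).symm)

section Values

variable {w : AddValuation K[X] (WithTop L)} {φ : K[X]} {γ : L} (hγ : w φ = γ)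
include hγ

theorem coe_sub_le_iff (α : L) (a : K[X]) (i : ℕ) :
    ((α - i • γ : L) : WithTop L) ≤ w a ↔ (α : WithTop L) ≤ w (a * φ ^ i) := by
  rw [w.map_mul, w.map_pow, hγ]
  cases w a with
  | top => simp
  | coe x => norm_cast; rw [sub_le_iff_le_add]

theorem coe_sub_lt_iff (α : L) (a : K[X]) (i : ℕ) :
    ((α - i • γ : L) : WithTop L) < w a ↔ (α : WithTop L) < w (a * φ ^ i) := by
  rw [w.map_mul, w.map_pow, hγ]
  cases w a with
  | top => rw [top_add]; simp only [WithTop.coe_lt_top]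
  | coe x => norm_cast; rw [sub_lt_iff_lt_add]

theorem eq_coe_sub_iff (α : L) (a : K[X]) (i : ℕ) :
    w a = ((α - i • γ : L) : WithTop L) ↔ w (a * φ ^ i) = α := by
  rw [w.map_mul, w.map_pow, hγ]
  cases w a with
  | top => rw [top_add]; simp only [WithTop.top_ne_coe]
  | coe x => norm_cast; rw [eq_sub_iff_add_eq]

theorem homog_mul_initial_pow {α : L} {a : K[X]} {i : ℕ}
    (ha : ((α - i • γ : L) : WithTop L) ≤ w a) :
    homog w (α - i • γ) a ha * initial w φ ^ i =
      homog w α (a * φ ^ i) ((coe_sub_le_iff hγ α a i).1 ha) := by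
  rw [homog_pow w hγ, ← homog_mul]
  exact homog_congr w (by abel) rfl _ _

end Values

/-- The class of `a` in degree `α`, with the value `0` if `a` does not belong to `P_α`. -/
noncomputable def homogD (w : AddValuation K[X] (WithTop L)) (α : L) (a : K[X]) : AssocGraded w :=
  open Classical in if h : (α : WithTop L) ≤ w a then homog w α a h else 0

theorem homogD_of_le (w : AddValuation K[X] (WithTop L)) {α : L} {a : K[X]}
    (h : (α : WithTop L) ≤ w a) : homogD w α a = homog w α a h := dif_pos h

theorem homogD_zero (w : AddValuation K[X] (WithTop L)) (α : L) : homogD w α 0 = 0 := by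
  rw [homogD_of_le w (by simp), homog_zero]

/-- The expansion of the class of `f` in degree `α` as a polynomial in `in(φ)`, whose coefficients are
the classes of the coefficients of the `φ`-expansion of `f`. Here `γ` is the value of `φ`. -/
noncomputable def gradedExpansion (w : AddValuation K[X] (WithTop L)) (φ : K[X]) (γ α : L)
    (f : K[X]) : (AssocGraded w)[X] :=
  ∑ i ∈ Finset.range (f.natDegree + 1), monomial i (homogD w (α - i • γ) (adicCoeff φ f i))

instance nontrivial_assocGraded (w : AddValuation K[X] (WithTop L)) : Nontrivial (AssocGraded w) :=
  ⟨⟨1, 0, by rw [← initial_one]; exact initial_ne_zero w (by simp)⟩⟩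

namespace IsMinimalKeyPolynomial

variable {w : AddValuation K[X] (WithTop L)} {φ : K[X]} (h : IsMinimalKeyPolynomial w φ)

/-- The classes of degree `α` of polynomials of degree less than `deg φ`. -/
def constants (α : L) : AddSubgroup (AssocGraded w) where
  carrier := {y | ∃ (a : K[X]) (ha : (α : WithTop L) ≤ w a), a.degree < φ.degree ∧
    homog w α a ha = y}
  zero_mem' := ⟨0, by simp, h.degree_zero_lt, homog_zero w α⟩
  add_mem' := by
    rintro _ _ ⟨a, ha, hda, rfl⟩ ⟨b, hb, hdb, rfl⟩
    exact ⟨a + b, w.map_le_add ha hb, (degree_add_le _ _).trans_lt (max_lt hda hdb),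
      homog_add w ha hb⟩
  neg_mem' := by
    rintro _ ⟨a, ha, hda, rfl⟩
    exact ⟨-a, by rwa [w.map_neg], by rwa [degree_neg], homog_neg w ha⟩

theorem homogD_mem_constants (α : L) {a : K[X]} (hd : a.degree < φ.degree) :
    homogD w α a ∈ h.constants α := by
  unfold homogD
  split_ifs with ha
  · exact ⟨a, ha, hd, rfl⟩
  · exact zero_mem _

theorem mul_mem_constants {α β : L} {y z : AssocGraded w} (hy : y ∈ h.constants α)
    (hz : z ∈ h.constants β) : y * z ∈ h.constants (α + β) := by
  obtain ⟨a, ha, hda, rfl⟩ := hy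
  obtain ⟨b, hb, hdb, rfl⟩ := hz
  by_cases ha0 : a = 0
  · subst ha0; rw [homog_zero, zero_mul]; exact zero_mem _
  by_cases hb0 : b = 0
  · subst hb0; rw [homog_zero, mul_zero]; exact zero_mem _
  have hle : ((α + β : L) : WithTop L) ≤ w (a * b) := by
    rw [w.map_mul, WithTop.coe_add]; exact add_le_add ha hb
  refine ⟨(a * b) %ₘ φ, hle.trans (h.le_modByMonic _), degree_modByMonic_lt _ h.monic, ?_⟩
  rw [← homog_mul, homog_eq_homog_iff, w.map_sub_swap]
  exact hle.trans_lt (h.lt_mul_sub_modByMonic a b ha0 hb0 hda hdb)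

theorem exists_inv_constants {α : L} {y : AssocGraded w} (hy : y ∈ h.constants α) (hy0 : y ≠ 0) :
    ∃ z ∈ h.constants (-α), y * z = 1 := by
  obtain ⟨a, ha, hda, rfl⟩ := hy
  have hwa := (homog_ne_zero_iff w ha).1 hy0
  have ha0 : a ≠ 0 := by rintro rfl; exact hy0 (homog_zero w α)
  obtain ⟨b, hb0, hdb, hab⟩ := h.exists_initial_mul_eq_one ha0 hda
  have hwb : w b = ((-α : L) : WithTop L) := by
    obtain ⟨β, hβ⟩ := WithTop.ne_top_iff_exists.1 (h.ne_top_of_degree_lt hb0 hdb)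
    rw [← initial_mul, ← initial_one w, eq_comm, initial_eq_initial_iff w (by simp)] at hab
    have h1 := w.map_eq_of_lt_sub hab
    rw [w.map_mul, w.map_one, hwa, ← hβ, ← WithTop.coe_add, WithTop.coe_eq_zero] at h1
    rw [← hβ, eq_neg_of_add_eq_zero_right h1]
  refine ⟨initial w b, ⟨b, hwb.ge, hdb, (initial_eq_homog w hwb).symm⟩, ?_⟩
  rw [← hab, initial_eq_homog w hwa]

theorem mem_constants_zero_iff {y : AssocGraded w} :
    y ∈ h.constants 0 ↔ ∃ c, h.constToGraded c = y := by
  constructor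
  · rintro ⟨a, ha, hda, rfl⟩
    exact h.exists_constToGraded_eq ha hda
  · rintro ⟨c, rfl⟩
    obtain ⟨a, ha, hd, hc, -⟩ := h.exists_eq_homog c
    exact ⟨a, ha, hd, hc.symm⟩

/-- The initial term of a minimal key polynomial is transcendental over the constants. -/
theorem eq_zero_of_eval_initial {γ : L} (hγ : w φ = γ) (α : L) (T : (AssocGraded w)[X])
    (hT : ∀ i, T.coeff i ∈ h.constants (α - i • γ)) (h0 : T.eval (initial w φ) = 0) : T = 0 := by
  choose a ha hda hTa using hT
  have ha' := fun i => (coe_sub_le_iff hγ α (a i) i).1 (ha i)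
  have h1 : ∑ i ∈ Finset.range (T.natDegree + 1), homog w α (a i * φ ^ i) (ha' i) = 0 := by
    rw [← h0, eval_eq_sum_range]
    refine Finset.sum_congr rfl fun i _ => ?_
    rw [← hTa i, homog_mul_initial_pow hγ]
  rw [homog_sum, homog_eq_zero_iff] at h1
  ext i
  rw [coeff_zero]
  by_cases hi : i < T.natDegree + 1
  · have h2 := h1.trans_le (h.le_adicCoeff _ i)
    rw [adicCoeff_sum_mul_pow h.monic a hda, if_pos hi, ← coe_sub_lt_iff hγ] at h2
    rw [← hTa i]
    exact homog_eq_zero w _ _ h2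
  · exact coeff_eq_zero_of_natDegree_lt (by omega)

/-- The graded algebra of a valuation with a minimal key polynomial of torsion value. -/
noncomputable def gradedConstants {γ : L} (hγ : w φ = γ) (he : 0 < relRamificationIndex w)
    {u v : AssocGraded w} (hu : u ∈ h.constants (relRamificationIndex w • γ))
    (hv : v ∈ h.constants (-(relRamificationIndex w • γ))) (huv : u * v = 1) :
    GradedConstants h.ConstField (AssocGraded w) L where
  const := h.constants
  ι := h.constToGraded
  x := initial w φ
  γ := γ
  e := relRamificationIndex w
  u := u
  v := v
  mem_const_zero := fun _ => h.mem_constants_zero_iff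
  mul_mem := h.mul_mem_constants
  exists_inv := h.exists_inv_constants
  eq_zero_of_eval := h.eq_zero_of_eval_initial hγ
  e_pos := he
  u_mem := hu
  v_mem := hv
  u_mul_v := huv
  dvd := by
    rintro α i k _ _ ⟨a, ha, hda, rfl⟩ ⟨b, hb, hdb, rfl⟩ ha0 hb0
    have h1 := (homog_ne_zero_iff w ha).1 ha0
    have h2 := (homog_ne_zero_iff w hb).1 hb0
    refine h.relRamificationIndex_dvd_sub (a := a) (b := b) (i := i) ?_ ?_ hda hdb ?_
    · rintro rfl; exact ha0 (homog_zero w _)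
    · rintro rfl; exact hb0 (homog_zero w _)
    · rw [(eq_coe_sub_iff hγ _ _ _).1 h1, (eq_coe_sub_iff hγ _ _ _).1 h2]

variable {γ : L}

include h in
theorem coeff_gradedExpansion (α : L) (f : K[X]) (i : ℕ) :
    (gradedExpansion w φ γ α f).coeff i = homogD w (α - i • γ) (adicCoeff φ f i) := by
  rw [gradedExpansion, finsetSum_coeff]
  simp only [coeff_monomial]
  rw [Finset.sum_ite_eq']
  split_ifs with hi
  · rfl
  · rw [Finset.mem_range, not_lt] at hi
    rw [adicCoeff_eq_zero h.monic h.natDegree_pos f i (by omega), homogD_zero]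

theorem coeff_gradedExpansion_mem (α : L) (f : K[X]) (i : ℕ) :
    (gradedExpansion w φ γ α f).coeff i ∈ h.constants (α - i • γ) := by
  rw [h.coeff_gradedExpansion]
  exact h.homogD_mem_constants _ (degree_adicCoeff_lt h.monic f i)

include h in
theorem coe_sub_le_adicCoeff (hγ : w φ = γ) {α : L} {f : K[X]} (hα : (α : WithTop L) ≤ w f)
    (i : ℕ) : ((α - i • γ : L) : WithTop L) ≤ w (adicCoeff φ f i) :=
  (coe_sub_le_iff hγ _ _ _).2 (hα.trans (h.le_adicCoeff f i))

include h in
theorem eval_gradedExpansion (hγ : w φ = γ) {α : L} {f : K[X]} (hα : w f = α) :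
    (gradedExpansion w φ γ α f).eval (initial w φ) = initial w f := by
  have hle := h.coe_sub_le_adicCoeff hγ hα.ge
  have hle' := fun i => (coe_sub_le_iff hγ α _ i).1 (hle i)
  rw [initial_eq_homog w hα, gradedExpansion, eval_finsetSum]
  have h1 : ∀ i ∈ Finset.range (f.natDegree + 1),
      (monomial i (homogD w (α - i • γ) (adicCoeff φ f i))).eval (initial w φ) =
        homog w α (adicCoeff φ f i * φ ^ i) (hle' i) := by
    intro i _
    rw [eval_monomial, homogD_of_le w (hle i), homog_mul_initial_pow hγ]
  rw [Finset.sum_congr rfl h1, homog_sum]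
  exact homog_congr w rfl (sum_adicCoeff h.monic h.natDegree_pos f _ (Nat.lt_succ_self _)) _ _

include h in
theorem coeff_gradedExpansion_ne_zero_iff (hγ : w φ = γ) {α : L} {f : K[X]} (hα : w f = α) (i : ℕ) :
    (gradedExpansion w φ γ α f).coeff i ≠ 0 ↔ i ∈ minimalIndices w φ f := by
  rw [h.coeff_gradedExpansion, homogD_of_le w (h.coe_sub_le_adicCoeff hγ hα.ge i),
    homog_ne_zero_iff, eq_coe_sub_iff hγ]
  change _ ↔ w _ = w f
  rw [hα]

include h in
theorem coeff_gradedExpansion_of_mem (hγ : w φ = γ) {α : L} {f : K[X]} (hα : w f = α) {i : ℕ}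
    (hi : i ∈ minimalIndices w φ f) :
    (gradedExpansion w φ γ α f).coeff i = initial w (adicCoeff φ f i) := by
  rw [h.coeff_gradedExpansion, homogD_of_le w (h.coe_sub_le_adicCoeff hγ hα.ge i)]
  symm
  refine initial_eq_homog w ((eq_coe_sub_iff hγ _ _ _).2 ?_)
  rw [← hα]
  exact hi

/-- A normalizing unit is the class of a polynomial of degree less than `deg φ`. -/
theorem normalizingUnit_mem (hγ : w φ = γ) (he : 0 < relRamificationIndex w)
    {u : AssocGraded w} (hu : IsNormalizingUnit w φ u) :
    u ∈ h.constants (relRamificationIndex w • γ) := by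
  obtain ⟨hunit, b, hb, rfl⟩ := hu
  have hb' : w b = ((relRamificationIndex w • γ : L) : WithTop L) := by
    rw [hb, hγ]; exact (WithTop.coe_nsmul _ _).symm
  -- The degree `e γ` contains some invertible constant, possibly different from the given unit.
  obtain ⟨a, ha0, hda, ha⟩ := h.mem_valueGroupZero_iff.1
    ((h.relRamificationIndex_dvd_iff hγ _).1 dvd_rfl)
  have hmem : initial w a ∈ h.constants (relRamificationIndex w • γ) :=
    ⟨a, ha.ge, hda, (initial_eq_homog w ha).symm⟩
  obtain ⟨z, hz, haz⟩ := h.exists_inv_constants hmem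
    (initial_ne_zero w (h.ne_top_of_degree_lt ha0 hda))
  set D := h.gradedConstants hγ he hmem hz haz with hD
  obtain ⟨c, hc⟩ := (initial_dvd_initial_iff w (a := b) (b := 1) (by simp)).1
    (by rw [initial_one]; exact hunit.dvd)
  have hbc : initial w b * initial w c = 1 := by
    rw [← initial_mul, ← initial_one w]; exact (initial_congr w hc).symm
  have hct : w c ≠ ⊤ := by
    refine ne_top_of_initial_ne_zero w fun h0 => ?_
    rw [h0, mul_zero] at hbc
    exact zero_ne_one hbc
  obtain ⟨β, hβ⟩ := WithTop.ne_top_iff_exists.1 hct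
  set Tb := gradedExpansion w φ γ (relRamificationIndex w • γ) b
  set Tc := gradedExpansion w φ γ β c
  have hTb : D.IsHom (relRamificationIndex w • γ) Tb := h.coeff_gradedExpansion_mem _ b
  have hTc : D.IsHom β Tc := h.coeff_gradedExpansion_mem _ c
  have hsum : relRamificationIndex w • γ + β = 0 := by
    have h1 := w.map_eq_of_lt_sub hc
    rw [w.map_mul, hb', ← hβ, w.map_one] at h1
    exact_mod_cast h1
  have hone : Tb * Tc = 1 := by
    refine D.eq_of_eval_eq (α := 0) (hsum ▸ hTb.mul hTc) ?_ ?_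
    · rw [← C_1]; exact D.isHom_C D.one_mem
    · rw [eval_mul, eval_one]
      change Tb.eval (initial w φ) * Tc.eval (initial w φ) = 1
      rw [h.eval_gradedExpansion hγ hb', h.eval_gradedExpansion hγ hβ.symm, hbc]
  obtain ⟨y, hy, hTy⟩ := D.eq_C_of_mul_eq_one hTb hTc hone
  have : initial w b = y := by
    rw [← h.eval_gradedExpansion hγ hb']
    change Tb.eval _ = y
    rw [hTy, eval_C]
  rw [this]
  exact hy

end IsMinimalKeyPolynomial

end Expansion

/-! ### Residual polynomials and lifts of homogeneous primes -/

section Residual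

variable {K : Type*} [Field K] {L : Type*} [AddCommGroup L] [LinearOrder L] [IsOrderedAddMonoid L]

namespace IsMinimalKeyPolynomial

variable {w : AddValuation K[X] (WithTop L)} {φ : K[X]} (h : IsMinimalKeyPolynomial w φ)

section Indices

variable {γ : L} (hγ : w φ = γ) {g : K[X]} (hg : g.Monic) {N : ℕ}
  (hN : φ.natDegree * N = g.natDegree) (hwg : w g = ((N • γ : L) : WithTop L))
include h hγ hg hN hwg

theorem isGreatest_minimalIndices : IsGreatest (minimalIndices w φ g) N := by
  constructor
  · change w _ = w g
    rw [adicCoeff_eq_one hg h.monic h.natDegree_pos hN, one_mul, w.map_pow, hγ, hwg]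
    exact (WithTop.coe_nsmul _ _).symm
  · intro i hi
    by_contra hlt
    change w _ = w g at hi
    rw [adicCoeff_eq_zero_of_lt hg h.monic h.natDegree_pos hN (not_le.1 hlt), zero_mul, w.map_zero,
      hwg] at hi
    exact WithTop.top_ne_coe hi

/-- The residual coefficients of a monic polynomial whose Newton polygon is one-sided. -/
theorem residualCoeff_eq (h0 : 0 ∈ minimalIndices w φ g) (u : AssocGraded w) (j : ℕ)
    [Decidable (relRamificationIndex w * j ∈ minimalIndices w φ g)] :
    residualCoeff w φ u g j = if relRamificationIndex w * j ∈ minimalIndices w φ g then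
      Ring.inverse u ^ (N / relRamificationIndex w - j) *
        initial w (adicCoeff φ g (relRamificationIndex w * j)) else 0 := by
  have hinf : sInf (minimalIndices w φ g) = 0 := Nat.sInf_eq_zero.2 (Or.inl h0)
  have hsup : sSup (minimalIndices w φ g) = N :=
    (h.isGreatest_minimalIndices hγ hg hN hwg).csSup_eq
  unfold residualCoeff
  simp only [hinf, hsup, zero_add, Nat.sub_zero, mul_comm j]
  rw [adicCoeff_eq_one hg h.monic h.natDegree_pos hN, initial_one]
  have : Ring.inverse (1 : AssocGraded w) = 1 := Ring.inverse_one _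
  rw [this]
  split_ifs with hj
  · rw [one_mul]
  · rfl

theorem relRamificationIndex_dvd (h0 : 0 ∈ minimalIndices w φ g) : relRamificationIndex w ∣ N := by
  have hN' := (h.isGreatest_minimalIndices hγ hg hN hwg).1
  have ht : w g ≠ ⊤ := by rw [hwg]; exact WithTop.coe_ne_top
  have hne : ∀ i ∈ minimalIndices w φ g, adicCoeff φ g i ≠ 0 := by
    intro i hi hz
    change w _ = w g at hi
    rw [hz, zero_mul, w.map_zero] at hi
    exact ht hi.symm
  refine h.relRamificationIndex_dvd_sub (hne 0 h0) (hne N hN') (degree_adicCoeff_lt h.monic g 0)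
    (degree_adicCoeff_lt h.monic g N) (i := 0) ?_
  rw [zero_add]
  exact Eq.trans h0 (Eq.symm hN')

/-- The residual coefficients vanish exactly at the indices outside of `S`. -/
theorem residualCoeff_ne_zero_iff (h0 : 0 ∈ minimalIndices w φ g) {u : AssocGraded w}
    (hu : IsUnit u) (j : ℕ) :
    residualCoeff w φ u g j ≠ 0 ↔ relRamificationIndex w * j ∈ minimalIndices w φ g := by
  classical
  rw [h.residualCoeff_eq hγ hg hN hwg h0]
  split_ifs with hj
  · refine iff_of_true ?_ hj
    have ha : adicCoeff φ g (relRamificationIndex w * j) ≠ 0 := by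
      intro hz
      change w _ = w g at hj
      rw [hz, zero_mul, w.map_zero, hwg] at hj
      exact WithTop.top_ne_coe hj
    exact ((hu.ringInverse.pow _).mul
      (h.isUnit_initial ha (degree_adicCoeff_lt h.monic g _))).ne_zero
  · exact iff_of_false (by simp) hj

end Indices

section Lift

variable {γ : L} (hγ : w φ = γ) (he : 0 < relRamificationIndex w)
  {u v : AssocGraded w} (hu : u ∈ h.constants (relRamificationIndex w • γ))
  (hv : v ∈ h.constants (-(relRamificationIndex w • γ))) (huv : u * v = 1)

theorem ringInverse_eq_of_mul_eq_one {R : Type*} [CommRing R] {a b : R} (hab : a * b = 1) :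
    Ring.inverse a = b := by
  have hu : IsUnit a := IsUnit.of_mul_eq_one _ hab
  calc Ring.inverse a = Ring.inverse a * (a * b) := by rw [hab, mul_one]
    _ = b := by rw [← mul_assoc, Ring.inverse_mul_cancel _ hu, one_mul]

/-- The homogeneous element `u ^ d p(in(φ) ^ e u⁻¹)`, for `d = deg p`, as a polynomial in `in(φ)`. -/
noncomputable def homogenize (p : h.ConstField[X]) : (AssocGraded w)[X] :=
  C (u ^ p.natDegree) * (h.gradedConstants hγ he hu hv huv).lift p

theorem coeff_homogenize_mul (p : h.ConstField[X]) (j : ℕ) :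
    (h.homogenize hγ he hu hv huv p).coeff (relRamificationIndex w * j) =
      u ^ p.natDegree * (h.constToGraded (p.coeff j) * v ^ j) := by
  rw [homogenize, coeff_C_mul]
  congr 1
  exact (h.gradedConstants hγ he hu hv huv).lift_coeff_mul p j

theorem coeff_homogenize_of_not_dvd (p : h.ConstField[X]) {i : ℕ}
    (hi : ¬ relRamificationIndex w ∣ i) : (h.homogenize hγ he hu hv huv p).coeff i = 0 := by
  rw [homogenize, coeff_C_mul, GradedConstants.lift_coeff]
  rw [if_neg (by exact hi), mul_zero]

theorem isHom_homogenize (p : h.ConstField[X]) (i : ℕ) :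
    (h.homogenize hγ he hu hv huv p).coeff i ∈
      h.constants ((relRamificationIndex w * p.natDegree) • γ - i • γ) := by
  set D := h.gradedConstants hγ he hu hv huv
  have h1 := (D.isHom_C (D.pow_mem D.u_mem p.natDegree)).mul (D.isHom_lift p) i
  have e : p.natDegree • D.e • D.γ + 0 = (relRamificationIndex w * p.natDegree) • γ := by
    rw [add_zero, mul_comm, mul_nsmul]
    exact nsmul_left_comm _ _ _
  rw [e] at h1
  exact h1

/-- A homogeneous element `u ^ d p(in(φ) ^ e u⁻¹)` with `p` monic is the initial term of a monic
polynomial. -/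
theorem exists_monic_initial_eq {p : h.ConstField[X]} (hp : p.Monic) :
    ∃ Q : K[X], Q.Monic ∧ φ.natDegree * (relRamificationIndex w * p.natDegree) = Q.natDegree ∧
      w Q = (((relRamificationIndex w * p.natDegree) • γ : L) : WithTop L) ∧
      initial w Q = (h.homogenize hγ he hu hv huv p).eval (initial w φ) := by
  set M := relRamificationIndex w * p.natDegree with hM
  set T := h.homogenize hγ he hu hv huv p with hT
  have hTM : T.coeff M = 1 := by
    rw [hT, hM, h.coeff_homogenize_mul, hp.coeff_natDegree, map_one, one_mul, ← mul_pow, huv, one_pow]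
  -- The coefficients are lifted one by one, the leading one to `1`.
  have hex : ∀ i, ∃ (a : K[X]) (ha : ((M • γ - i • γ : L) : WithTop L) ≤ w a),
      a.degree < φ.degree ∧ homog w _ a ha = T.coeff i ∧ (i = M → a = 1) := by
    intro i
    by_cases hi : i = M
    · subst hi
      refine ⟨1, by simp, h.degree_one_lt, ?_, fun _ => rfl⟩
      rw [hTM, ← homog_one w]
      exact homog_congr w (sub_self _) rfl _ _
    · obtain ⟨a, ha, hd, hTa⟩ := h.isHom_homogenize hγ he hu hv huv p i
      exact ⟨a, ha, hd, hTa, fun h => absurd h hi⟩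
  choose a ha hda hTa haM using hex
  have ha' := fun i => (coe_sub_le_iff hγ _ (a i) i).1 (ha i)
  set R := ∑ i ∈ Finset.range M, a i * φ ^ i with hR
  set Q := ∑ i ∈ Finset.range (M + 1), a i * φ ^ i with hQ
  have hQR : Q = φ ^ M + R := by
    rw [hQ, Finset.sum_range_succ, haM M rfl, one_mul, add_comm]
  have hRd : R.degree < (φ ^ M).degree := by
    rw [degree_eq_natDegree (h.monic.pow M).ne_zero, h.monic.natDegree_pow]
    exact degree_sum_mul_pow_lt h.monic a hda M
  obtain ⟨hQm, hQd⟩ := Monic.add_of_degree_lt (h.monic.pow M) hRd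
  rw [← hQR] at hQm hQd
  have hle : ((M • γ : L) : WithTop L) ≤ w Q := w.map_le_sum fun i _ => ha' i
  have hwQ : w Q = ((M • γ : L) : WithTop L) := by
    refine le_antisymm ?_ hle
    have h1 := h.le_adicCoeff Q M
    rw [hQ, adicCoeff_sum_mul_pow h.monic a hda, if_pos (Nat.lt_succ_self _), haM M rfl, one_mul,
      w.map_pow, hγ] at h1
    exact h1.trans_eq (WithTop.coe_nsmul _ _).symm
  refine ⟨Q, hQm, by rw [hQd, h.monic.natDegree_pow, mul_comm], hwQ, ?_⟩
  have hTdeg : T.natDegree < M + 1 := by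
    refine Nat.lt_succ_of_le (natDegree_le_iff_coeff_eq_zero.2 fun i hi => ?_)
    by_cases hei : relRamificationIndex w ∣ i
    · obtain ⟨j, rfl⟩ := hei
      rw [hT, h.coeff_homogenize_mul, coeff_eq_zero_of_natDegree_lt, map_zero, zero_mul, mul_zero]
      exact lt_of_mul_lt_mul_left hi (Nat.zero_le _)
    · exact h.coeff_homogenize_of_not_dvd hγ he hu hv huv p hei
  rw [eval_eq_sum_range' hTdeg, initial_eq_homog w hwQ]
  have h1 : ∀ i ∈ Finset.range (M + 1), T.coeff i * initial w φ ^ i =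
      homog w _ (a i * φ ^ i) (ha' i) := by
    intro i _
    rw [← hTa i, homog_mul_initial_pow hγ]
  rw [Finset.sum_congr rfl h1, homog_sum]

variable {p : h.ConstField[X]} {Q : K[X]}
  (hwQ : w Q = (((relRamificationIndex w * p.natDegree) • γ : L) : WithTop L))
  (hQi : initial w Q = (h.homogenize hγ he hu hv huv p).eval (initial w φ))
include hwQ hQi

theorem gradedExpansion_eq_homogenize :
    gradedExpansion w φ γ ((relRamificationIndex w * p.natDegree) • γ) Q =
      h.homogenize hγ he hu hv huv p := by
  refine (h.gradedConstants hγ he hu hv huv).eq_of_eval_eq (h.coeff_gradedExpansion_mem _ Q)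
    (h.isHom_homogenize hγ he hu hv huv p) ?_
  change eval (initial w φ) _ = eval (initial w φ) _
  rw [h.eval_gradedExpansion hγ hwQ, hQi]

/-- A monic polynomial with initial term `u ^ d p(in(φ) ^ e u⁻¹)` has residual polynomial `p`. -/
theorem isResidualPolynomial_map (hp0 : p.coeff 0 ≠ 0) (hQ : Q.Monic)
    (hQd : φ.natDegree * (relRamificationIndex w * p.natDegree) = Q.natDegree) :
    IsResidualPolynomial w φ u Q (p.map h.constToKappa) := by
  classical
  have hT := h.gradedExpansion_eq_homogenize hγ he hu hv huv hwQ hQi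
  have hS := h.coeff_gradedExpansion_ne_zero_iff hγ hwQ
  rw [hT] at hS
  have hu1 : IsUnit u := IsUnit.of_mul_eq_one _ huv
  have hv1 : IsUnit v := IsUnit.of_mul_eq_one u (by rw [mul_comm, huv])
  have hι : Function.Injective h.constToGraded := h.constToGraded.injective
  have h0 : 0 ∈ minimalIndices w φ Q := by
    rw [← hS 0]
    have := h.coeff_homogenize_mul hγ he hu hv huv p 0
    rw [mul_zero] at this
    rw [this, pow_zero, mul_one]
    intro hz
    rw [(hu1.pow _).mul_right_eq_zero] at hz
    exact hp0 (hι (by rw [hz, map_zero]))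
  intro j
  obtain ⟨δ, hδ1, hδ2⟩ := h.exists_gradeZero (p.coeff j)
  refine ⟨δ, ?_, ?_⟩
  · rw [hδ1, h.residualCoeff_eq hγ hQ hQd hwQ h0]
    split_ifs with hj
    · have hjd : j ≤ p.natDegree := by
        have := (h.isGreatest_minimalIndices hγ hQ hQd hwQ).2 hj
        exact le_of_mul_le_mul_left this he
      rw [← h.coeff_gradedExpansion_of_mem hγ hwQ hj, hT, h.coeff_homogenize_mul,
        ringInverse_eq_of_mul_eq_one huv, Nat.mul_div_cancel_left _ he]
      calc h.constToGraded (p.coeff j)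
          = (u * v) ^ p.natDegree * h.constToGraded (p.coeff j) := by rw [huv, one_pow, one_mul]
        _ = (u ^ p.natDegree * v ^ (p.natDegree - j + j)) * h.constToGraded (p.coeff j) := by
            rw [Nat.sub_add_cancel hjd, mul_pow]
        _ = _ := by rw [pow_add]; ring
    · have := (hS (relRamificationIndex w * j)).not.2 hj
      rw [not_not, h.coeff_homogenize_mul, (hu1.pow _).mul_right_eq_zero,
        (hv1.pow _).mul_left_eq_zero] at this
      exact this
  · rw [hδ2, coeff_map, h.coe_constToKappa]

/-- A monic polynomial with initial term `u ^ d p(in(φ) ^ e u⁻¹)` is a key polynomial if `p` is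
irreducible and different from the variable. -/
theorem isKeyPolynomial_of_irreducible (hp : Irreducible p) (hp0 : p.coeff 0 ≠ 0) (hQ : Q.Monic)
    (hQd : φ.natDegree * (relRamificationIndex w * p.natDegree) = Q.natDegree) :
    IsKeyPolynomial w Q := by
  set D := h.gradedConstants hγ he hu hv huv with hD
  have hT : D.IsHom _ (h.homogenize hγ he hu hv huv p) := h.isHom_homogenize hγ he hu hv huv p
  have hQt : w Q ≠ ⊤ := by rw [hwQ]; exact WithTop.coe_ne_top
  -- Divisibility by `in(Q)` is compared with divisibility by `lift p` among the expansions in `in(φ)`.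
  have hmono : ∀ {f : K[X]} {α : L}, w f = α → initial w Q ∣ initial w f → ∃ (β : L)
      (S : (AssocGraded w)[X]), D.IsHom β S ∧ gradedExpansion w φ γ α f = D.lift p * S := by
    intro f α hf hdvd
    have hft : w f ≠ ⊤ := by rw [hf]; exact WithTop.coe_ne_top
    obtain ⟨c, hc⟩ := (initial_dvd_initial_iff w hft).1 hdvd
    have hval := w.map_eq_of_lt_sub hc
    have hct : w c ≠ ⊤ := by
      intro hct
      rw [w.map_mul, hct, add_top] at hval
      exact hft hval.symm
    obtain ⟨β, hβ⟩ := WithTop.ne_top_iff_exists.1 hct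
    have hα : α = (relRamificationIndex w * p.natDegree) • γ + β := by
      rw [w.map_mul, hwQ, ← hβ, hf] at hval
      exact_mod_cast hval.symm
    have hSc : D.IsHom β (gradedExpansion w φ γ β c) := h.coeff_gradedExpansion_mem β c
    have hSf : D.IsHom α (gradedExpansion w φ γ α f) := h.coeff_gradedExpansion_mem α f
    refine ⟨_, _, (D.isHom_C (D.pow_mem D.u_mem p.natDegree)).mul hSc, ?_⟩
    have h1 : gradedExpansion w φ γ α f =
        h.homogenize hγ he hu hv huv p * gradedExpansion w φ γ β c := by
      refine D.eq_of_eval_eq hSf (hα ▸ hT.mul hSc) ?_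
      rw [eval_mul]
      change eval (initial w φ) _ = eval (initial w φ) _ * eval (initial w φ) _
      rw [h.eval_gradedExpansion hγ hf, h.eval_gradedExpansion hγ hβ.symm, ← hQi, ← initial_mul]
      exact initial_congr w hc
    rw [h1, homogenize]
    change C (u ^ p.natDegree) * D.lift p * _ = D.lift p * (C (u ^ p.natDegree) * _)
    ring
  have hback : ∀ {f : K[X]} {α : L}, w f = α → D.lift p ∣ gradedExpansion w φ γ α f →
      initial w Q ∣ initial w f := by
    rintro f α hf ⟨S, hS⟩
    rw [← h.eval_gradedExpansion hγ hf, hS, eval_mul, hQi, homogenize, eval_mul, eval_C]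
    refine Dvd.dvd.mul_right ?_ _
    have hu1 : IsUnit (u ^ p.natDegree) := (IsUnit.of_mul_eq_one _ huv).pow _
    exact (hu1.mul_left_dvd).2 dvd_rfl
  have hlow : ∀ {f : K[X]} {α : L} {M : ℕ}, w f = α → (∀ i, M ≤ i → adicCoeff φ f i = 0) →
      initial w Q ∣ initial w f → relRamificationIndex w * p.natDegree < M := by
    intro f α M hf hM hdvd
    obtain ⟨β, S, hS, hfS⟩ := hmono hf hdvd
    have hTf0 : gradedExpansion w φ γ α f ≠ 0 := by
      intro hz
      have := h.eval_gradedExpansion hγ hf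
      rw [hz, eval_zero] at this
      exact initial_ne_zero w (by rw [hf]; exact WithTop.coe_ne_top) this.symm
    have hlt : (gradedExpansion w φ γ α f).natDegree < M := by
      rw [natDegree_lt_iff_degree_lt hTf0, degree_lt_iff_coeff_zero]
      intro i hi
      rw [h.coeff_gradedExpansion, hM i hi, homogD_zero]
    exact lt_of_le_of_lt (D.natDegree_le_of_lift_mul_eq hp0 (h.coeff_gradedExpansion_mem α f) hTf0
      hS hfS) hlt
  have hpd : 0 < p.natDegree := hp.natDegree_pos
  refine ⟨hQ, ?_, prime_initial_of_homogeneous w hQt ?_ ?_⟩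
  · intro f hf hfd hdvd
    have hft : w f ≠ ⊤ := by
      intro ht
      obtain ⟨i, hi⟩ : ∃ i, adicCoeff φ f i ≠ 0 := by
        by_contra! hall
        apply hf
        rw [← sum_adicCoeff h.monic h.natDegree_pos f _ (Nat.lt_succ_self _)]
        exact Finset.sum_eq_zero fun i _ => by rw [hall i, zero_mul]
      have h1 := h.le_adicCoeff f i
      rw [ht, top_le_iff, w.map_mul, w.map_pow, hγ, ← WithTop.coe_nsmul] at h1
      exact WithTop.add_ne_top.2
        ⟨h.ne_top_of_degree_lt hi (degree_adicCoeff_lt h.monic f i), WithTop.coe_ne_top⟩ h1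
    obtain ⟨α, hα⟩ := WithTop.ne_top_iff_exists.1 hft
    refine lt_irrefl _ (hlow hα.symm (fun i hi => ?_) hdvd)
    refine adicCoeff_eq_zero_of_degree_lt h.monic ?_ hi
    rwa [mul_comm, hQd, ← degree_eq_natDegree hQ.ne_zero]
  · intro hunit
    have hdvd : initial w Q ∣ initial w 1 := by rw [initial_one]; exact hunit.dvd
    have := hlow (α := 0) (M := 1) (by simp) (fun i hi => ?_) hdvd
    · have := Nat.mul_pos he hpd
      omega
    · obtain ⟨k, rfl⟩ : ∃ k, i = k + 1 := ⟨i - 1, by omega⟩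
      exact adicCoeff_succ_of_lt h.monic h.degree_one_lt k
  · intro b c hb hc hdvd
    obtain ⟨β, hβ⟩ := WithTop.ne_top_iff_exists.1 hb
    obtain ⟨δ, hδ⟩ := WithTop.ne_top_iff_exists.1 hc
    have hbc : w (b * c) = ((β + δ : L) : WithTop L) := by
      rw [w.map_mul, ← hβ, ← hδ, WithTop.coe_add]
    rw [← initial_mul] at hdvd
    obtain ⟨ε, S, hS, hbcS⟩ := hmono hbc hdvd
    have hHb : D.IsHom β (gradedExpansion w φ γ β b) := h.coeff_gradedExpansion_mem β b
    have hHc : D.IsHom δ (gradedExpansion w φ γ δ c) := h.coeff_gradedExpansion_mem δ c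
    have hne : ∀ {f : K[X]} {α : L}, w f = α → gradedExpansion w φ γ α f ≠ 0 := by
      intro f α hf hz
      have := h.eval_gradedExpansion hγ hf
      rw [hz, eval_zero] at this
      exact initial_ne_zero w (by rw [hf]; exact WithTop.coe_ne_top) this.symm
    have hprod : gradedExpansion w φ γ β b * gradedExpansion w φ γ δ c = D.lift p * S := by
      rw [← hbcS]
      refine D.eq_of_eval_eq (hHb.mul hHc) (h.coeff_gradedExpansion_mem (β + δ) (b * c)) ?_
      rw [eval_mul]
      change eval (initial w φ) _ * eval (initial w φ) _ = eval (initial w φ) _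
      rw [h.eval_gradedExpansion hγ hβ.symm, h.eval_gradedExpansion hγ hδ.symm,
        h.eval_gradedExpansion hγ hbc, initial_mul]
    rcases D.lift_dvd_or_dvd hp0 hp.prime hHb hHc (hne hβ.symm) (hne hδ.symm) hS hprod with h1 | h1
    · exact Or.inl (hback hβ.symm h1)
    · exact Or.inr (hback hδ.symm h1)

end Lift

end IsMinimalKeyPolynomial

end Residual

/-! ### Powers in the graded algebra, and Newton polygons -/

section Descent

variable {K : Type*} [Field K] {L : Type*} [AddCommGroup L] [LinearOrder L] [IsOrderedAddMonoid L]

namespace IsMinimalKeyPolynomial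

variable {w : AddValuation K[X] (WithTop L)} {φ : K[X]} (h : IsMinimalKeyPolynomial w φ)
  {γ : L} (hγ : w φ = γ) (he : 0 < relRamificationIndex w)
  {u v : AssocGraded w} (hu : u ∈ h.constants (relRamificationIndex w • γ))
  (hv : v ∈ h.constants (-(relRamificationIndex w • γ))) (huv : u * v = 1)

theorem homogenize_pow {p : h.ConstField[X]} (hp : p.Monic) (n : ℕ) :
    h.homogenize hγ he hu hv huv (p ^ n) = h.homogenize hγ he hu hv huv p ^ n := by
  rw [homogenize, homogenize, hp.natDegree_pow, mul_pow, ← C_pow, ← pow_mul, mul_comm n,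
    map_pow (h.gradedConstants hγ he hu hv huv).lift]

/-- A residual polynomial has coefficients in the field of constants, and it determines the initial
term. -/
theorem exists_homogenize_eq {g : K[X]} (hg : g.Monic) {N : ℕ}
    (hN : φ.natDegree * N = g.natDegree) (hwg : w g = ((N • γ : L) : WithTop L))
    (h0 : 0 ∈ minimalIndices w φ g) {P : (kappa w)[X]} (hP : IsResidualPolynomial w φ u g P) :
    ∃ p : h.ConstField[X], p.map h.constToKappa = P ∧ p.coeff 0 ≠ 0 ∧
      relRamificationIndex w * p.natDegree = N ∧
      initial w g = (h.homogenize hγ he hu hv huv p).eval (initial w φ) := by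
  classical
  set d := N / relRamificationIndex w with hd
  have hed : relRamificationIndex w * d = N :=
    Nat.mul_div_cancel' (h.relRamificationIndex_dvd hγ hg hN hwg h0)
  have hmax := h.isGreatest_minimalIndices hγ hg hN hwg
  have hu1 : IsUnit u := IsUnit.of_mul_eq_one _ huv
  have hle : ∀ j, relRamificationIndex w * j ∈ minimalIndices w φ g → j ≤ d := by
    intro j hj
    have := hmax.2 hj
    rw [← hed] at this
    exact le_of_mul_le_mul_left this he
  have hres := h.residualCoeff_eq hγ hg hN hwg h0 u
  rw [ringInverse_eq_of_mul_eq_one huv] at hres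
  have hconst : ∀ j, ∃ c : h.ConstField, h.constToGraded c = residualCoeff w φ u g j := by
    intro j
    rw [← h.mem_constants_zero_iff, hres]
    split_ifs with hj
    · set D := h.gradedConstants hγ he hu hv huv
      have h1 : v ^ (d - j) ∈ h.constants ((d - j) • -(relRamificationIndex w • γ)) :=
        D.pow_mem hv (d - j)
      have h2 := h.coeff_gradedExpansion_mem (γ := γ) (N • γ) g (relRamificationIndex w * j)
      rw [h.coeff_gradedExpansion_of_mem hγ hwg hj] at h2
      have h3 := h.mul_mem_constants h1 h2
      have e : (d - j) • -(relRamificationIndex w • γ) +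
          (N • γ - (relRamificationIndex w * j) • γ) = 0 := by
        have h4 : N = relRamificationIndex w * (d - j) + relRamificationIndex w * j := by
          rw [← mul_add, Nat.sub_add_cancel (hle j hj), hed]
        rw [h4, add_nsmul, add_sub_cancel_right, smul_neg, ← mul_nsmul, neg_add_cancel]
      rwa [e] at h3
    · exact zero_mem _
  choose c hc using hconst
  have hPc : ∀ j, P.coeff j = h.constToKappa (c j) := by
    intro j
    obtain ⟨δ, hδ1, hδ2⟩ := hP j
    apply Subtype.ext
    rw [← hδ2, h.coe_constToKappa]
    exact h.constToResidue_eq (by rw [hδ1, hc])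
  obtain ⟨p, hp⟩ := (mem_lifts P).1 ((lifts_iff_coeff_lifts P).2 fun j => ⟨c j, (hPc j).symm⟩)
  have hpc : ∀ j, p.coeff j = c j := by
    intro j
    apply h.constToKappa.injective
    refine Eq.trans ?_ (hPc j)
    rw [← hp, coeff_map]
    rfl
  have hp_ne : ∀ j, p.coeff j ≠ 0 ↔ relRamificationIndex w * j ∈ minimalIndices w φ g := by
    intro j
    rw [← h.residualCoeff_ne_zero_iff hγ hg hN hwg h0 hu1, ← hc, ← hpc]
    exact (map_ne_zero h.constToGraded).symm
  have hpd : p.natDegree = d := by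
    refine le_antisymm (natDegree_le_iff_coeff_eq_zero.2 fun j hj => ?_)
      (le_natDegree_of_ne_zero ((hp_ne d).2 (hed ▸ hmax.1)))
    by_contra hne
    exact absurd (hle j ((hp_ne j).1 hne)) (not_le.2 hj)
  refine ⟨p, hp, (hp_ne 0).2 (by rwa [mul_zero]), by rw [hpd, hed], ?_⟩
  have hS := h.coeff_gradedExpansion_ne_zero_iff hγ hwg
  rw [← h.eval_gradedExpansion hγ hwg]
  congr 1
  ext i
  by_cases hi : relRamificationIndex w ∣ i
  · obtain ⟨j, rfl⟩ := hi
    rw [h.coeff_homogenize_mul, hpc, hc, hpd, hres]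
    split_ifs with hj
    · rw [h.coeff_gradedExpansion_of_mem hγ hwg hj]
      calc initial w (adicCoeff φ g (relRamificationIndex w * j))
          = (u * v) ^ d * initial w (adicCoeff φ g (relRamificationIndex w * j)) := by
            rw [huv, one_pow, one_mul]
        _ = u ^ d * v ^ (d - j + j) * initial w (adicCoeff φ g (relRamificationIndex w * j)) := by
            rw [Nat.sub_add_cancel (hle j hj), mul_pow]
        _ = _ := by rw [pow_add]; ring
    · rw [zero_mul, mul_zero]
      by_contra hne
      exact hj ((hS _).1 hne)
  · rw [h.coeff_homogenize_of_not_dvd hγ he hu hv huv p hi]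
    by_contra hne
    have hD := (h.gradedConstants hγ he hu hv huv).dvd (α := N • γ) (i := 0) (k := i)
      (h.coeff_gradedExpansion_mem _ g 0)
      (by rw [zero_add]; exact h.coeff_gradedExpansion_mem _ g i) ((hS 0).2 h0) hne
    exact hi hD

include h hγ in
/-- If the residual polynomial of `g` is a power `ψ ^ n`, then the initial term of `g` is the `n`-th
power of the initial term of a key polynomial with residual polynomial `ψ`. -/
theorem exists_isKeyPolynomial_initial_pow {u : AssocGraded w} (hu : IsNormalizingUnit w φ u)
    {g : K[X]} (hg : g.Monic) {N : ℕ}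
    (hN : φ.natDegree * N = g.natDegree) (hN0 : 0 < N) (hwg : w g = ((N • γ : L) : WithTop L))
    (h0 : 0 ∈ minimalIndices w φ g) {ψ : (kappa w)[X]} (hψ : ψ.Monic) (hψ' : Irreducible ψ) {n : ℕ}
    (hn : n ∣ g.natDegree → w (n : K[X]) = 0)
    (hR : IsResidualPolynomial w φ u g (ψ ^ n)) :
    w (n : K[X]) = 0 ∧ ∃ Q : K[X], Q.Monic ∧ Q.natDegree * n = g.natDegree ∧ IsKeyPolynomial w Q ∧
      initial w g = initial w Q ^ n ∧ ∀ Q' : K[X], Q'.Monic → Q'.natDegree = Q.natDegree →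
        initial w Q' = initial w Q → IsResidualPolynomial w φ u Q' ψ := by
  have he : 0 < relRamificationIndex w :=
    Nat.pos_of_dvd_of_pos (h.relRamificationIndex_dvd hγ hg hN hwg h0) hN0
  have humem := h.normalizingUnit_mem hγ he hu
  obtain ⟨v, hv, huv⟩ := h.exists_inv_constants humem hu.1.ne_zero
  obtain ⟨p, hp, hp0, hpN, hpi⟩ := h.exists_homogenize_eq hγ he humem hv huv hg hN hwg h0 hR
  have hpn : p.natDegree = n * ψ.natDegree := by
    rw [← natDegree_map h.constToKappa, hp, hψ.natDegree_pow]
  have hn0 : w (n : K[X]) = 0 := by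
    refine hn ⟨φ.natDegree * (relRamificationIndex w * ψ.natDegree), ?_⟩
    rw [← hN, ← hpN, hpn]; ring
  have hnF : (n : h.ConstField) ≠ 0 := by
    intro hz
    have h1 := congrArg h.constToResidue hz
    rw [map_natCast, map_zero, natCast_residue_eq_zero_iff] at h1
    exact h1 hn0
  obtain ⟨ψ₀, hψ₀, hψ₀ψ, hpψ⟩ := exists_map_eq_of_pow h.constToKappa hψ hψ'.natDegree_pos hnF hp
  have hirr : Irreducible ψ₀ :=
    hψ₀.irreducible_of_irreducible_map h.constToKappa ψ₀ (by rwa [hψ₀ψ])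
  have hψ₀0 : ψ₀.coeff 0 ≠ 0 := by
    intro hz
    apply hp0
    rw [hpψ, coeff_zero_eq_eval_zero, eval_pow, ← coeff_zero_eq_eval_zero, hz, zero_pow]
    rintro rfl
    simp at hnF
  obtain ⟨Q, hQ, hQd, hwQ, hQi⟩ := h.exists_monic_initial_eq hγ he humem hv huv hψ₀
  refine ⟨hn0, Q, hQ, ?_, h.isKeyPolynomial_of_irreducible hγ he humem hv huv hwQ hQi hirr hψ₀0 hQ hQd,
    ?_, ?_⟩
  · rw [← hN, ← hpN, ← hQd, hpψ, hψ₀.natDegree_pow]; ring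
  · rw [hpi, hQi, hpψ, h.homogenize_pow hγ he humem hv huv hψ₀, eval_pow]
  · intro Q' hQ' hd' hi'
    have hwQ' : w Q' = w Q := by
      have hne : w Q ≠ ⊤ := by rw [hwQ]; exact WithTop.coe_ne_top
      exact w.map_eq_of_lt_sub ((initial_eq_initial_iff w hne).1 hi'.symm)
    rw [← hψ₀ψ]
    exact h.isResidualPolynomial_map hγ he humem hv huv (hwQ'.trans hwQ) (hi'.trans hQi) hψ₀0 hQ'
      (hQd.trans hd'.symm)

end IsMinimalKeyPolynomial

/-- Tschirnhaus substitutions do not change the initial term of a key polynomial `Q` such that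
`in(g) = in(Q) ^ n`. -/
theorem exists_isApproximateRoot_initial_eq {w : AddValuation K[X] (WithTop L)} {g Q : K[X]}
    (hg : g.Monic) {n : ℕ} (hn : w (n : K[X]) = 0) (hQ : IsKeyPolynomial w Q)
    (hd : Q.natDegree * n = g.natDegree) (hi : initial w g = initial w Q ^ n) :
    ∃ R : K[X], IsApproximateRoot g n R ∧ initial w R = initial w Q := by
  have hn0 : (n : K) ≠ 0 := by
    intro hz
    rw [← C_eq_natCast, hz, C_0, w.map_zero] at hn
    exact WithTop.top_ne_zero hn
  have hnpos : 0 < n := Nat.pos_of_ne_zero (by rintro rfl; simp at hn0)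
  have hgt : w g ≠ ⊤ := by
    refine ne_top_of_initial_ne_zero w ?_
    rw [hi, ← initial_pow]
    refine initial_ne_zero w ?_
    rw [w.map_pow]
    obtain ⟨β, hβ⟩ := WithTop.ne_top_iff_exists.1 hQ.ne_top
    rw [← hβ, ← WithTop.coe_nsmul]
    exact WithTop.coe_ne_top
  have hinv : w (C (n : K)⁻¹) = 0 := by
    have h1 : w (C (n : K)⁻¹ * (n : K[X])) = 0 := by
      rw [← C_eq_natCast, ← C_mul, inv_mul_cancel₀ hn0, C_1, w.map_one]
    rwa [w.map_mul, hn, add_zero] at h1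
  refine exists_isApproximateRoot_of_tschirnhaus hg hQ.natDegree_pos hd hn0
    (fun R => initial w R = initial w Q) ?_ hQ.monic rfl rfl
  intro R hR hRd hRi
  have hRk : IsKeyPolynomial w R := hQ.of_initial_eq hR
    (by rw [degree_eq_natDegree hR.ne_zero, degree_eq_natDegree hQ.monic.ne_zero, hRd]) hRi
  rw [← hRi, ← initial_pow, initial_eq_initial_iff w hgt, w.map_sub_swap] at hi
  obtain ⟨β, hβ⟩ := WithTop.ne_top_iff_exists.1 hRk.ne_top
  have hwg : w g = ((n • β : L) : WithTop L) := by
    rw [← w.map_eq_of_lt_sub (by rwa [w.map_sub_swap] at hi : w g < w (R ^ n - g)), w.map_pow, ← hβ]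
    exact (WithTop.coe_nsmul _ _).symm
  have h1 := hi.trans_le (hRk.le_adicCoeff (g - R ^ n) (n - 1))
  rw [adicCoeff_sub_pow hR hRk.natDegree_pos (by omega), w.map_mul, w.map_pow, hwg, ← hβ] at h1
  have h2 : (β : WithTop L) < w (adicCoeff R g (n - 1)) := by
    cases hx : w (adicCoeff R g (n - 1)) with
    | top => exact WithTop.coe_lt_top _
    | coe x =>
      rw [hx] at h1
      norm_cast at h1 ⊢
      obtain ⟨m, rfl⟩ : ∃ m, n = m + 1 := ⟨n - 1, by omega⟩
      rw [Nat.add_sub_cancel, succ_nsmul'] at h1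
      exact lt_of_add_lt_add_right h1
  change initial w _ = _
  rw [← hRi]
  refine (initial_congr w ?_).symm
  rw [add_sub_cancel_left, w.map_mul, hinv, zero_add, ← hβ]
  exact h2

end Descent

section Newton

/-- A half plane bounded by a vertical line, together with at most one point of this line. -/
theorem convex_halfPlane_union {L : Type*} [AddCommGroup L] [Module ℚ L] (s c : ℚ) (x : WithTop L) :
    Convex ℚ {P : ℚ × L | c < s * P.1 ∨ (s * P.1 = c ∧ (P.2 : WithTop L) = x)} := by
  intro P hP P' hP' a b ha hb hab
  rcases ha.eq_or_lt with rfl | ha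
  · rw [zero_add] at hab; subst hab; simpa using hP'
  rcases hb.eq_or_lt with rfl | hb
  · rw [add_zero] at hab; subst hab; simpa using hP
  have hlin : s * (a • P + b • P').1 = a * (s * P.1) + b * (s * P'.1) := by
    change s * (a * P.1 + b * P'.1) = _
    ring
  have hc : c = a * c + b * c := by rw [← add_mul, hab, one_mul]
  rcases hP with h1 | ⟨h1, h1'⟩ <;> rcases hP' with h2 | ⟨h2, h2'⟩
  · left
    rw [hlin, hc]
    exact add_lt_add (mul_lt_mul_of_pos_left h1 ha) (mul_lt_mul_of_pos_left h2 hb)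
  · left
    rw [hlin, hc, h2]
    exact add_lt_add_left (mul_lt_mul_of_pos_left h1 ha) _
  · left
    rw [hlin, hc, h1]
    exact add_lt_add_right (mul_lt_mul_of_pos_left h2 hb) _
  · right
    refine ⟨by rw [hlin, h1, h2, ← hc], ?_⟩
    have : P.2 = P'.2 := by
      rw [← h1'] at h2'
      exact (WithTop.coe_injective h2').symm
    change ((a • P.2 + b • P'.2 : L) : WithTop L) = x
    rw [← this, ← add_smul, hab, one_smul, h1']

variable {K : Type*} [Field K] {L : Type*} [AddCommGroup L] [LinearOrder L] [IsOrderedAddMonoid L]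
  [Module ℚ L] [PosSMulMono ℚ L]

theorem convex_halfPlane (c lam : L) : Convex ℚ {P : ℚ × L | c ≤ P.2 + P.1 • lam} := by
  intro P hP P' hP' a b ha hb hab
  change c ≤ (a • P.2 + b • P'.2) + (a * P.1 + b * P'.1) • lam
  have e : (a • P.2 + b • P'.2) + (a * P.1 + b * P'.1) • lam =
      a • (P.2 + P.1 • lam) + b • (P'.2 + P'.1 • lam) := by
    rw [add_smul, smul_add, smul_add, mul_smul, mul_smul]; abel
  rw [e, show c = a • c + b • c by rw [← add_smul, hab, one_smul]]
  exact add_le_add (smul_le_smul_of_nonneg_left hP ha) (smul_le_smul_of_nonneg_left hP' hb)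

/-- If the Newton polygon of a monic polynomial is one-sided, then it joins the points of abscissa
`0` and `deg g / deg φ`. -/
theorem of_isOneSided_newtonPolygon {μ : AddValuation K[X] (WithTop L)} {φ g : K[X]} (hφ : φ.Monic)
    (h0 : 0 < φ.natDegree) (hg : g.Monic) {N : ℕ} (hN : φ.natDegree * N = g.natDegree) {lam : L}
    (hs : IsOneSided (newtonPolygon μ φ g) lam) :
    μ (adicCoeff φ g 0) = ((N • lam : L) : WithTop L) ∧
      ∀ i, ((N • lam : L) : WithTop L) ≤ μ (adicCoeff φ g i) + ((i • lam : L) : WithTop L) := by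
  obtain ⟨hs1, ⟨⟨⟨P₀, hP₀, hP₀0⟩, -⟩, -⟩⟩ := hs
  have hval : ∀ P ∈ newtonPolygon μ φ g, ∀ P' ∈ newtonPolygon μ φ g,
      P.2 + P.1 • lam = P'.2 + P'.1 • lam := by
    intro P hP P' hP'
    refine le_antisymm ?_ ?_
    · rw [hs1] at hP; exact hP.2 P' hP'
    · rw [hs1] at hP'; exact hP'.2 P hP
  have hzero : ∀ i, N < i → adicCoeff φ g i = 0 := fun i => adicCoeff_eq_zero_of_lt hg hφ h0 hN
  have hone : adicCoeff φ g N = 1 := adicCoeff_eq_one hg hφ h0 hN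
  have hcloudle : ∀ P ∈ newtonCloud μ φ g, ∃ i : ℕ, i ≤ N ∧ P.1 = i ∧
      μ (adicCoeff φ g i) = (P.2 : WithTop L) := by
    rintro P ⟨i, hi, hP⟩
    refine ⟨i, ?_, hi, hP⟩
    by_contra hlt
    rw [hzero i (not_le.1 hlt), μ.map_zero] at hP
    exact WithTop.top_ne_coe hP
  -- The right end point of the polygon.
  have hright : ((N : ℚ), (0 : L)) ∈ newtonPolygon μ φ g := by
    refine ⟨subset_convexHull _ _ ⟨N, rfl, by rw [hone, μ.map_one]; rfl⟩, fun β hβ => ?_⟩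
    have hsub : newtonCloud μ φ g ⊆ {P : ℚ × L | -(N : ℚ) < (-1) * P.1 ∨
        ((-1) * P.1 = -(N : ℚ) ∧ (P.2 : WithTop L) = 0)} := by
      intro P hP
      obtain ⟨i, hi, hPi, hPv⟩ := hcloudle P hP
      rcases hi.lt_or_eq with hi | rfl
      · left
        rw [hPi, neg_one_mul, neg_lt_neg_iff]
        exact_mod_cast hi
      · right
        refine ⟨by rw [hPi, neg_one_mul], ?_⟩
        rw [← hPv, hone, μ.map_one]
    rcases convexHull_min hsub (convex_halfPlane_union _ _ _) hβ with h1 | ⟨-, h1⟩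
    · change -(N : ℚ) < (-1) * (N : ℚ) at h1
      rw [neg_one_mul] at h1
      exact absurd h1 (lt_irrefl _)
    · have h2 : β = 0 := WithTop.coe_injective h1
      exact h2.ge
  -- The left end point of the polygon.
  have hP₀' : P₀ ∈ newtonPolygon μ φ g := hP₀.1
  have hleft : (P₀.2 : WithTop L) = μ (adicCoeff φ g 0) := by
    have hsub : newtonCloud μ φ g ⊆ {P : ℚ × L | (0 : ℚ) < 1 * P.1 ∨
        (1 * P.1 = 0 ∧ (P.2 : WithTop L) = μ (adicCoeff φ g 0))} := by
      rintro P ⟨i, hi, hP⟩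
      rcases Nat.eq_zero_or_pos i with rfl | hi0
      · right; exact ⟨by rw [hi]; simp, hP.symm⟩
      · left; rw [hi, one_mul]; exact_mod_cast hi0
    rcases convexHull_min hsub (convex_halfPlane_union _ _ _) hP₀'.1 with h1 | ⟨-, h1⟩
    · rw [hP₀0, mul_zero] at h1
      exact absurd h1 (lt_irrefl _)
    · exact h1
  have hNlam : ((N : ℚ), (0 : L)).2 + ((N : ℚ), (0 : L)).1 • lam = N • lam := by
    change 0 + (N : ℚ) • lam = _
    rw [zero_add, Nat.cast_smul_eq_nsmul]
  constructor
  · rw [← hleft]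
    have := hval P₀ hP₀' _ hright
    rw [hP₀0, zero_smul, add_zero, hNlam] at this
    rw [this]
  · -- A cloud point of least value lies on the polygon.
    obtain ⟨i₀, hi₀, hmin⟩ := Finset.exists_min_image (Finset.range (N + 1))
      (fun i => μ (adicCoeff φ g i) + ((i • lam : L) : WithTop L)) ⟨0, by simp⟩
    have hfin : μ (adicCoeff φ g i₀) ≠ ⊤ := by
      intro ht
      have := hmin N (by simp)
      rw [ht, top_add, top_le_iff, hone, μ.map_one, zero_add] at this
      exact WithTop.coe_ne_top this
    obtain ⟨α, hα⟩ := WithTop.ne_top_iff_exists.1 hfin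
    have hsub : newtonCloud μ φ g ⊆ {P : ℚ × L | α + i₀ • lam ≤ P.2 + P.1 • lam} := by
      intro P hP
      obtain ⟨i, hi, hPi, hPv⟩ := hcloudle P hP
      have := hmin i (Finset.mem_range.2 (by omega))
      rw [← hα, hPv] at this
      change α + i₀ • lam ≤ P.2 + P.1 • lam
      rw [hPi, Nat.cast_smul_eq_nsmul]
      exact_mod_cast this
    have hmem : ((i₀ : ℚ), α) ∈ newtonPolygon μ φ g := by
      refine ⟨subset_convexHull _ _ ⟨i₀, rfl, hα.symm⟩, fun β hβ => ?_⟩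
      have h1 : α + i₀ • lam ≤ β + (i₀ : ℚ) • lam := convexHull_min hsub (convex_halfPlane _ _) hβ
      rw [Nat.cast_smul_eq_nsmul] at h1
      exact le_of_add_le_add_right h1
    have hV : α + i₀ • lam = N • lam := by
      rw [← hNlam, ← hval _ hmem _ hright]
      change _ = α + (i₀ : ℚ) • lam
      rw [Nat.cast_smul_eq_nsmul]
    intro i
    by_cases hi : i < N + 1
    · have := hmin i (Finset.mem_range.2 hi)
      rw [← hα, ← WithTop.coe_add, hV] at this
      exact this
    · rw [hzero i (by omega), μ.map_zero, top_add]
      exact le_top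

end Newton

/-! ### Consecutive augmentations -/

section Steps

variable {K : Type*} [Field K] {L : Type*} [AddCommGroup L] [LinearOrder L] [IsOrderedAddMonoid L]

theorem natCast_value_eq_zero_of_dvd {w : AddValuation K[X] (WithTop L)} {m n : ℕ} (hmn : n ∣ m)
    (hm : w (m : K[X]) = 0) : w (n : K[X]) = 0 := by
  obtain ⟨k, rfl⟩ := hmn
  rw [Nat.cast_mul, w.map_mul] at hm
  exact (add_eq_zero_iff_of_nonneg (natCast_nonneg w n) (natCast_nonneg w k)).1 hm |>.1

theorem natCast_ne_zero_of_value_eq_zero {w : AddValuation K[X] (WithTop L)} {n : ℕ}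
    (hn : w (n : K[X]) = 0) : (n : K) ≠ 0 := by
  intro hz
  rw [← C_eq_natCast, hz, C_0, w.map_zero] at hn
  exact WithTop.top_ne_zero hn

theorem augment_natCast {μ : AddValuation K[X] (WithTop L)} {φ : K[X]} (h : IsKeyPolynomial μ φ)
    {γ : L} (hγ : μ φ < γ) (n : ℕ) : augment μ φ h γ hγ (n : K[X]) = μ (n : K[X]) :=
  augment_of_degree_lt h hγ
    ((degree_natCast_le n).trans_lt (natDegree_pos_iff_degree_pos.1 h.natDegree_pos))

section

variable {μ : AddValuation K[X] (WithTop L)} {φ : K[X]} (h : IsKeyPolynomial μ φ) {γ : L}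
  (hγ : μ φ < γ) {g : K[X]} {N : ℕ}
  (hg0 : μ (adicCoeff φ g 0) = ((N • γ : L) : WithTop L))
  (hge : ∀ i, ((N • γ : L) : WithTop L) ≤ μ (adicCoeff φ g i) + ((i • γ : L) : WithTop L))
include hg0 hge

theorem augment_eq_of_oneSided : augment μ φ h γ hγ g = ((N • γ : L) : WithTop L) := by
  refine le_antisymm ?_ ((le_augmentFun_iff h γ g _).2 hge)
  refine (augmentFun_le h γ g 0).trans_eq ?_
  rw [hg0, zero_nsmul, WithTop.coe_zero, add_zero]

theorem zero_mem_minimalIndices_of_oneSided :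
    0 ∈ minimalIndices (augment μ φ h γ hγ) φ g := by
  change augment μ φ h γ hγ _ = augment μ φ h γ hγ g
  rw [augment_eq_of_oneSided h hγ hg0 hge, pow_zero, mul_one,
    augment_of_degree_lt h hγ (degree_adicCoeff_lt h.monic g 0), hg0]

end

/-- If `g` is close to `Q ^ n`, its Newton polygon with respect to `Q` is steep. -/
theorem lt_of_initial_eq_pow {w : AddValuation K[X] (WithTop L)} {Q g : K[X]}
    (hQ : IsKeyPolynomial w Q) {n : ℕ} (hn : n ≠ 0) (hi : initial w g = initial w Q ^ n) {lam : L}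
    (h0 : w (adicCoeff Q g 0) = ((n • lam : L) : WithTop L)) : w Q < lam := by
  obtain ⟨β, hβ⟩ := WithTop.ne_top_iff_exists.1 hQ.ne_top
  have hpow : w (Q ^ n) = ((n • β : L) : WithTop L) := by
    rw [w.map_pow, ← hβ]; exact (WithTop.coe_nsmul _ _).symm
  rw [← initial_pow, eq_comm, initial_eq_initial_iff w (by rw [hpow]; exact WithTop.coe_ne_top),
    hpow] at hi
  have h1 := hi.trans_le (hQ.le_adicCoeff (g - Q ^ n) 0)
  rw [adicCoeff_sub_pow hQ.monic hQ.natDegree_pos (Ne.symm hn), pow_zero, mul_one, h0,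
    WithTop.coe_lt_coe] at h1
  rw [← hβ, WithTop.coe_lt_coe]
  exact lt_of_nsmul_lt_nsmul_right n h1

/-- If the residual polynomial of `g` with respect to an approximate root `Q` is a power `ψ ^ m`,
then `n = e deg(ψ) m` and `e deg(ψ) > 1`: otherwise the residual polynomial is `(y + c) ^ n` with
`c ≠ 0`, and its coefficient `n c` in degree `n - 1` does not vanish, although the coefficient of
`Q ^ (n - 1)` in `g` does. -/
theorem one_lt_of_isResidualPolynomial_pow {w : AddValuation K[X] (WithTop L)} {Q g : K[X]}
    (h : IsMinimalKeyPolynomial w Q) {γ : L} (hγ : w Q = γ) (hg : g.Monic) {n : ℕ}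
    (hn : w (n : K[X]) = 0) (hd : Q.natDegree * n = g.natDegree)
    (hcoeff : adicCoeff Q g (n - 1) = 0) (hwg : w g = ((n • γ : L) : WithTop L))
    (h0 : 0 ∈ minimalIndices w Q g) {u : AssocGraded w} (hu : IsUnit u) {ψ : (kappa w)[X]}
    (hψ : ψ.Monic) (hψ' : Irreducible ψ) {m : ℕ} (hR : IsResidualPolynomial w Q u g (ψ ^ m)) :
    relRamificationIndex w * ψ.natDegree * m = n ∧ 1 < relRamificationIndex w * ψ.natDegree := by
  have hnpos : 0 < n := by
    rcases Nat.eq_zero_or_pos n with rfl | hn'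
    · exact absurd Nat.cast_zero (natCast_ne_zero_of_value_eq_zero hn)
    · exact hn'
  have hmax := h.isGreatest_minimalIndices hγ hg hd hwg
  have he := h.relRamificationIndex_dvd hγ hg hd hwg h0
  have hepos : 0 < relRamificationIndex w := Nat.pos_of_dvd_of_pos he hnpos
  have hcoef : ∀ j, (ψ ^ m).coeff j ≠ 0 ↔ relRamificationIndex w * j ∈ minimalIndices w Q g := by
    intro j
    obtain ⟨δ, hδ1, hδ2⟩ := hR j
    rw [← h.residualCoeff_ne_zero_iff hγ hg hd hwg h0 hu, ← hδ1]
    have h1 : (ψ ^ m).coeff j = 0 ↔ gradeZeroToResidue w δ = 0 := by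
      rw [hδ2]; exact ZeroMemClass.coe_eq_zero.symm
    have h2 : gradeZeroToResidue w δ = 0 ↔ δ = 0 :=
      map_eq_zero_iff _ (gradeZeroToResidue_injective w)
    have h3 : gradeZeroToGraded w δ = 0 ↔ δ = 0 :=
      map_eq_zero_iff _ (gradeZeroToGraded_injective w)
    exact not_congr (h1.trans (h2.trans h3.symm))
  obtain ⟨d, hed⟩ := he
  have hdeg : (ψ ^ m).natDegree = d := by
    refine le_antisymm (natDegree_le_iff_coeff_eq_zero.2 fun j hj => ?_)
      (le_natDegree_of_ne_zero ((hcoef d).2 (hed ▸ hmax.1)))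
    by_contra hne
    have h1 := hmax.2 ((hcoef j).1 hne)
    have h2 : relRamificationIndex w * j ≤ relRamificationIndex w * d := by rwa [← hed]
    exact absurd (le_of_mul_le_mul_left h2 hepos) (not_le.2 hj)
  rw [hψ.natDegree_pow] at hdeg
  have hprod : relRamificationIndex w * ψ.natDegree * m = n := by rw [hed, ← hdeg]; ring
  refine ⟨hprod, ?_⟩
  by_contra hle
  have hψpos := hψ'.natDegree_pos
  have he1 : relRamificationIndex w = 1 := by nlinarith
  have hf1 : ψ.natDegree = 1 := by nlinarith
  rw [he1, hf1, one_mul, one_mul] at hprod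
  subst hprod
  rw [hψ.eq_X_add_C hf1] at hcoef
  have h1 : ((X + C (ψ.coeff 0)) ^ m).coeff (m - 1) = 0 := by
    by_contra hne
    have h2 : w _ = w g := (hcoef _).1 hne
    rw [he1, one_mul, hcoeff, zero_mul, w.map_zero, hwg] at h2
    exact WithTop.top_ne_coe h2
  have hmk : (m : kappa w) ≠ 0 := by
    intro hz
    have h2 : (m : ResidueFieldOf w) = 0 := by
      have h3 := congrArg (algebraMap (kappa w) (ResidueFieldOf w)) hz
      rwa [map_natCast, map_zero] at h3
    exact (natCast_residue_eq_zero_iff w m).1 h2 hn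
  have hc : ψ.coeff 0 = 0 := by
    rw [coeff_X_add_C_pow, show m - (m - 1) = 1 by omega, pow_one,
      Nat.choose_symm_of_eq_add (show m = (m - 1) + 1 by omega), Nat.choose_one_right] at h1
    exact (mul_eq_zero.1 h1).resolve_right hmk
  refine (hcoef 0).2 (by rwa [mul_zero]) ?_
  rw [hc, C_0, add_zero, coeff_X_pow, if_neg hnpos.ne]

/-- If the residual polynomial of `g` with respect to an approximate root `Q` is a power `ψ ^ m` of an
irreducible polynomial, then the `m`-th approximate root of `g` has larger degree than `Q`. -/
theorem IsApproximateRoot.exists_natDegree_lt {w : AddValuation K[X] (WithTop L)} {Q g : K[X]}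
    {n : ℕ} (hQ : IsApproximateRoot g n Q) (h : IsMinimalKeyPolynomial w Q) {γ : L} (hγ : w Q = γ)
    (hg : g.Monic) (hgpos : 0 < g.natDegree) (hgv : w (g.natDegree : K[X]) = 0)
    (hwg : w g = ((n • γ : L) : WithTop L)) (h0 : 0 ∈ minimalIndices w Q g) {u : AssocGraded w}
    (hu : IsUnit u) {ψ : (kappa w)[X]} (hψ : ψ.Monic) (hψ' : Irreducible ψ) {m : ℕ}
    (hR : IsResidualPolynomial w Q u g (ψ ^ m)) :
    m < n ∧ 1 < relRamificationIndex w * ψ.natDegree ∧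
      ∃ Q₁ : K[X], IsApproximateRoot g m Q₁ ∧
        (∀ Q' : K[X], IsApproximateRoot g m Q' → Q' = Q₁) ∧ Q.natDegree < Q₁.natDegree := by
  have hQpos := h.natDegree_pos
  have hn : n ≠ 0 := by rintro rfl; exact hQ.natCast_ne_zero Nat.cast_zero
  obtain ⟨hprod, hlt⟩ := one_lt_of_isResidualPolynomial_pow h hγ hg
    (natCast_value_eq_zero_of_dvd ⟨_, by rw [← hQ.natDegree_mul, mul_comm]⟩ hgv)
    hQ.natDegree_mul hQ.coeff_eq_zero hwg h0 hu hψ hψ' hR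
  generalize hr : relRamificationIndex w * ψ.natDegree = r at hprod hlt ⊢
  have hm : 0 < m := Nat.pos_of_ne_zero (by rintro rfl; omega)
  have hdeg : Q.natDegree * r * m = g.natDegree := by
    rw [← hQ.natDegree_mul, ← hprod, mul_assoc]
  have hK : (m : K) ≠ 0 := natCast_ne_zero_of_value_eq_zero
    (natCast_value_eq_zero_of_dvd ⟨_, by rw [← hdeg, mul_comm]⟩ hgv)
  obtain ⟨Q₁, hQ₁⟩ := exists_isApproximateRoot hg (Nat.mul_pos hQpos (by omega)) hdeg hK
  refine ⟨?_, hlt, Q₁, hQ₁, fun Q' hQ' => hQ₁.eq hg hgpos hQ', ?_⟩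
  · rw [← hprod]
    exact (Nat.lt_mul_iff_one_lt_left hm).2 hlt
  · rw [Nat.eq_of_mul_eq_mul_right hm (hQ₁.natDegree_mul.trans hdeg.symm)]
    exact (Nat.lt_mul_iff_one_lt_right hQpos).2 hlt

end Steps

end KeyPol

theorem mainTheorem5 {K Γ : Type*} [Field K]
    [AddCommGroup Γ] [LinearOrder Γ] [IsOrderedAddMonoid Γ]
    (v : AddValuation K (WithTop Γ)) (hv : ∀ γ : Γ, ∃ a : K, v a = γ)
    (μ : AddValuation K[X] (WithTop (DivisibleHull Γ)))
    (hμ : ∀ a : K, μ (C a) = (v a).map (fun γ : Γ => (γ : DivisibleHull Γ)))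
    (φ : K[X]) (hφ : IsKeyPolynomial μ φ)
    (g : K[X]) (hg : g.Monic) (hdeg : φ.natDegree ∣ g.natDegree)
    (hchar : ¬ ringChar (ResidueFieldOf μ) ∣ g.natDegree)
    (lam : DivisibleHull Γ) (hlam : μ φ < lam)
    (hN : IsOneSided (newtonPolygon μ φ g) lam)
    (μ₁ : AddValuation K[X] (WithTop (DivisibleHull Γ))) (hμ₁ : μ₁ = augment μ φ hφ lam hlam)
    (u : AssocGraded μ₁) (hu : IsNormalizingUnit μ₁ φ u)
    (ψ : (kappa μ₁)[X]) (hψ : ψ.Monic) (hψ' : Irreducible ψ)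
    (n : ℕ) (hR : IsResidualPolynomial μ₁ φ u g (ψ ^ n)) :
    ∃ Q : K[X], IsApproximateRoot g n Q ∧ (∀ Q' : K[X], IsApproximateRoot g n Q' → Q' = Q) ∧
      ∃ hQ : IsKeyPolynomial μ₁ Q,
        IsResidualPolynomial μ₁ φ u Q ψ ∧
        ∀ lam₁ : DivisibleHull Γ, IsOneSided (newtonPolygon μ₁ Q g) lam₁ →
          ∃ hlam₁ : μ₁ Q < lam₁,
            ∀ ν : AddValuation K[X] (WithTop (DivisibleHull Γ)), ν = augment μ₁ Q hQ lam₁ hlam₁ →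
            ∀ u₁ : AssocGraded ν, IsNormalizingUnit ν Q u₁ →
            ∀ ψ₁ : (kappa ν)[X], ψ₁.Monic → Irreducible ψ₁ →
            ∀ n₁ : ℕ, IsResidualPolynomial ν Q u₁ g (ψ₁ ^ n₁) →
              n₁ < n ∧
              1 < relRamificationIndex ν * ψ₁.natDegree ∧
              ∃ Q₁ : K[X], IsApproximateRoot g n₁ Q₁ ∧
                (∀ Q' : K[X], IsApproximateRoot g n₁ Q' → Q' = Q₁) ∧
                Q.natDegree < Q₁.natDegree := by
  subst hμ₁
  set μ₁ := augment μ φ hφ lam hlam with hμ₁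
  have hmin : IsMinimalKeyPolynomial μ₁ φ := isMinimalKeyPolynomial_augment hφ hlam
  have hγ : μ₁ φ = lam := augment_self hφ hlam
  -- The hypothesis on the characteristic makes `deg g`, and with it each of its divisors, a unit.
  have hgK : (g.natDegree : ResidueFieldOf μ) ≠ 0 := fun hz => hchar ((ringChar.spec _ _).1 hz)
  have hgv : μ (g.natDegree : K[X]) = 0 := by
    by_contra hne
    exact hgK ((natCast_residue_eq_zero_iff μ _).2 hne)
  have hgpos : 0 < g.natDegree := Nat.pos_of_ne_zero fun hz => hgK (by rw [hz, Nat.cast_zero])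
  obtain ⟨N, hN'⟩ := hdeg
  have hN0 : 0 < N := Nat.pos_of_ne_zero (by rintro rfl; omega)
  obtain ⟨hg0, hge⟩ := of_isOneSided_newtonPolygon hφ.monic hφ.natDegree_pos hg hN'.symm hN
  have hwg := augment_eq_of_oneSided hφ hlam hg0 hge
  have h0 := zero_mem_minimalIndices_of_oneSided hφ hlam hg0 hge
  obtain ⟨hn, Q₀, -, hQ₀d, hQ₀k, hQ₀i, hQ₀R⟩ :=
    hmin.exists_isKeyPolynomial_initial_pow hγ hu hg hN'.symm hN0 hwg h0 hψ hψ'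
      (fun hdvd => by
        rw [hμ₁, augment_natCast]; exact natCast_value_eq_zero_of_dvd hdvd hgv) hR
  obtain ⟨Q, hQ, hQi⟩ := exists_isApproximateRoot_initial_eq hg hn hQ₀k hQ₀d hQ₀i
  have hn0 : n ≠ 0 := by rintro rfl; exact hQ.natCast_ne_zero Nat.cast_zero
  have hQd : Q.natDegree = Q₀.natDegree := Nat.eq_of_mul_eq_mul_right (Nat.pos_of_ne_zero hn0)
    (hQ.natDegree_mul.trans hQ₀d.symm)
  have hQk : IsKeyPolynomial μ₁ Q := hQ₀k.of_initial_eq hQ.monic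
    (by rw [degree_eq_natDegree hQ.monic.ne_zero, degree_eq_natDegree hQ₀k.monic.ne_zero, hQd]) hQi
  refine ⟨Q, hQ, fun Q' hQ' => hQ.eq hg hgpos hQ', hQk, hQ₀R Q hQ.monic hQd hQi, ?_⟩
  intro lam₁ hN₁
  obtain ⟨hb0, hbe⟩ :=
    of_isOneSided_newtonPolygon hQ.monic hQk.natDegree_pos hg hQ.natDegree_mul hN₁
  have hlam₁ : μ₁ Q < lam₁ := lt_of_initial_eq_pow hQk hn0 (by rw [hQ₀i, hQi]) hb0
  refine ⟨hlam₁, ?_⟩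
  rintro ν rfl u₁ hu₁ ψ₁ hψ₁ hψ₁' n₁ hR₁
  exact hQ.exists_natDegree_lt (isMinimalKeyPolynomial_augment hQk hlam₁)
    (augment_self hQk hlam₁) hg hgpos (by rw [augment_natCast, hμ₁, augment_natCast]; exact hgv)
    (augment_eq_of_oneSided hQk hlam₁ hb0 hbe)
    (zero_mem_minimalIndices_of_oneSided hQk hlam₁ hb0 hbe) hu₁.1 hψ₁ hψ₁' hR₁
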